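/- \textbf{Setting.} Let $S$ be a category and let $J$ be a subcanonical singleton pretopology on $S$: a class of maps (the \emph{covers}) which contains the isomorphisms, is closed under composition, all of whose pullbacks along arbitrary maps exist and are again covers, and each of whose members is the colimit of its kernel pair. Pullbacks of covers are specified once and for all, with the convention that $A\times_A U=U$ and $B\times_A A=B$ when one of the two maps is an identity. For an internal category $X=(X_1\rightrightarrows X_0)$ in $S$ (the pullbacks of composable pairs and triples are assumed to exist, but $S$ need not have other limits) and a map $p\colon U\to X_0$, the \emph{base change} $X[U]$ has object of objects $U$ and object of arrows $U^2\times_{X_0^2}X_1$; for $p$ a cover it is formed with the specified pullbacks, as $U\times_{X_0}X_1\times_{X_0}U$, so that $X[X_0]=X$. $\mathrm{Cat}(S)$ denotes the 2-category of internal categories, functors and natural transformations, and $C\subseteq\mathrm{Cat}(S)$ is a full sub-2-category admitting base change along covers: for every $X$ in $C$ and every cover $U\to X_0$ some base change of $X$ along it lies in $C$. An \emph{anafunctor} $(U,f)$ from $X$ to $Y$ consists of a cover $U\to X_0$ and a functor $f\colon X[U]\to Y$. A \emph{transformation} $(U,f)\Rightarrow(V,g)$ is a natural transformation from $X[U\times_{X_0}V]\to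 X[U]\xrightarrow{f}Y$ to $X[U\times_{X_0}V]\to X[V]\xrightarrow{g}Y$. The composite of $(U,f)\colon X\to Y$ and $(V,g)\colon Y\to Z$ is $X[U\times_{Y_0}V]\to Y[V]\xrightarrow{g}Z$; transformations are composed vertically by descent, the composite having locally the component $(u,w)\mapsto\beta(v,w)\circ\alpha(u,v)$. This gives the bicategory $\mathrm{Cat}_{ana}(S,J)$ and its full sub-bicategory $C_{ana}(J)$ on the objects of $C$. A functor $f\colon X\to Y$ is \emph{fully faithful} if $X_1$ is the pullback of $(s,t)\colon Y_1\to Y_0^2$ along $f_0^2\colon X_0^2\to Y_0^2$; it is \emph{$J$-locally split} if there are a cover $U\to Y_0$, a functor $\bar f\colon Y[U]\to X$, and a natural isomorphism between $f\circ\bar f$ and the canonical functor $Y[U]\to Y$; it is a \emph{$J$-equivalence} if it is both. \textbf{Proposition.} There is a strict 2-functor \[\alpha_J\colon C\to C_{ana}(J)\] which is the identity on objects, sends a functor $f\colon X\to Y$ to the anafunctor $(X_0,f)$, and sends a natural transformation $a\colon f\Rightarrow g$ to the transformation with component $X_0\times_{X_0}X_0=X_0\xrightarrow{a}Y_1$.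 It sends every $J$-equivalence $f\colon X\to Y$ to an equivalence in $C_{ana}(J)$; more precisely, for every choice of a cover $U\to Y_0$, a functor $\bar f\colon Y[U]\to X$ and a natural isomorphism as in the definition of $J$-locally split, the anafunctor $(U,\bar f)\colon Y\to X$ is a pseudoinverse of $\alpha_J(f)=(X_0,f)$. The same formulas define a strict 2-functor $\mathrm{Cat}(S)\to\mathrm{Cat}_{ana}(S,J)$, and $\alpha_J$ commutes with it and with the inclusions: the composites $C\to C_{ana}(J)\hookrightarrow\mathrm{Cat}_{ana}(S,J)$ and $C\hookrightarrow\mathrm{Cat}(S)\to\mathrm{Cat}_{ana}(S,J)$ are equal. -/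

import Mathlib

open CategoryTheory CategoryTheory.Limits

universe v u

namespace Anafunctors

variable {S : Type u} [Category.{v} S]

/-! ### Internal categories -/

/-- An internal category in `S`: `S` need not have pullbacks, so the existence of the objects of
composable pairs and of composable triples is part of the structure.  Composition `m` is written
in diagrammatic order, i.e. `m (a, b)` is defined when the target of `a` is the source of `b`. -/
structure InternalCat (S : Type u) [Category.{v} S] where
  /-- object of objects -/
  obj : S
  /-- object of arrows -/
  arr : S
  /-- source -/
  s : arr ⟶ obj
  /-- target -/
  t : arr ⟶ obj
  /-- unit -/
  e : obj ⟶ arr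
  e_s : e ≫ s = 𝟙 obj
  e_t : e ≫ t = 𝟙 obj
  [hasPairs : HasPullback t s]
  [hasTriples : HasPullback (pullback.snd t s ≫ t) s]
  /-- multiplication -/
  m : pullback t s ⟶ arr
  m_s : m ≫ s = pullback.fst t s ≫ s
  m_t : m ≫ t = pullback.snd t s ≫ t
  unit_left : pullback.lift (s ≫ e) (𝟙 arr) (by simp [e_t]) ≫ m = 𝟙 arr
  unit_right : pullback.lift (𝟙 arr) (t ≫ e) (by simp [e_s]) ≫ m = 𝟙 arr
  assoc :
    pullback.lift (pullback.fst (pullback.snd t s ≫ t) s ≫ m)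
        (pullback.snd (pullback.snd t s ≫ t) s)
        (by rw [Category.assoc, m_t, pullback.condition]) ≫ m =
      pullback.lift (pullback.fst (pullback.snd t s ≫ t) s ≫ pullback.fst t s)
        (pullback.lift (pullback.fst (pullback.snd t s ≫ t) s ≫ pullback.snd t s)
          (pullback.snd (pullback.snd t s ≫ t) s)
          (by rw [Category.assoc, pullback.condition]) ≫ m)
        (by rw [Category.assoc, Category.assoc, m_s, pullback.lift_fst_assoc, Category.assoc,
          pullback.condition]) ≫ m

attribute [instance] InternalCat.hasPairs InternalCat.hasTriples

namespace InternalCat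

variable (X : InternalCat S)

/-- Composition of two composable generalised elements of the object of arrows. -/
noncomputable def comp {T : S} (a b : T ⟶ X.arr) (h : a ≫ X.t = b ≫ X.s) : T ⟶ X.arr :=
  pullback.lift a b h ≫ X.m

theorem comp_s {T : S} (a b : T ⟶ X.arr) (h : a ≫ X.t = b ≫ X.s) :
    X.comp a b h ≫ X.s = a ≫ X.s := by
  rw [comp, Category.assoc, X.m_s, pullback.lift_fst_assoc]

theorem comp_t {T : S} (a b : T ⟶ X.arr) (h : a ≫ X.t = b ≫ X.s) :
    X.comp a b h ≫ X.t = b ≫ X.t := by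
  rw [comp, Category.assoc, X.m_t, pullback.lift_snd_assoc]

theorem precomp {T T' : S} (r : T' ⟶ T) (a b : T ⟶ X.arr) (h : a ≫ X.t = b ≫ X.s) :
    r ≫ X.comp a b h = X.comp (r ≫ a) (r ≫ b) (by simp [h]) := by
  unfold comp
  rw [← Category.assoc]
  congr 1
  apply pullback.hom_ext
  · rw [Category.assoc, pullback.lift_fst, pullback.lift_fst]
  · rw [Category.assoc, pullback.lift_snd, pullback.lift_snd]

theorem comp_congr {T : S} {a b a' b' : T ⟶ X.arr} (ha : a = a') (hb : b = b')
    (h : a ≫ X.t = b ≫ X.s) : X.comp a b h = X.comp a' b' (by rw [← ha, ← hb, h]) := by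
  subst ha hb; rfl

theorem id_comp {T : S} (x : T ⟶ X.obj) (a : T ⟶ X.arr) (h : (x ≫ X.e) ≫ X.t = a ≫ X.s) :
    X.comp (x ≫ X.e) a h = a := by
  have hx : x = a ≫ X.s := by simpa [X.e_t] using h
  have := congrArg (fun k => a ≫ k) X.unit_left
  simp only [Category.comp_id] at this
  change a ≫ X.comp (X.s ≫ X.e) (𝟙 _) _ = a at this
  rw [X.precomp] at this
  conv_rhs => rw [← this]
  exact X.comp_congr (by rw [hx, Category.assoc]) (by simp) _

theorem comp_id {T : S} (x : T ⟶ X.obj) (a : T ⟶ X.arr) (h : a ≫ X.t = (x ≫ X.e) ≫ X.s) :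
    X.comp a (x ≫ X.e) h = a := by
  have hx : a ≫ X.t = x := by simpa [X.e_s] using h
  have := congrArg (fun k => a ≫ k) X.unit_right
  simp only [Category.comp_id] at this
  change a ≫ X.comp (𝟙 _) (X.t ≫ X.e) _ = a at this
  rw [X.precomp] at this
  conv_rhs => rw [← this]
  exact X.comp_congr (by simp) (by rw [← hx, Category.assoc]) _

theorem id_comp' {T : S} (x : T ⟶ X.obj) {a b : T ⟶ X.arr} (h : b ≫ X.t = a ≫ X.s)
    (hb : b = x ≫ X.e) : X.comp b a h = a := by
  subst hb; exact X.id_comp _ _ _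

theorem comp_id' {T : S} (x : T ⟶ X.obj) {a b : T ⟶ X.arr} (h : a ≫ X.t = b ≫ X.s)
    (hb : b = x ≫ X.e) : X.comp a b h = a := by
  subst hb; exact X.comp_id _ _ _

theorem comp_assoc {T : S} (a b c : T ⟶ X.arr) (hab : a ≫ X.t = b ≫ X.s)
    (h : X.comp a b hab ≫ X.t = c ≫ X.s) :
    X.comp (X.comp a b hab) c h =
      X.comp a (X.comp b c (by rw [← h, comp_t])) (by rw [comp_s, hab]) := by
  have hbc : b ≫ X.t = c ≫ X.s := by rw [← h, comp_t]
  let P := pullback (pullback.snd X.t X.s ≫ X.t) X.s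
  let q : P ⟶ pullback X.t X.s := pullback.fst _ _
  let p₃ : P ⟶ X.arr := pullback.snd _ _
  have h₁₂ : (q ≫ pullback.fst X.t X.s) ≫ X.t = (q ≫ pullback.snd X.t X.s) ≫ X.s := by
    rw [Category.assoc, Category.assoc, pullback.condition]
  have h₂₃ : (q ≫ pullback.snd X.t X.s) ≫ X.t = p₃ ≫ X.s := by
    rw [Category.assoc]; exact pullback.condition
  have key : X.comp (q ≫ pullback.fst X.t X.s) (q ≫ pullback.snd X.t X.s) h₁₂ = q ≫ X.m := by
    have : pullback.lift _ _ h₁₂ = q := by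
      apply pullback.hom_ext
      · rw [pullback.lift_fst]
      · rw [pullback.lift_snd]
    rw [comp, this]
  have A : X.comp (X.comp (q ≫ pullback.fst X.t X.s) (q ≫ pullback.snd X.t X.s) h₁₂) p₃
      (by rw [comp_t, h₂₃]) = X.comp (q ≫ pullback.fst X.t X.s)
        (X.comp (q ≫ pullback.snd X.t X.s) p₃ h₂₃) (by rw [comp_s, h₁₂]) :=
    (X.comp_congr key rfl _).trans X.assoc
  let r : T ⟶ P := pullback.lift (pullback.lift a b hab) c (by rw [pullback.lift_snd_assoc, hbc])
  have r₁ : r ≫ q ≫ pullback.fst X.t X.s = a := by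
    rw [pullback.lift_fst_assoc, pullback.lift_fst]
  have r₂ : r ≫ q ≫ pullback.snd X.t X.s = b := by
    rw [pullback.lift_fst_assoc, pullback.lift_snd]
  have r₃ : r ≫ p₃ = c := pullback.lift_snd _ _ _
  have := congrArg (fun k => r ≫ k) A
  simp only [X.precomp, r₁, r₂, r₃] at this
  exact this

end InternalCat

/-! ### Internal functors and transformations, and the 2-category `Cat(S)` -/

/-- An internal functor: a pair of maps commuting with all the structure maps. -/
@[ext]
structure InternalFunctor (X Y : InternalCat S) where
  /-- object component -/
  obj : X.obj ⟶ Y.obj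
  /-- arrow component -/
  arr : X.arr ⟶ Y.arr
  arr_s : arr ≫ Y.s = X.s ≫ obj
  arr_t : arr ≫ Y.t = X.t ≫ obj
  map_e : X.e ≫ arr = obj ≫ Y.e
  map_m : X.m ≫ arr =
    pullback.lift (pullback.fst X.t X.s ≫ arr) (pullback.snd X.t X.s ≫ arr)
      (by rw [Category.assoc, Category.assoc, arr_s, arr_t, pullback.condition_assoc]) ≫ Y.m

namespace InternalFunctor

variable {X Y Z : InternalCat S}

theorem map_comp (f : InternalFunctor X Y) {T : S} (a b : T ⟶ X.arr)
    (h : a ≫ X.t = b ≫ X.s) :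
    X.comp a b h ≫ f.arr = Y.comp (a ≫ f.arr) (b ≫ f.arr)
      (by rw [Category.assoc, Category.assoc, f.arr_s, f.arr_t, reassoc_of% h]) := by
  unfold InternalCat.comp
  rw [Category.assoc, f.map_m, ← Category.assoc]
  congr 1
  apply pullback.hom_ext
  · rw [Category.assoc, pullback.lift_fst, pullback.lift_fst, pullback.lift_fst_assoc]
  · rw [Category.assoc, pullback.lift_snd, pullback.lift_snd, pullback.lift_snd_assoc]

/-- To check that a pair of maps is a functor it suffices to look at generalised elements. -/
@[reducible] def mk' (obj : X.obj ⟶ Y.obj) (arr : X.arr ⟶ Y.arr) (arr_s : arr ≫ Y.s = X.s ≫ obj)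
    (arr_t : arr ≫ Y.t = X.t ≫ obj) (map_e : X.e ≫ arr = obj ≫ Y.e)
    (map_comp : ∀ {T : S} (a b : T ⟶ X.arr) (h : a ≫ X.t = b ≫ X.s)
      (h' : (a ≫ arr) ≫ Y.t = (b ≫ arr) ≫ Y.s),
      X.comp a b h ≫ arr = Y.comp (a ≫ arr) (b ≫ arr) h') : InternalFunctor X Y where
  obj := obj
  arr := arr
  arr_s := arr_s
  arr_t := arr_t
  map_e := map_e
  map_m := by
    have := map_comp (pullback.fst X.t X.s) (pullback.snd X.t X.s) pullback.condition
      (by rw [Category.assoc, Category.assoc, arr_s, arr_t, pullback.condition_assoc])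
    have h2 : X.comp (pullback.fst X.t X.s) (pullback.snd X.t X.s) pullback.condition = X.m := by
      unfold InternalCat.comp
      have : pullback.lift (pullback.fst X.t X.s) (pullback.snd X.t X.s) pullback.condition
          = 𝟙 _ := by
        apply pullback.hom_ext
        · rw [pullback.lift_fst, Category.id_comp]
        · rw [pullback.lift_snd, Category.id_comp]
      rw [this, Category.id_comp]
    rw [h2] at this
    exact this

/-- The identity functor. -/
@[reducible] def id (X : InternalCat S) : InternalFunctor X X :=
  mk' (𝟙 _) (𝟙 _) (by simp) (by simp) (by simp)
    (fun a b h h' => by rw [Category.comp_id]; exact X.comp_congr (by simp) (by simp) _)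

/-- Composition of functors (in diagrammatic order). -/
@[reducible] def comp (f : InternalFunctor X Y) (g : InternalFunctor Y Z) : InternalFunctor X Z :=
  mk' (f.obj ≫ g.obj) (f.arr ≫ g.arr)
    (by rw [Category.assoc, g.arr_s, reassoc_of% f.arr_s])
    (by rw [Category.assoc, g.arr_t, reassoc_of% f.arr_t])
    (by rw [Category.assoc, ← g.map_e, reassoc_of% f.map_e])
    (fun a b h h' => by
      rw [← Category.assoc, f.map_comp, g.map_comp]
      exact Z.comp_congr (by simp) (by simp) _)

end InternalFunctor

/-- An internal natural transformation `f ⇒ g`; naturality is the equation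
`f(a) ; α_{t a} = α_{s a} ; g(a)` for the universal arrow `a`. -/
@[ext]
structure InternalTrans {X Y : InternalCat S} (f g : InternalFunctor X Y) where
  /-- the component map -/
  app : X.obj ⟶ Y.arr
  app_s : app ≫ Y.s = f.obj
  app_t : app ≫ Y.t = g.obj
  naturality :
    Y.comp f.arr (X.t ≫ app) (by rw [Category.assoc, app_s, f.arr_t]) =
      Y.comp (X.s ≫ app) g.arr (by rw [Category.assoc, app_t, g.arr_s])

namespace InternalTrans

variable {X Y Z : InternalCat S}

theorem nat {f g : InternalFunctor X Y} (α : InternalTrans f g) {T : S} (a : T ⟶ X.arr) :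
    Y.comp (a ≫ f.arr) ((a ≫ X.t) ≫ α.app)
        (by simp only [Category.assoc]; rw [α.app_s, f.arr_t]) =
      Y.comp ((a ≫ X.s) ≫ α.app) (a ≫ g.arr)
        (by simp only [Category.assoc]; rw [α.app_t, g.arr_s]) := by
  have := congrArg (fun k => a ≫ k) α.naturality
  simp only [Y.precomp] at this
  simpa only [Category.assoc] using this

/-- The identity transformation. -/
@[reducible] def id (f : InternalFunctor X Y) : InternalTrans f f where
  app := f.obj ≫ Y.e
  app_s := by simp [Y.e_s]
  app_t := by simp [Y.e_t]
  naturality := by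
    simp only [← Category.assoc]
    rw [Y.comp_id, Y.id_comp]

/-- Vertical composition. -/
@[reducible] noncomputable def vcomp {f g h : InternalFunctor X Y} (α : InternalTrans f g)
    (β : InternalTrans g h) : InternalTrans f h where
  app := Y.comp α.app β.app (by rw [α.app_t, β.app_s])
  app_s := by rw [Y.comp_s, α.app_s]
  app_t := by rw [Y.comp_t, β.app_t]
  naturality := by
    simp only [Y.precomp]
    have h1 := α.naturality
    have h2 := β.naturality
    rw [← Y.comp_assoc _ _ _ (by rw [Category.assoc, α.app_s, f.arr_t])
      (by rw [Y.comp_t, Category.assoc, Category.assoc, α.app_t, β.app_s]),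
      Y.comp_congr h1 rfl, Y.comp_assoc, Y.comp_congr rfl h2, ← Y.comp_assoc]

/-- Whiskering on the left. -/
@[reducible] def whiskerLeft (f : InternalFunctor X Y) {g h : InternalFunctor Y Z} (β : InternalTrans g h) :
    InternalTrans (f.comp g) (f.comp h) where
  app := f.obj ≫ β.app
  app_s := by rw [Category.assoc, β.app_s]
  app_t := by rw [Category.assoc, β.app_t]
  naturality := by
    have := β.nat f.arr
    refine Eq.trans (Z.comp_congr rfl ?_ _) (this.trans (Z.comp_congr ?_ rfl _))
    · rw [← Category.assoc, f.arr_t]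
    · rw [← Category.assoc, f.arr_s]

/-- Whiskering on the right. -/
@[reducible] def whiskerRight {f g : InternalFunctor X Y} (α : InternalTrans f g) (h : InternalFunctor Y Z) :
    InternalTrans (f.comp h) (g.comp h) where
  app := α.app ≫ h.arr
  app_s := by rw [Category.assoc, h.arr_s, reassoc_of% α.app_s]
  app_t := by rw [Category.assoc, h.arr_t, reassoc_of% α.app_t]
  naturality := by
    have := congrArg (fun k => k ≫ h.arr) α.naturality
    simp only [h.map_comp] at this
    refine Eq.trans (Z.comp_congr rfl ?_ _) (this.trans (Z.comp_congr ?_ rfl _)) <;> simp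

end InternalTrans

noncomputable instance (X Y : InternalCat S) : Category (InternalFunctor X Y) where
  Hom f g := InternalTrans f g
  id f := InternalTrans.id f
  comp α β := α.vcomp β
  id_comp _ := InternalTrans.ext (Y.id_comp _ _ _)
  comp_id _ := InternalTrans.ext (Y.comp_id _ _ _)
  assoc _ _ _ := InternalTrans.ext (Y.comp_assoc _ _ _ _ _)

@[ext]
theorem InternalTrans.hom_ext {X Y : InternalCat S} {f g : InternalFunctor X Y} {α β : f ⟶ g}
    (h : InternalTrans.app α = InternalTrans.app β) : α = β :=
  InternalTrans.ext h

/-- The invertible transformation with identity components between two equal functors. -/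
@[reducible] def InternalFunctor.isoOfEq {X Y : InternalCat S} (f g : InternalFunctor X Y)
    (h : f = g) : f ≅ g where
  hom := { InternalTrans.id f with app_t := by rw [← h]; exact (InternalTrans.id f).app_t
                                   naturality := by
                                    subst h; exact (InternalTrans.id f).naturality }
  inv := { InternalTrans.id f with app_s := by rw [← h]; exact (InternalTrans.id f).app_s
                                   naturality := by
                                    subst h; exact (InternalTrans.id f).naturality }
  hom_inv_id := by subst h; exact Category.id_comp (𝟙 f)
  inv_hom_id := by subst h; exact Category.id_comp (𝟙 f)

/-- The 2-category `Cat(S)` of internal categories, functors and transformations. -/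
noncomputable instance : Bicategory (InternalCat S) where
  Hom X Y := InternalFunctor X Y
  id X := InternalFunctor.id X
  comp f g := f.comp g
  whiskerLeft f _ _ β := InternalTrans.whiskerLeft f β
  whiskerRight α h := InternalTrans.whiskerRight α h
  associator f g h := InternalFunctor.isoOfEq ((f.comp g).comp h) (f.comp (g.comp h))
    (InternalFunctor.ext (Category.assoc _ _ _) (Category.assoc _ _ _))
  leftUnitor f := InternalFunctor.isoOfEq ((InternalFunctor.id _).comp f) f
    (InternalFunctor.ext (Category.id_comp _) (Category.id_comp _))
  rightUnitor f := InternalFunctor.isoOfEq (f.comp (InternalFunctor.id _)) f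
    (InternalFunctor.ext (Category.comp_id _) (Category.comp_id _))
  whiskerLeft_id f g := by
    apply InternalTrans.ext
    change f.obj ≫ g.obj ≫ _ = (f.obj ≫ g.obj) ≫ _
    simp
  whiskerLeft_comp f _ _ _ η θ := InternalTrans.ext (InternalCat.precomp _ _ _ _ _)
  id_whiskerLeft {a b f g} η := by
    apply InternalTrans.ext
    change 𝟙 _ ≫ InternalTrans.app η = b.comp ((𝟙 _ ≫ f.obj) ≫ b.e) (b.comp _ (_ ≫ b.e) _) _
    rw [b.id_comp, b.comp_id, Category.id_comp]
  comp_whiskerLeft {a b c d} f g h h' η := by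
    apply InternalTrans.ext
    change (f.obj ≫ g.obj) ≫ InternalTrans.app η =
      d.comp (((f.obj ≫ g.obj) ≫ h.obj) ≫ d.e) (d.comp _ (_ ≫ d.e) _) _
    rw [d.id_comp, d.comp_id]
    exact Category.assoc _ _ _
  id_whiskerRight {a b c} f g := by
    apply InternalTrans.ext
    change (f.obj ≫ b.e) ≫ g.arr = (f.obj ≫ g.obj) ≫ c.e
    simp [g.map_e]
  comp_whiskerRight η θ i := InternalTrans.ext (i.map_comp _ _ _)
  whiskerRight_id {a b f g} η := by
    apply InternalTrans.ext
    change InternalTrans.app η ≫ 𝟙 _ = b.comp ((f.obj ≫ 𝟙 _) ≫ b.e) (b.comp _ (_ ≫ b.e) _) _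
    rw [b.id_comp, b.comp_id, Category.comp_id]
  whiskerRight_comp {a b c d} f f' η g h := by
    apply InternalTrans.ext
    change InternalTrans.app η ≫ g.arr ≫ h.arr =
      d.comp (((f.obj ≫ g.obj) ≫ h.obj) ≫ d.e) (d.comp _ (_ ≫ d.e) _) _
    rw [d.id_comp, d.comp_id]
    exact (Category.assoc _ _ _).symm
  whisker_assoc {a b c d} f g g' η h := by
    apply InternalTrans.ext
    change (f.obj ≫ InternalTrans.app η) ≫ h.arr =
      d.comp (((f.obj ≫ g.obj) ≫ h.obj) ≫ d.e) (d.comp _ (_ ≫ d.e) _) _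
    rw [d.id_comp, d.comp_id]
    exact Category.assoc _ _ _
  whisker_exchange {a b c f g h i} η θ := by
    apply InternalTrans.ext
    have := InternalTrans.nat θ (InternalTrans.app η)
    refine Eq.trans (c.comp_congr ?_ rfl _) (this.symm.trans (c.comp_congr rfl ?_ _))
    · exact congrArg (· ≫ InternalTrans.app θ) (InternalTrans.app_s η).symm
    · exact congrArg (· ≫ InternalTrans.app θ) (InternalTrans.app_t η)
  pentagon {a b c d e'} f g h i := by
    apply InternalTrans.ext
    change e'.comp (((((f.obj ≫ g.obj) ≫ h.obj) ≫ d.e) ≫ i.arr)) (e'.comp (_ ≫ e'.e)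
      (f.obj ≫ ((g.obj ≫ h.obj) ≫ i.obj) ≫ e'.e) _) _ = e'.comp (_ ≫ e'.e) (_ ≫ e'.e) _
    have h₁ : ((((f.obj ≫ g.obj) ≫ h.obj) ≫ d.e) ≫ i.arr) =
        (((f.obj ≫ g.obj) ≫ h.obj) ≫ i.obj) ≫ e'.e := by
      simp [i.map_e]
    refine (e'.comp_congr h₁ (e'.id_comp _ _ _) _).trans ?_
    rw [e'.id_comp, e'.id_comp]
    simp only [Category.assoc]
  triangle {a b c} f g := by
    apply InternalTrans.ext
    change c.comp (_ ≫ c.e) (f.obj ≫ (𝟙 _ ≫ g.obj) ≫ c.e) _ = ((f.obj ≫ 𝟙 _) ≫ b.e) ≫ g.arr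
    rw [c.id_comp]
    simp [g.map_e]

/-! ### Unary sites -/

/-- A singleton pretopology on `S`: a class of maps, the covers, which contains the isomorphisms,
is closed under composition, and all of whose pullbacks exist and are again covers. -/
structure SingletonPretopology (S : Type u) [Category.{v} S] where
  /-- the covers -/
  IsCover : MorphismProperty S
  of_isIso : ∀ {A B : S} (p : A ⟶ B) [IsIso p], IsCover p
  comp : ∀ {A B D : S} (p : A ⟶ B) (q : B ⟶ D), IsCover p → IsCover q → IsCover (p ≫ q)
  hasPullback : ∀ {A B U : S} (f : B ⟶ A) (p : U ⟶ A), IsCover p → HasPullback f p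
  baseChange : ∀ {A B U P : S} {fst : P ⟶ B} {snd : P ⟶ U} {f : B ⟶ A} {p : U ⟶ A},
    IsPullback fst snd f p → IsCover p → IsCover fst

/-- A specified pullback `B ×_A U` of `p : U ⟶ A` along `f : B ⟶ A`. -/
structure SpecifiedPullback {A B U : S} (f : B ⟶ A) (p : U ⟶ A) where
  /-- the object `B ×_A U` -/
  pt : S
  /-- first projection -/
  fst : pt ⟶ B
  /-- second projection -/
  snd : pt ⟶ U
  isPullback : IsPullback fst snd f p

namespace SpecifiedPullback

variable {A B U : S} {f : B ⟶ A} {p : U ⟶ A} (P : SpecifiedPullback f p)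

/-- The generalised element `(x, y)` of `B ×_A U`. -/
noncomputable def lift {T : S} (x : T ⟶ B) (y : T ⟶ U) (h : x ≫ f = y ≫ p) : T ⟶ P.pt :=
  P.isPullback.lift x y h

@[simp] theorem lift_fst {T : S} (x : T ⟶ B) (y : T ⟶ U) (h : x ≫ f = y ≫ p) :
    P.lift x y h ≫ P.fst = x := P.isPullback.lift_fst _ _ _

@[simp] theorem lift_snd {T : S} (x : T ⟶ B) (y : T ⟶ U) (h : x ≫ f = y ≫ p) :
    P.lift x y h ≫ P.snd = y := P.isPullback.lift_snd _ _ _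

@[simp] theorem lift_fst_assoc {T Z : S} (x : T ⟶ B) (y : T ⟶ U) (h : x ≫ f = y ≫ p)
    (k : B ⟶ Z) : P.lift x y h ≫ P.fst ≫ k = x ≫ k := by
  rw [← Category.assoc, lift_fst]

@[simp] theorem lift_snd_assoc {T Z : S} (x : T ⟶ B) (y : T ⟶ U) (h : x ≫ f = y ≫ p)
    (k : U ⟶ Z) : P.lift x y h ≫ P.snd ≫ k = y ≫ k := by
  rw [← Category.assoc, lift_snd]

theorem hom_ext {T : S} {a b : T ⟶ P.pt} (h₁ : a ≫ P.fst = b ≫ P.fst)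
    (h₂ : a ≫ P.snd = b ≫ P.snd) : a = b := P.isPullback.hom_ext h₁ h₂

theorem w : P.fst ≫ f = P.snd ≫ p := P.isPullback.w

end SpecifiedPullback

/-- A unary site: a singleton pretopology with specified pullbacks of covers, which obey the
convention that pulling back along an identity, or pulling back an identity, does nothing
(`A ×_A U = U` and `B ×_A A = B`). -/
structure UnarySite (S : Type u) [Category.{v} S] extends SingletonPretopology S where
  /-- the specified pullbacks of covers -/
  pb : ∀ {A B U : S} (f : B ⟶ A) (p : U ⟶ A), IsCover p → SpecifiedPullback f p
  pb_id : ∀ {A U : S} (p : U ⟶ A) (hp : IsCover p),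
    pb (𝟙 A) p hp = ⟨U, p, 𝟙 U, IsPullback.of_vert_isIso ⟨by simp⟩⟩
  pb_of_id : ∀ {A B : S} (f : B ⟶ A) (h : IsCover (𝟙 A)),
    pb f (𝟙 A) h = ⟨B, 𝟙 B, f, IsPullback.of_horiz_isIso ⟨by simp⟩⟩

open Classical in
/-- The convention on specified pullbacks is harmless: every singleton pretopology underlies a unary
site. -/
theorem UnarySite.exists_of_pretopology (J : SingletonPretopology S) :
    ∃ J' : UnarySite S, J'.toSingletonPretopology = J := by
  let pb : ∀ {A B U : S} (f : B ⟶ A) (p : U ⟶ A), J.IsCover p → SpecifiedPullback f p :=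
    fun {A B U} f p hp =>
      if h : ∃ e : B = A, f = eqToHom e then
        ⟨U, p ≫ eqToHom h.choose.symm, 𝟙 U, by
          have : IsIso f := by rw [h.choose_spec]; infer_instance
          refine IsPullback.of_vert_isIso ⟨?_⟩
          exact (congrArg (_ ≫ ·) h.choose_spec).trans (by simp)⟩
      else if h' : ∃ e : U = A, p = eqToHom e then
        ⟨B, 𝟙 B, f ≫ eqToHom h'.choose.symm, by
          have : IsIso p := by rw [h'.choose_spec]; infer_instance
          refine IsPullback.of_horiz_isIso ⟨?_⟩
          exact Eq.trans (by simp) (congrArg (_ ≫ ·) h'.choose_spec).symm⟩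
      else
        haveI := J.hasPullback f p hp
        ⟨pullback f p, pullback.fst f p, pullback.snd f p, IsPullback.of_hasPullback f p⟩
  refine ⟨{ J with pb := pb, pb_id := ?_, pb_of_id := ?_ }, rfl⟩
  · intro A U p hp
    have h : ∃ e : A = A, 𝟙 A = eqToHom e := ⟨rfl, rfl⟩
    simp only [pb, dif_pos h]
    congr 1
    simp
  · intro A B f h
    by_cases h₁ : ∃ e : B = A, f = eqToHom e
    · obtain ⟨e, he⟩ := id h₁
      subst e he
      simp only [pb, dif_pos h₁]
      congr 1
      simp
    · simp only [pb, dif_neg h₁]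
      simp

namespace UnarySite

variable (J : UnarySite S)

/-- The site is subcanonical: every cover is effective, i.e. is the colimit (coequaliser) of its
kernel pair. -/
class IsSubcanonical : Prop where
  effective : ∀ {A U : S} (p : U ⟶ A) (hp : J.IsCover p),
    Nonempty (IsColimit (Cofork.ofπ p (J.pb p p hp).w))

variable {J}

theorem cover_fst {A B U : S} (f : B ⟶ A) (p : U ⟶ A) (hp : J.IsCover p) :
    J.IsCover (J.pb f p hp).fst :=
  J.baseChange (J.pb f p hp).isPullback hp

theorem cover_fst_comp {A B U D : S} (f : B ⟶ A) (p : U ⟶ A) (hp : J.IsCover p) (g : B ⟶ D)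
    (hg : J.IsCover g) : J.IsCover ((J.pb f p hp).fst ≫ g) :=
  J.comp _ _ (cover_fst f p hp) hg

theorem cover_id (A : S) : J.IsCover (𝟙 A) := J.of_isIso _

theorem cancel_cover [J.IsSubcanonical] {A U Z : S} {p : U ⟶ A} (hp : J.IsCover p)
    {a b : A ⟶ Z} (h : p ≫ a = p ≫ b) : a = b :=
  Cofork.IsColimit.hom_ext (IsSubcanonical.effective p hp).some h

/-- Maps descend along covers. -/
theorem exists_descent [J.IsSubcanonical] {A U Z : S} {p : U ⟶ A} (hp : J.IsCover p)
    (k : U ⟶ Z) (h : ∀ {T : S} (a b : T ⟶ U), a ≫ p = b ≫ p → a ≫ k = b ≫ k) :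
    ∃ d : A ⟶ Z, p ≫ d = k :=
  ⟨_, Cofork.IsColimit.π_desc' (IsSubcanonical.effective p hp).some k
    (h _ _ (J.pb p p hp).w)⟩

/-- Equality of maps may be checked locally: after choosing a point of a cover. -/
theorem local_eq [J.IsSubcanonical] {A U T Z : S} {p : U ⟶ A} (hp : J.IsCover p) (x : T ⟶ A)
    {a b : T ⟶ Z} (h : ∀ {T' : S} (r : T' ⟶ T) (y : T' ⟶ U), r ≫ x = y ≫ p →
      r ≫ a = r ≫ b) : a = b :=
  cancel_cover (cover_fst x p hp) (h _ _ (J.pb x p hp).w)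

/-! ### Base change of an internal category along a cover -/

section BaseChange

variable (J) (X : InternalCat S) {U : S} (p : U ⟶ X.obj) (hp : J.IsCover p)

/-- `U ×_{X₀} X₁`: the arrows with a lift of their source -/
def bcSrc : SpecifiedPullback X.s p := J.pb X.s p hp

/-- `(U ×_{X₀} X₁) ×_{X₀} U`: the arrows with a lift of their source and of their target -/
def bcArr : SpecifiedPullback ((J.bcSrc X p hp).fst ≫ X.t) p := J.pb _ p hp

variable {X p}

/-- The generalised element `(u, a, v)` of `U ×_{X₀} X₁ ×_{X₀} U`. -/
noncomputable def el {T : S} (u : T ⟶ U) (a : T ⟶ X.arr) (v : T ⟶ U) (hs : a ≫ X.s = u ≫ p)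
    (ht : a ≫ X.t = v ≫ p) : T ⟶ (J.bcArr X p hp).pt :=
  (J.bcArr X p hp).lift ((J.bcSrc X p hp).lift a u hs) v (by simpa using ht)

/-- source lift -/
def bcS : (J.bcArr X p hp).pt ⟶ U := (J.bcArr X p hp).fst ≫ (J.bcSrc X p hp).snd
/-- underlying arrow -/
def bcA : (J.bcArr X p hp).pt ⟶ X.arr := (J.bcArr X p hp).fst ≫ (J.bcSrc X p hp).fst
/-- target lift -/
def bcT : (J.bcArr X p hp).pt ⟶ U := (J.bcArr X p hp).snd

theorem bcA_s : J.bcA hp ≫ X.s = J.bcS hp ≫ p := by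
  simp [bcA, bcS, (J.bcSrc X p hp).w]

theorem bcA_t : J.bcA hp ≫ X.t = J.bcT hp ≫ p := by
  simpa [bcA, bcT] using (J.bcArr X p hp).w

variable {T : S} (u : T ⟶ U) (a : T ⟶ X.arr) (v : T ⟶ U) (hs : a ≫ X.s = u ≫ p)
    (ht : a ≫ X.t = v ≫ p)

@[simp] theorem el_S : J.el hp u a v hs ht ≫ J.bcS hp = u := by simp [el, bcS]
@[simp] theorem el_A : J.el hp u a v hs ht ≫ J.bcA hp = a := by simp [el, bcA]
@[simp] theorem el_T : J.el hp u a v hs ht ≫ J.bcT hp = v := by simp [el, bcT]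

theorem bc_hom_ext {a b : T ⟶ (J.bcArr X p hp).pt} (h₁ : a ≫ J.bcS hp = b ≫ J.bcS hp)
    (h₂ : a ≫ J.bcA hp = b ≫ J.bcA hp) (h₃ : a ≫ J.bcT hp = b ≫ J.bcT hp) : a = b := by
  apply (J.bcArr X p hp).hom_ext _ h₃
  apply (J.bcSrc X p hp).hom_ext
  · simpa [bcA] using h₂
  · simpa [bcS] using h₁

theorem comp_el {T' : S} (r : T' ⟶ T) : r ≫ J.el hp u a v hs ht =
    J.el hp (r ≫ u) (r ≫ a) (r ≫ v) (by simp [hs]) (by simp [ht]) := by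
  apply J.bc_hom_ext hp <;> simp

theorem el_congr {u' v' : T ⟶ U} {a' : T ⟶ X.arr} (hu : u = u') (ha : a = a') (hv : v = v') :
    J.el hp u a v hs ht = J.el hp u' a' v' (by rw [← hu, ← ha, hs]) (by rw [← hv, ← ha, ht]) := by
  subst hu ha hv; rfl

theorem eq_el (x : T ⟶ (J.bcArr X p hp).pt) : x =
    J.el hp (x ≫ J.bcS hp) (x ≫ J.bcA hp) (x ≫ J.bcT hp) (by simp [bcA_s]) (by simp [bcA_t]) := by
  apply J.bc_hom_ext hp <;> simp

theorem eq_el' {x : T ⟶ (J.bcArr X p hp).pt} (h₁ : x ≫ J.bcS hp = u) (h₂ : x ≫ J.bcA hp = a)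
    (h₃ : x ≫ J.bcT hp = v) : x = J.el hp u a v hs ht := by
  apply J.bc_hom_ext hp
  · rw [h₁, el_S]
  · rw [h₂, el_A]
  · rw [h₃, el_T]

theorem isPullback_of_exists {P A B D : S} {fst : P ⟶ A} {snd : P ⟶ B} {f : A ⟶ D} {g : B ⟶ D}
    (w : fst ≫ f = snd ≫ g)
    (h₁ : ∀ {T : S} (x : T ⟶ A) (y : T ⟶ B), x ≫ f = y ≫ g →
      ∃ l : T ⟶ P, l ≫ fst = x ∧ l ≫ snd = y)
    (h₂ : ∀ {T : S} (l l' : T ⟶ P), l ≫ fst = l' ≫ fst → l ≫ snd = l' ≫ snd → l = l') :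
    IsPullback fst snd f g :=
  ⟨⟨w⟩, ⟨PullbackCone.IsLimit.mk w (fun s => (h₁ s.fst s.snd s.condition).choose)
    (fun s => (h₁ s.fst s.snd s.condition).choose_spec.1)
    (fun s => (h₁ s.fst s.snd s.condition).choose_spec.2)
    (fun s _ h h' => h₂ _ _ (h.trans (h₁ s.fst s.snd s.condition).choose_spec.1.symm)
      (h'.trans (h₁ s.fst s.snd s.condition).choose_spec.2.symm))⟩⟩

/-- Pullbacks along the source map of `X` lift to pullbacks along the source map of the base
change. -/
theorem bc_pullback {Q Q' : S} (c : Q ⟶ Q') (hc : J.IsCover c) (k : Q' ⟶ X.obj) (h : Q ⟶ U)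
    (w : h ≫ p = c ≫ k) [HasPullback k X.s] :
    ∃ (R : S) (r₁ : R ⟶ Q) (r₂ : R ⟶ (J.bcArr X p hp).pt) (d : R ⟶ pullback k X.s),
      IsPullback r₁ r₂ h (J.bcS hp) ∧ J.IsCover d ∧ d ≫ pullback.fst k X.s = r₁ ≫ c ∧
        d ≫ pullback.snd k X.s = r₂ ≫ J.bcA hp := by
  let R₀ := J.pb (pullback.fst k X.s) c hc
  let R₁ := J.pb (R₀.fst ≫ pullback.snd k X.s ≫ X.t) p hp
  have e₁ : (R₁.fst ≫ R₀.fst ≫ pullback.snd k X.s) ≫ X.s = (R₁.fst ≫ R₀.snd ≫ h) ≫ p := by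
    simp only [Category.assoc]
    rw [w, ← pullback.condition, reassoc_of% R₀.w]
  have e₂ : (R₁.fst ≫ R₀.fst ≫ pullback.snd k X.s) ≫ X.t = R₁.snd ≫ p := by
    simpa only [Category.assoc] using R₁.w
  refine ⟨R₁.pt, R₁.fst ≫ R₀.snd,
    J.el hp (R₁.fst ≫ R₀.snd ≫ h) (R₁.fst ≫ R₀.fst ≫ pullback.snd k X.s) R₁.snd e₁ e₂,
    R₁.fst ≫ R₀.fst, ?_, ?_, ?_, ?_⟩
  · refine isPullback_of_exists (by simp) (fun {T} x y hxy => ?_) (fun {T} l l' h₁ h₂ => ?_)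
    · have f₁ : (x ≫ c) ≫ k = (y ≫ J.bcA hp) ≫ X.s := by
        rw [Category.assoc, Category.assoc, ← w, bcA_s, reassoc_of% hxy]
      have f₂ : pullback.lift (x ≫ c) (y ≫ J.bcA hp) f₁ ≫ pullback.fst k X.s = x ≫ c :=
        pullback.lift_fst _ _ _
      have f₂' : pullback.lift (x ≫ c) (y ≫ J.bcA hp) f₁ ≫ pullback.snd k X.s = y ≫ J.bcA hp :=
        pullback.lift_snd _ _ _
      generalize pullback.lift (x ≫ c) (y ≫ J.bcA hp) f₁ = z at f₂ f₂'
      have f₃ : R₀.lift z x f₂ ≫ R₀.fst ≫ pullback.snd k X.s ≫ X.t = (y ≫ J.bcT hp) ≫ p := by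
        rw [SpecifiedPullback.lift_fst_assoc, reassoc_of% f₂', bcA_t, Category.assoc]
      refine ⟨R₁.lift (R₀.lift z x f₂) (y ≫ J.bcT hp) f₃, by simp, J.bc_hom_ext hp ?_ ?_ ?_⟩
      · simp [hxy]
      · simp [f₂']
      · simp
    · have hS := congrArg (· ≫ J.bcS hp) h₂
      have hA := congrArg (· ≫ J.bcA hp) h₂
      have hT := congrArg (· ≫ J.bcT hp) h₂
      simp only [Category.assoc, el_S, el_A, el_T] at hS hA hT
      simp only [← Category.assoc] at h₁
      refine R₁.hom_ext (R₀.hom_ext (pullback.hom_ext ?_ ?_) h₁) hT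
      · have := congrArg (· ≫ c) h₁
        simp only [Category.assoc, ← R₀.w] at this
        simpa only [Category.assoc] using this
      · simpa only [Category.assoc] using hA
  · exact J.comp _ _ (cover_fst _ _ _) (cover_fst _ _ _)
  · simp only [Category.assoc]; rw [R₀.w]
  · simp

theorem cover_bcA : J.IsCover (J.bcA hp (X := X)) :=
  J.comp _ _ (cover_fst _ _ _) (cover_fst _ _ _)

instance bc_hasPairs : HasPullback (J.bcT hp (X := X)) (J.bcS hp (X := X)) := by
  obtain ⟨R, r₁, r₂, d, h, -⟩ := J.bc_pullback hp (J.bcA hp (X := X)) (J.cover_bcA hp) X.t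
    (J.bcT hp (X := X)) (J.bcA_t hp).symm
  exact h.hasPullback

instance bc_hasTriples : HasPullback
    (pullback.snd (J.bcT hp (X := X)) (J.bcS hp (X := X)) ≫ J.bcT hp (X := X))
    (J.bcS hp (X := X)) := by
  obtain ⟨R, r₁, r₂, d, h, hd, h₁, h₂⟩ := J.bc_pullback hp (J.bcA hp (X := X)) (J.cover_bcA hp) X.t
    (J.bcT hp (X := X)) (J.bcA_t hp).symm
  obtain ⟨R', r₁', r₂', d', h', -⟩ := J.bc_pullback hp (h.isoPullback.inv ≫ d)
    (J.comp _ _ (J.of_isIso _) hd) (pullback.snd X.t X.s ≫ X.t)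
    (pullback.snd (J.bcT hp (X := X)) (J.bcS hp (X := X)) ≫ J.bcT hp (X := X))
    (by
      simp only [Category.assoc]
      rw [← bcA_t, reassoc_of% h₂, h.isoPullback_inv_snd_assoc])
  exact h'.hasPullback

/-- The composite of composable elements `(u, a, v)` and `(v, b, w)` is `(u, a ; b, w)`. -/
noncomputable def bcM : pullback (J.bcT hp (X := X)) (J.bcS hp (X := X)) ⟶ (J.bcArr X p hp).pt :=
  J.el hp (pullback.fst (J.bcT hp) (J.bcS hp) ≫ J.bcS hp)
    (X.comp (pullback.fst (J.bcT hp) (J.bcS hp) ≫ J.bcA hp)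
      (pullback.snd (J.bcT hp) (J.bcS hp) ≫ J.bcA hp)
      (by rw [Category.assoc, Category.assoc, bcA_t, bcA_s, pullback.condition_assoc]))
    (pullback.snd (J.bcT hp) (J.bcS hp) ≫ J.bcT hp)
    (by rw [X.comp_s, Category.assoc, Category.assoc, bcA_s])
    (by rw [X.comp_t, Category.assoc, Category.assoc, bcA_t])

theorem lift_bcM (x y : T ⟶ (J.bcArr X p hp).pt) (h : x ≫ J.bcT hp = y ≫ J.bcS hp) :
    pullback.lift x y h ≫ J.bcM hp = J.el hp (x ≫ J.bcS hp)
      (X.comp (x ≫ J.bcA hp) (y ≫ J.bcA hp)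
        (by rw [Category.assoc, Category.assoc, bcA_t, bcA_s, reassoc_of% h]))
      (y ≫ J.bcT hp) (by rw [X.comp_s, Category.assoc, Category.assoc, bcA_s])
      (by rw [X.comp_t, Category.assoc, Category.assoc, bcA_t]) := by
  unfold bcM
  rw [comp_el]
  apply el_congr
  · rw [pullback.lift_fst_assoc]
  · rw [X.precomp]
    exact X.comp_congr (by rw [pullback.lift_fst_assoc]) (by rw [pullback.lift_snd_assoc]) _
  · rw [pullback.lift_snd_assoc]

theorem lift_bcM_A (x y : T ⟶ (J.bcArr X p hp).pt) (h : x ≫ J.bcT hp = y ≫ J.bcS hp) :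
    (pullback.lift x y h ≫ J.bcM hp) ≫ J.bcA hp = X.comp (x ≫ J.bcA hp) (y ≫ J.bcA hp)
        (by rw [Category.assoc, Category.assoc, bcA_t, bcA_s, reassoc_of% h]) := by
  rw [lift_bcM, el_A]

theorem bcM_S : J.bcM hp (X := X) ≫ J.bcS hp = pullback.fst _ _ ≫ J.bcS hp :=
  J.el_S hp _ _ _ _ _

theorem bcM_T : J.bcM hp (X := X) ≫ J.bcT hp = pullback.snd _ _ ≫ J.bcT hp :=
  J.el_T hp _ _ _ _ _

theorem bc_assoc (q : T ⟶ pullback (J.bcT hp (X := X)) (J.bcS hp (X := X)))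
    (z : T ⟶ (J.bcArr X p hp).pt) (h : (q ≫ J.bcM hp) ≫ J.bcT hp = z ≫ J.bcS hp)
    (h' : (q ≫ pullback.snd _ _) ≫ J.bcT hp = z ≫ J.bcS hp)
    (h'' : (q ≫ pullback.fst _ _) ≫ J.bcT hp =
      (pullback.lift (q ≫ pullback.snd _ _) z h' ≫ J.bcM hp) ≫ J.bcS hp) :
    pullback.lift (q ≫ J.bcM hp) z h ≫ J.bcM hp =
      pullback.lift (q ≫ pullback.fst _ _)
        (pullback.lift (q ≫ pullback.snd _ _) z h' ≫ J.bcM hp) h'' ≫ J.bcM hp := by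
  obtain ⟨x, y, hxy, rfl⟩ : ∃ x y hxy, q = pullback.lift x y hxy :=
    ⟨q ≫ pullback.fst _ _, q ≫ pullback.snd _ _, by simp only [Category.assoc, pullback.condition],
      pullback.hom_ext (by rw [pullback.lift_fst]) (by rw [pullback.lift_snd])⟩
  have e₁ : pullback.lift x y hxy ≫ pullback.fst _ _ = x := pullback.lift_fst _ _ _
  have e₂ : pullback.lift x y hxy ≫ pullback.snd _ _ = y := pullback.lift_snd _ _ _
  apply J.bc_hom_ext hp
  · simp only [Category.assoc, bcM_S]
    rw [pullback.lift_fst_assoc, pullback.lift_fst_assoc, Category.assoc, bcM_S, Category.assoc]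
  · refine (J.lift_bcM_A hp _ _ _).trans (Eq.trans ?_ (J.lift_bcM_A hp _ _ h'').symm)
    refine (X.comp_congr (J.lift_bcM_A hp x y hxy) rfl _).trans ?_
    refine (X.comp_assoc _ _ _ _ _).trans ?_
    refine X.comp_congr (by rw [e₁]) ?_ _
    refine Eq.trans ?_ (J.lift_bcM_A hp _ z h').symm
    exact X.comp_congr (by rw [e₂]) rfl _
  · simp only [Category.assoc, bcM_T]
    rw [pullback.lift_snd_assoc, pullback.lift_snd_assoc, Category.assoc, bcM_T,
      pullback.lift_snd_assoc]

variable (X p)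

/-- The base change `X[U]` of `X` along a cover `p : U ⟶ X₀`: its object of objects is `U` and its
object of arrows is `U ×_{X₀} X₁ ×_{X₀} U`. -/
@[reducible] noncomputable def base : InternalCat S where
  obj := U
  arr := (J.bcArr X p hp).pt
  s := J.bcS hp
  t := J.bcT hp
  e := J.el hp (𝟙 U) (p ≫ X.e) (𝟙 U) (by simp [X.e_s]) (by simp [X.e_t])
  e_s := J.el_S hp _ _ _ _ _
  e_t := J.el_T hp _ _ _ _ _
  m := J.bcM hp
  m_s := J.el_S hp _ _ _ _ _
  m_t := J.el_T hp _ _ _ _ _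
  unit_left := by
    rw [lift_bcM]
    apply J.bc_hom_ext hp
    · simp
    · rw [el_A]
      simp only [Category.assoc, el_A]
      rw [X.comp_congr (Category.assoc _ _ _).symm rfl, X.id_comp]
    · simp
  unit_right := by
    rw [lift_bcM]
    apply J.bc_hom_ext hp
    · simp
    · rw [el_A]
      simp only [Category.assoc, el_A]
      rw [X.comp_congr rfl (Category.assoc _ _ _).symm, X.comp_id, Category.id_comp]
    · simp
  assoc := J.bc_assoc hp _ _ _ _ _

end BaseChange


section BaseChangeFunctors

variable (J)

theorem base_comp_el (X : InternalCat S) {U T : S} (p : U ⟶ X.obj) (hp : J.IsCover p)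
    (x y : T ⟶ (J.bcArr X p hp).pt) (h : x ≫ J.bcT hp = y ≫ J.bcS hp) :
    (J.base X p hp).comp x y h = J.el hp (x ≫ J.bcS hp)
      (X.comp (x ≫ J.bcA hp) (y ≫ J.bcA hp)
        (by rw [Category.assoc, Category.assoc, bcA_t, bcA_s, reassoc_of% h]))
      (y ≫ J.bcT hp) (by rw [X.comp_s, Category.assoc, Category.assoc, bcA_s])
      (by rw [X.comp_t, Category.assoc, Category.assoc, bcA_t]) :=
  J.lift_bcM hp x y h

/-- The canonical functor `X[U] ⟶ X`. -/
@[reducible] noncomputable def baseProj (X : InternalCat S) {U : S} (p : U ⟶ X.obj)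
    (hp : J.IsCover p) : InternalFunctor (J.base X p hp) X :=
  InternalFunctor.mk' p (J.bcA hp) (J.bcA_s hp) (J.bcA_t hp)
    (J.el_A hp (𝟙 U) (p ≫ X.e) (𝟙 U) (by simp [X.e_s]) (by simp [X.e_t]))
    (fun a b h h' => by
      rw [base_comp_el, el_A])

/-- A functor `F : W ⟶ Y` together with a lift of its object component through a cover
`q : V ⟶ Y₀` gives a functor `W ⟶ Y[V]`. -/
@[reducible] noncomputable def baseLift {W Y : InternalCat S} {V : S} {q : V ⟶ Y.obj}
    (hq : J.IsCover q) (F : InternalFunctor W Y) (k : W.obj ⟶ V) (hk : k ≫ q = F.obj) :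
    InternalFunctor W (J.base Y q hq) :=
  InternalFunctor.mk' k
    (J.el hq (W.s ≫ k) F.arr (W.t ≫ k) (by rw [F.arr_s, Category.assoc, hk])
      (by rw [F.arr_t, Category.assoc, hk]))
    (J.el_S hq _ _ _ _ _) (J.el_T hq _ _ _ _ _)
    (by
      rw [comp_el, comp_el]
      apply el_congr
      · rw [reassoc_of% W.e_s, Category.comp_id]
      · rw [F.map_e, ← hk, Category.assoc]
      · rw [reassoc_of% W.e_t, Category.comp_id])
    (fun a b h h' => by
      rw [base_comp_el, comp_el]
      apply el_congr
      · rw [Category.assoc, el_S, reassoc_of% W.comp_s]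
      · rw [F.map_comp]
        exact Y.comp_congr (by rw [Category.assoc, el_A]) (by rw [Category.assoc, el_A]) _
      · rw [Category.assoc, el_T, reassoc_of% W.comp_t])

/-- The canonical functor `X[W] ⟶ X[U]` induced by a map of covers `k : W ⟶ U` over `X₀`. -/
@[reducible] noncomputable def baseMap (X : InternalCat S) {U W : S} {p : U ⟶ X.obj}
    (hp : J.IsCover p) {w : W ⟶ X.obj} (hw : J.IsCover w) (k : W ⟶ U) (hk : k ≫ p = w) :
    InternalFunctor (J.base X w hw) (J.base X p hp) :=
  J.baseLift hp (J.baseProj X w hw) k hk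

end BaseChangeFunctors

/-- Glueing a map out of `T` from compatible local values. -/
theorem exists_glue [J.IsSubcanonical] {A U T Z : S} {p : U ⟶ A} (hp : J.IsCover p) (x : T ⟶ A)
    (k : ∀ {T' : S} (r : T' ⟶ T) (y : T' ⟶ U), r ≫ x = y ≫ p → (T' ⟶ Z))
    (nat : ∀ {T' T'' : S} (r : T' ⟶ T) (y : T' ⟶ U) (h : r ≫ x = y ≫ p) (r' : T'' ⟶ T')
      (h' : (r' ≫ r) ≫ x = (r' ≫ y) ≫ p), r' ≫ k r y h = k (r' ≫ r) (r' ≫ y) h')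
    (indep : ∀ {T' : S} (r : T' ⟶ T) (y y' : T' ⟶ U) (h : r ≫ x = y ≫ p) (h' : r ≫ x = y' ≫ p),
      k r y h = k r y' h') :
    ∃ d : T ⟶ Z, ∀ {T' : S} (r : T' ⟶ T) (y : T' ⟶ U) (h : r ≫ x = y ≫ p), r ≫ d = k r y h := by
  let P := J.pb x p hp
  have kc : ∀ {T' : S} (r r' : T' ⟶ T) (y y' : T' ⟶ U) (h : r ≫ x = y ≫ p)
      (h' : r' ≫ x = y' ≫ p), r = r' → y = y' → k r y h = k r' y' h' := by
    intro T' r r' y y' h h' e e'; subst e e'; rfl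
  obtain ⟨d, hd⟩ := exists_descent (cover_fst x p hp) (k P.fst P.snd P.w) (by
    intro T' a b hab
    have ha : (a ≫ P.fst) ≫ x = (a ≫ P.snd) ≫ p := by
      rw [Category.assoc, Category.assoc, P.w]
    have hb : (b ≫ P.fst) ≫ x = (b ≫ P.snd) ≫ p := by
      rw [Category.assoc, Category.assoc, P.w]
    rw [nat _ _ _ a ha, nat _ _ _ b hb]
    have hab' : a ≫ P.fst = b ≫ P.fst := hab
    exact (indep _ _ (b ≫ P.snd) _ (by rw [hab', hb])).trans (kc _ _ _ _ _ _ hab' rfl))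
  refine ⟨d, fun {T'} r y h => ?_⟩
  have h1 : P.lift r y h ≫ P.fst = r := P.lift_fst _ _ _
  have h2 : P.lift r y h ≫ P.snd = y := P.lift_snd _ _ _
  have e := congrArg (P.lift r y h ≫ ·) hd
  change P.lift r y h ≫ P.fst ≫ d = _ at e
  rw [reassoc_of% h1, nat _ _ _ _ (by rw [h1, h2, h])] at e
  rw [e]
  exact kc _ _ _ _ _ _ h1 h2

end UnarySite

/-! ### Anafunctors and their transformations -/

/-- An anafunctor from `X` to `Y`: a cover `p : U ⟶ X₀` and a functor `X[U] ⟶ Y`. -/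
structure Anafunctor (J : UnarySite S) (X Y : InternalCat S) where
  /-- the total object of the cover -/
  U : S
  /-- the cover -/
  p : U ⟶ X.obj
  cover : J.IsCover p
  /-- the functor `X[U] ⟶ Y` -/
  functor : InternalFunctor (J.base X p cover) Y

namespace Anafunctor

open UnarySite

variable {J : UnarySite S} {X Y Z W : InternalCat S}

/-- The fibre product `U ×_{X₀} V` of the covers of two anafunctors. -/
@[reducible] def prod (A B : Anafunctor J X Y) : SpecifiedPullback A.p B.p := J.pb A.p B.p B.cover

theorem prod_cover (A B : Anafunctor J X Y) : J.IsCover ((A.prod B).fst ≫ A.p) :=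
  cover_fst_comp _ _ _ _ A.cover

/-- A transformation `(U, f) ⇒ (V, g)` of anafunctors: an internal natural transformation from
`X[U ×_{X₀} V] ⟶ X[U] ⟶ Y` to `X[U ×_{X₀} V] ⟶ X[V] ⟶ Y`. -/
@[reducible] def Trans (A B : Anafunctor J X Y) : Type v :=
  InternalTrans
    ((J.baseMap X A.cover (prod_cover A B) (A.prod B).fst rfl).comp A.functor)
    ((J.baseMap X B.cover (prod_cover A B) (A.prod B).snd (A.prod B).w.symm).comp B.functor)

/-- The value of the functor of an anafunctor on the arrow `(u, a, v)` of `X[U]`. -/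
noncomputable def app (A : Anafunctor J X Y) {T : S} (u : T ⟶ A.U) (a : T ⟶ X.arr) (v : T ⟶ A.U)
    (hs : a ≫ X.s = u ≫ A.p) (ht : a ≫ X.t = v ≫ A.p) : T ⟶ Y.arr :=
  J.el A.cover u a v hs ht ≫ A.functor.arr

section app

variable (A : Anafunctor J X Y) {T : S} (u : T ⟶ A.U) (a : T ⟶ X.arr) (v : T ⟶ A.U)
    (hs : a ≫ X.s = u ≫ A.p) (ht : a ≫ X.t = v ≫ A.p)

theorem app_s : A.app u a v hs ht ≫ Y.s = u ≫ A.functor.obj := by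
  rw [app, Category.assoc, A.functor.arr_s, ← Category.assoc, el_S]

theorem app_t : A.app u a v hs ht ≫ Y.t = v ≫ A.functor.obj := by
  rw [app, Category.assoc, A.functor.arr_t, ← Category.assoc, el_T]

theorem app_congr {u' v' : T ⟶ A.U} {a' : T ⟶ X.arr} (hu : u = u') (ha : a = a') (hv : v = v') :
    A.app u a v hs ht = A.app u' a' v' (by rw [← hu, ← ha, hs]) (by rw [← hv, ← ha, ht]) := by
  subst hu ha hv; rfl

theorem comp_app {T' : S} (r : T' ⟶ T) : r ≫ A.app u a v hs ht =
    A.app (r ≫ u) (r ≫ a) (r ≫ v) (by simp [hs]) (by simp [ht]) := by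
  rw [app, ← Category.assoc, comp_el, app]

theorem app_comp (b : T ⟶ X.arr) (w : T ⟶ A.U) (hs' : b ≫ X.s = v ≫ A.p)
    (ht' : b ≫ X.t = w ≫ A.p) (h : A.app u a v hs ht ≫ Y.t = A.app v b w hs' ht' ≫ Y.s) :
    Y.comp (A.app u a v hs ht) (A.app v b w hs' ht') h =
      A.app u (X.comp a b (by rw [ht, hs'])) w (by rw [X.comp_s, hs])
        (by rw [X.comp_t, ht']) := by
  have := A.functor.map_comp (J.el A.cover u a v hs ht) (J.el A.cover v b w hs' ht')
    (by rw [el_T, el_S])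
  refine this.symm.trans ?_
  rw [base_comp_el, app]
  congr 1
  exact el_congr _ _ _ _ _ _ _ (el_S _ _ _ _ _ _ _)
    (X.comp_congr (el_A _ _ _ _ _ _ _) (el_A _ _ _ _ _ _ _) _) (el_T _ _ _ _ _ _ _)

theorem app_id (hs : ((u ≫ A.p) ≫ X.e) ≫ X.s = u ≫ A.p) (ht : ((u ≫ A.p) ≫ X.e) ≫ X.t = u ≫ A.p) :
    A.app u ((u ≫ A.p) ≫ X.e) u hs ht = (u ≫ A.functor.obj) ≫ Y.e := by
  rw [Category.assoc u A.functor.obj, ← A.functor.map_e, ← Category.assoc, app]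
  congr 1
  symm
  apply eq_el'
  · rw [Category.assoc, (J.base X A.p A.cover).e_s, Category.comp_id]
  · rw [Category.assoc, el_A, Category.assoc]
  · rw [Category.assoc, (J.base X A.p A.cover).e_t, Category.comp_id]

theorem map_el {V : S} {w : V ⟶ X.obj} (hw : J.IsCover w) (k : V ⟶ A.U) (hk : k ≫ A.p = w)
    (x : T ⟶ V) (a : T ⟶ X.arr) (x' : T ⟶ V) (hs : a ≫ X.s = x ≫ w) (ht : a ≫ X.t = x' ≫ w) :
    J.el hw x a x' hs ht ≫ ((J.baseMap X A.cover hw k hk).comp A.functor).arr =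
      A.app (x ≫ k) a (x' ≫ k) (by rw [hs, Category.assoc, hk])
        (by rw [ht, Category.assoc, hk]) := by
  refine (Category.assoc _ _ _).symm.trans ?_
  rw [app]
  congr 1
  apply eq_el'
  · rw [Category.assoc, el_S, ← Category.assoc, el_S]
  · rw [Category.assoc, el_A, el_A]
  · rw [Category.assoc, el_T, ← Category.assoc, el_T]

end app

/-- A family of arrows `app u a v : f(u) ⟶ g(v)` of `Y`, for all arrows `a` of `X` and lifts `u`,
`v` of its source and target, natural in all variables.  These families correspond bijectively to
transformations of anafunctors, see `Anafunctor.famEquiv`. -/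
structure Fam (A B : Anafunctor J X Y) where
  /-- the family -/
  app : ∀ {T : S} (u : T ⟶ A.U) (a : T ⟶ X.arr) (v : T ⟶ B.U),
    a ≫ X.s = u ≫ A.p → a ≫ X.t = v ≫ B.p → (T ⟶ Y.arr)
  app_s : ∀ {T : S} (u : T ⟶ A.U) (a : T ⟶ X.arr) (v : T ⟶ B.U) (hs : a ≫ X.s = u ≫ A.p)
    (ht : a ≫ X.t = v ≫ B.p), app u a v hs ht ≫ Y.s = u ≫ A.functor.obj
  app_t : ∀ {T : S} (u : T ⟶ A.U) (a : T ⟶ X.arr) (v : T ⟶ B.U) (hs : a ≫ X.s = u ≫ A.p)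
    (ht : a ≫ X.t = v ≫ B.p), app u a v hs ht ≫ Y.t = v ≫ B.functor.obj
  comp_app : ∀ {T T' : S} (u : T ⟶ A.U) (a : T ⟶ X.arr) (v : T ⟶ B.U) (hs : a ≫ X.s = u ≫ A.p)
    (ht : a ≫ X.t = v ≫ B.p) (r : T' ⟶ T),
    r ≫ app u a v hs ht = app (r ≫ u) (r ≫ a) (r ≫ v) (by simp [hs]) (by simp [ht])
  pre : ∀ {T : S} (u' : T ⟶ A.U) (b : T ⟶ X.arr) (u : T ⟶ A.U) (a : T ⟶ X.arr) (v : T ⟶ B.U)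
    (hs' : b ≫ X.s = u' ≫ A.p) (ht' : b ≫ X.t = u ≫ A.p)
    (hs : a ≫ X.s = u ≫ A.p) (ht : a ≫ X.t = v ≫ B.p)
    (h : A.app u' b u hs' ht' ≫ Y.t = app u a v hs ht ≫ Y.s),
    Y.comp (A.app u' b u hs' ht') (app u a v hs ht) h =
      app u' (X.comp b a (by rw [ht', hs])) v (by rw [X.comp_s, hs']) (by rw [X.comp_t, ht])
  post : ∀ {T : S} (u : T ⟶ A.U) (a : T ⟶ X.arr) (v : T ⟶ B.U) (b : T ⟶ X.arr) (v' : T ⟶ B.U)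
    (hs : a ≫ X.s = u ≫ A.p) (ht : a ≫ X.t = v ≫ B.p)
    (hs' : b ≫ X.s = v ≫ B.p) (ht' : b ≫ X.t = v' ≫ B.p)
    (h : app u a v hs ht ≫ Y.t = B.app v b v' hs' ht' ≫ Y.s),
    Y.comp (app u a v hs ht) (B.app v b v' hs' ht') h =
      app u (X.comp a b (by rw [ht, hs'])) v' (by rw [X.comp_s, hs]) (by rw [X.comp_t, ht'])

namespace Fam

variable {A B D : Anafunctor J X Y}

theorem ext' {F G : Fam A B} (h : ∀ {T : S} (u : T ⟶ A.U) (a : T ⟶ X.arr) (v : T ⟶ B.U)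
    (hs : a ≫ X.s = u ≫ A.p) (ht : a ≫ X.t = v ≫ B.p), F.app u a v hs ht = G.app u a v hs ht) :
    F = G := by
  cases F; cases G
  congr
  funext T u a v hs ht
  exact h u a v hs ht

theorem app_congr (F : Fam A B) {T : S} {u u' : T ⟶ A.U} {a a' : T ⟶ X.arr} {v v' : T ⟶ B.U}
    (hu : u = u') (ha : a = a') (hv : v = v') (hs : a ≫ X.s = u ≫ A.p) (ht : a ≫ X.t = v ≫ B.p) :
    F.app u a v hs ht = F.app u' a' v' (by rw [← hu, ← ha, hs]) (by rw [← hv, ← ha, ht]) := by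
  subst hu ha hv; rfl

end Fam

/-- The component `α(u, v) : f(u) ⟶ g(v)` of a transformation at a generalised element of
`U ×_{X₀} V`. -/
noncomputable def Trans.ev {A B : Anafunctor J X Y} (α : Trans A B) {T : S} (u : T ⟶ A.U)
    (v : T ⟶ B.U) (h : u ≫ A.p = v ≫ B.p) : T ⟶ Y.arr :=
  (A.prod B).lift u v h ≫ InternalTrans.app α

namespace Trans

variable {A B D : Anafunctor J X Y}

theorem ext' {α β : Trans A B} (h : InternalTrans.app α = InternalTrans.app β) : α = β :=
  InternalTrans.ext h

section

variable (α : Trans A B) {T : S} (u : T ⟶ A.U) (v : T ⟶ B.U) (h : u ≫ A.p = v ≫ B.p)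

theorem ev_s : α.ev u v h ≫ Y.s = u ≫ A.functor.obj := by
  rw [ev, Category.assoc, InternalTrans.app_s]
  exact SpecifiedPullback.lift_fst_assoc _ _ _ _ _

theorem ev_t : α.ev u v h ≫ Y.t = v ≫ B.functor.obj := by
  rw [ev, Category.assoc, InternalTrans.app_t]
  exact SpecifiedPullback.lift_snd_assoc _ _ _ _ _

theorem ev_congr {u' : T ⟶ A.U} {v' : T ⟶ B.U} (hu : u = u') (hv : v = v') :
    α.ev u v h = α.ev u' v' (by rw [← hu, ← hv, h]) := by
  subst hu hv; rfl

theorem comp_ev {T' : S} (r : T' ⟶ T) :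
    r ≫ α.ev u v h = α.ev (r ≫ u) (r ≫ v) (by simp [h]) := by
  rw [ev, ev, ← Category.assoc]
  congr 1
  apply (A.prod B).hom_ext <;> simp

theorem ev_nat (a : T ⟶ X.arr) (u' : T ⟶ A.U) (v' : T ⟶ B.U) (h' : u' ≫ A.p = v' ≫ B.p)
    (hs : a ≫ X.s = u ≫ A.p) (ht : a ≫ X.t = u' ≫ A.p) :
    Y.comp (A.app u a u' hs ht) (α.ev u' v' h') (by rw [app_t, ev_s]) =
      Y.comp (α.ev u v h) (B.app v a v' (by rw [hs, h]) (by rw [ht, h']))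
        (by rw [ev_t, B.app_s]) := by
  let x := (A.prod B).lift u v h
  let x' := (A.prod B).lift u' v' h'
  have n := InternalTrans.nat α (J.el (prod_cover A B) x a x' (by simp [x, hs]) (by simp [x', ht]))
  refine Eq.trans (Y.comp_congr ?_ ?_ _) (n.trans (Y.comp_congr ?_ ?_ _))
  · rw [map_el]; exact (app_congr _ _ _ _ _ _ (by simp [x]) rfl (by simp [x'])).symm
  · rw [ev]; congr 1; exact (el_T _ _ _ _ _ _ _).symm
  · rw [ev]; congr 1; exact el_S _ _ _ _ _ _ _
  · rw [map_el]; exact (app_congr _ _ _ _ _ _ (by simp [x]) rfl (by simp [x']))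

end

end Trans

/-- The transformation with components `α(u, v) = F(u, id, v)`. -/
noncomputable def ofFam {A B : Anafunctor J X Y} (F : Fam A B) : Trans A B where
  app := F.app (A.prod B).fst (((A.prod B).fst ≫ A.p) ≫ X.e) (A.prod B).snd
    (by simp [X.e_s]) (by simp [X.e_t, (A.prod B).w])
  app_s := F.app_s _ _ _ _ _
  app_t := F.app_t _ _ _ _ _
  naturality := by
    have hA := A.map_el (prod_cover A B) (A.prod B).fst rfl (J.bcS (prod_cover A B))
      (J.bcA (prod_cover A B)) (J.bcT (prod_cover A B)) (J.bcA_s _) (J.bcA_t _)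
    have hB := B.map_el (prod_cover A B) (A.prod B).snd (A.prod B).w.symm (J.bcS (prod_cover A B))
      (J.bcA (prod_cover A B)) (J.bcT (prod_cover A B)) (J.bcA_s _) (J.bcA_t _)
    have h1 : J.el (prod_cover A B) (J.bcS (prod_cover A B)) (J.bcA (prod_cover A B))
        (J.bcT (prod_cover A B)) (J.bcA_s _) (J.bcA_t _) = 𝟙 _ := by
      apply bc_hom_ext <;> simp
    rw [h1, Category.id_comp] at hA hB
    refine Eq.trans (Y.comp_congr hA (F.comp_app _ _ _ _ _ _) _) (Eq.trans ?_
      (Y.comp_congr (F.comp_app _ _ _ _ _ _) hB _).symm)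
    rw [F.pre, F.post]
    refine F.app_congr rfl ?_ rfl _ _
    rw [X.comp_id' _ _ (Category.assoc _ _ _).symm, X.id_comp' _ _ (Category.assoc _ _ _).symm]

theorem ofFam_ev {A B : Anafunctor J X Y} (F : Fam A B) {T : S} (u : T ⟶ A.U) (v : T ⟶ B.U)
    (h : u ≫ A.p = v ≫ B.p) : (ofFam F).ev u v h = F.app u ((u ≫ A.p) ≫ X.e) v
      (by simp [X.e_s]) (by simp [X.e_t, h]) := by
  refine (F.comp_app _ _ _ _ _ _).trans (F.app_congr (by simp) (by simp) (by simp) _ _)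

section Descent

variable [J.IsSubcanonical]

theorem exists_ext {A B : Anafunctor J X Y} (α : Trans A B) {T : S} (u : T ⟶ A.U) (a : T ⟶ X.arr)
    (v : T ⟶ B.U) (hs : a ≫ X.s = u ≫ A.p) (ht : a ≫ X.t = v ≫ B.p) :
    ∃ d : T ⟶ Y.arr, ∀ {T' : S} (r : T' ⟶ T) (w : T' ⟶ B.U) (h : r ≫ u ≫ A.p = w ≫ B.p),
      r ≫ d = Y.comp (α.ev (r ≫ u) w (by rw [Category.assoc, h]))
        (B.app w (r ≫ a) (r ≫ v) (by rw [Category.assoc, hs, h])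
          (by rw [Category.assoc, Category.assoc, ht])) (by rw [Trans.ev_t, app_s]) := by
  refine exists_glue B.cover (u ≫ A.p)
    (fun {T'} r w h => Y.comp (α.ev (r ≫ u) w (by rw [Category.assoc, h]))
        (B.app w (r ≫ a) (r ≫ v) (by rw [Category.assoc, hs, h])
          (by rw [Category.assoc, Category.assoc, ht])) (by rw [Trans.ev_t, app_s])) ?_ ?_
  · intro T' T'' r w h r' h'
    rw [Y.precomp]
    refine Y.comp_congr ?_ ?_ _
    · rw [Trans.comp_ev]; exact Trans.ev_congr _ _ _ _ (by simp) rfl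
    · rw [comp_app]; exact app_congr _ _ _ _ _ _ rfl (by simp) (by simp)
  · intro T' r w w' h h'
    have hw : w ≫ B.p = w' ≫ B.p := by rw [← h, h']
    have n := α.ev_nat (r ≫ u) w (by rw [Category.assoc, h]) ((w ≫ B.p) ≫ X.e) (r ≫ u) w'
      (by rw [Category.assoc, h']) (by simp [X.e_s, h]) (by simp [X.e_t, h])
    have hid : A.app (r ≫ u) ((w ≫ B.p) ≫ X.e) (r ≫ u) (by simp [X.e_s, h]) (by simp [X.e_t, h])
        = ((r ≫ u) ≫ A.functor.obj) ≫ Y.e := by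
      rw [← app_id _ _ (by simp [X.e_s]) (by simp [X.e_t])]
      exact app_congr _ _ _ _ _ _ rfl (by rw [Category.assoc r, h]) rfl
    rw [Y.id_comp' _ _ hid] at n
    have hB := B.app_comp w ((w ≫ B.p) ≫ X.e) w' (by simp [X.e_s]) (by simp [X.e_t, hw]) (r ≫ a)
      (r ≫ v) (by rw [Category.assoc, hs, h']) (by rw [Category.assoc, Category.assoc, ht])
      (by rw [app_t, app_s])
    refine Eq.trans ?_ (Y.comp_congr n rfl (by rw [Trans.ev_t, app_s])).symm
    rw [Y.comp_assoc]
    refine Y.comp_congr rfl (Eq.trans ?_ hB.symm) _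
    exact app_congr _ _ _ _ _ _ rfl (X.id_comp _ _ (by simp [X.e_t, hs, h])).symm rfl

/-- The value `α(u, a, v)` of a transformation at an arrow `a` with lifts `u`, `v` of its source and
target; it is locally equal to `α(u, w) ; g(w, a, v)`, where `w` lifts the source of `a`. -/
noncomputable def Trans.ext {A B : Anafunctor J X Y} (α : Trans A B) {T : S} (u : T ⟶ A.U)
    (a : T ⟶ X.arr) (v : T ⟶ B.U) (hs : a ≫ X.s = u ≫ A.p) (ht : a ≫ X.t = v ≫ B.p) : T ⟶ Y.arr :=
  (exists_ext α u a v hs ht).choose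

namespace Trans

variable {A B : Anafunctor J X Y} (α : Trans A B) {T : S} (u : T ⟶ A.U) (a : T ⟶ X.arr)
    (v : T ⟶ B.U) (hs : a ≫ X.s = u ≫ A.p) (ht : a ≫ X.t = v ≫ B.p)

theorem ext_congr {u' : T ⟶ A.U} {a' : T ⟶ X.arr} {v' : T ⟶ B.U}
    (hu : u = u') (ha : a = a') (hv : v = v') :
    α.ext u a v hs ht = α.ext u' a' v' (by rw [← hu, ← ha, hs]) (by rw [← hv, ← ha, ht]) := by
  subst hu ha hv; rfl

theorem ext_eq (w : T ⟶ B.U) (h : u ≫ A.p = w ≫ B.p) :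
    α.ext u a v hs ht = Y.comp (α.ev u w h) (B.app w a v (by rw [hs, h]) ht)
      (by rw [Trans.ev_t, app_s]) := by
  have := (exists_ext α u a v hs ht).choose_spec (𝟙 T) w (by rw [Category.id_comp, h])
  rw [Category.id_comp] at this
  refine this.trans (Y.comp_congr (ev_congr _ _ _ _ (by simp) rfl)
    (app_congr _ _ _ _ _ _ rfl (by simp) (by simp)) _)

theorem comp_ext {T' : S} (r : T' ⟶ T) : r ≫ α.ext u a v hs ht =
    α.ext (r ≫ u) (r ≫ a) (r ≫ v) (by simp [hs]) (by simp [ht]) := by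
  apply local_eq B.cover (r ≫ u ≫ A.p)
  intro T'' q w h
  have e := (exists_ext α u a v hs ht).choose_spec (q ≫ r) w (by simpa using h)
  have e' := (exists_ext α (r ≫ u) (r ≫ a) (r ≫ v) (by simp [hs]) (by simp [ht])).choose_spec q w
    (by simpa using h)
  refine (Category.assoc _ _ _).symm.trans (e.trans (Eq.trans ?_ e'.symm))
  exact Y.comp_congr (ev_congr _ _ _ _ (by simp) rfl)
    (app_congr _ _ _ _ _ _ rfl (by simp) (by simp)) _

theorem ext_s : α.ext u a v hs ht ≫ Y.s = u ≫ A.functor.obj := by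
  apply local_eq B.cover (u ≫ A.p)
  intro T' r w h
  rw [← Category.assoc, comp_ext, ext_eq α _ _ _ _ _ w (by simpa using h), Y.comp_s, ev_s,
    Category.assoc]

theorem ext_t : α.ext u a v hs ht ≫ Y.t = v ≫ B.functor.obj := by
  apply local_eq B.cover (u ≫ A.p)
  intro T' r w h
  rw [← Category.assoc, comp_ext, ext_eq α _ _ _ _ _ w (by simpa using h), Y.comp_t, app_t,
    Category.assoc]

theorem ext_pre (u' : T ⟶ A.U) (b : T ⟶ X.arr) (hs' : b ≫ X.s = u' ≫ A.p) (ht' : b ≫ X.t = u ≫ A.p)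
    (h : A.app u' b u hs' ht' ≫ Y.t = α.ext u a v hs ht ≫ Y.s) :
    Y.comp (A.app u' b u hs' ht') (α.ext u a v hs ht) h =
      α.ext u' (X.comp b a (by rw [ht', hs])) v (by rw [X.comp_s, hs']) (by rw [X.comp_t, ht]) := by
  apply local_eq B.cover (u ≫ A.p)
  intro T₁ r w h₁
  apply local_eq B.cover (r ≫ u' ≫ A.p)
  intro T₂ q w' h₂
  simp only [Y.precomp, comp_ext, comp_app, X.precomp]
  refine Eq.trans ?_ (ext_eq α _ _ _ (by rw [X.comp_s]; simp [hs'])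
    (by rw [X.comp_t]; simp [ht]) w' (by simpa using h₂)).symm
  have e := ext_eq α (q ≫ r ≫ u) (q ≫ r ≫ a) (q ≫ r ≫ v) (by simp [hs]) (by simp [ht]) (q ≫ w)
    (by simp [h₁])
  have n := α.ev_nat (q ≫ r ≫ u') w' (by simpa using h₂) (q ≫ r ≫ b) (q ≫ r ≫ u) (q ≫ w)
    (by simp [h₁]) (by simp [hs']) (by simp [ht'])
  have c := B.app_comp w' (q ≫ r ≫ b) (q ≫ w) (by simpa [hs'] using h₂) (by simp [ht', h₁])
    (q ≫ r ≫ a) (q ≫ r ≫ v) (by simp [hs, h₁]) (by simp [ht]) (by rw [app_t, app_s])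
  refine (Y.comp_congr rfl e (by rw [app_t, ext_s])).trans ?_
  refine (Y.comp_assoc _ _ _ (by rw [app_t, ev_s]) (by rw [Y.comp_t, ev_t, app_s])).symm.trans ?_
  refine (Y.comp_congr n rfl (by rw [Y.comp_t, ev_t, app_s])).trans ?_
  refine (Y.comp_assoc _ _ _ (by rw [ev_t, app_s]) (by rw [Y.comp_t, app_t, app_s])).trans ?_
  exact Y.comp_congr rfl c (by rw [Y.comp_s, ev_t, app_s])

theorem ext_post (b : T ⟶ X.arr) (v' : T ⟶ B.U)
    (hs' : b ≫ X.s = v ≫ B.p) (ht' : b ≫ X.t = v' ≫ B.p)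
    (h : α.ext u a v hs ht ≫ Y.t = B.app v b v' hs' ht' ≫ Y.s) :
    Y.comp (α.ext u a v hs ht) (B.app v b v' hs' ht') h =
      α.ext u (X.comp a b (by rw [ht, hs'])) v' (by rw [X.comp_s, hs])
        (by rw [X.comp_t, ht']) := by
  apply local_eq B.cover (u ≫ A.p)
  intro T₁ r w h₁
  simp only [Y.precomp, comp_ext, comp_app, X.precomp]
  refine Eq.trans ?_ (ext_eq α _ _ _ (by rw [X.comp_s]; simp [hs])
    (by rw [X.comp_t]; simp [ht']) w (by simpa using h₁)).symm
  have e := ext_eq α (r ≫ u) (r ≫ a) (r ≫ v) (by simp [hs]) (by simp [ht]) w (by simpa using h₁)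
  have c := B.app_comp w (r ≫ a) (r ≫ v) (by simpa [hs] using h₁) (by simp [ht])
    (r ≫ b) (r ≫ v') (by simp [hs']) (by simp [ht']) (by rw [app_t, app_s])
  refine (Y.comp_congr e rfl (by rw [ext_t, app_s])).trans ?_
  refine (Y.comp_assoc _ _ _ (by rw [ev_t, app_s]) (by rw [Y.comp_t, app_t, app_s])).trans ?_
  exact Y.comp_congr rfl c (by rw [Y.comp_s, ev_t, app_s])

end Trans

/-- The family of arrows corresponding to a transformation. -/
noncomputable def toFam {A B : Anafunctor J X Y} (α : Trans A B) : Fam A B where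
  app u a v hs ht := α.ext u a v hs ht
  app_s u a v hs ht := α.ext_s u a v hs ht
  app_t u a v hs ht := α.ext_t u a v hs ht
  comp_app u a v hs ht r := α.comp_ext u a v hs ht r
  pre u' b u a v hs' ht' hs ht h := α.ext_pre u a v hs ht u' b hs' ht' h
  post u a v b v' hs ht hs' ht' h := α.ext_post u a v hs ht b v' hs' ht' h

theorem toFam_ofFam {A B : Anafunctor J X Y} (F : Fam A B) : toFam (ofFam F) = F := by
  apply Fam.ext'
  intro T u a v hs ht
  change (ofFam F).ext u a v hs ht = _
  apply local_eq B.cover (u ≫ A.p)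
  intro T' r w h
  rw [F.comp_app, Trans.comp_ext, Trans.ext_eq _ _ _ _ _ _ w (by simpa using h)]
  refine (Y.comp_congr (ofFam_ev F (r ≫ u) w (by simpa using h)) rfl
    (by rw [Trans.ev_t, app_s])).trans ?_
  rw [F.post]
  exact F.app_congr rfl (X.id_comp _ _ (by simp [X.e_t, hs])) rfl _ _

theorem ofFam_toFam {A B : Anafunctor J X Y} (α : Trans A B) : ofFam (toFam α) = α := by
  apply Trans.ext'
  change α.ext (A.prod B).fst (((A.prod B).fst ≫ A.p) ≫ X.e) (A.prod B).snd
    (by simp [X.e_s]) (by simp [X.e_t, (A.prod B).w]) = _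
  rw [Trans.ext_eq _ _ _ _ _ _ (A.prod B).snd (A.prod B).w]
  rw [Y.comp_id' _ _ (by
    rw [← app_id B (A.prod B).snd (by simp [X.e_s]) (by simp [X.e_t])]
    exact app_congr _ _ _ _ _ _ rfl (by rw [(A.prod B).w]) rfl)]
  have : (A.prod B).lift (A.prod B).fst (A.prod B).snd (A.prod B).w = 𝟙 _ := by
    apply (A.prod B).hom_ext <;> simp
  rw [Trans.ev, this, Category.id_comp]

/-- Transformations of anafunctors are the same as natural families of arrows. -/
noncomputable def famEquiv (A B : Anafunctor J X Y) : Trans A B ≃ Fam A B :=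
  ⟨toFam, ofFam, ofFam_toFam, toFam_ofFam⟩

end Descent

namespace Fam

variable {A B D : Anafunctor J X Y} (F : Fam A B) (G : Fam B D)

theorem mid {T : S} (u : T ⟶ A.U) (b : T ⟶ X.arr) (v : T ⟶ B.U) (c : T ⟶ X.arr) (v' : T ⟶ B.U)
    (d : T ⟶ X.arr) (w : T ⟶ D.U) (hu : b ≫ X.s = u ≫ A.p) (hv : b ≫ X.t = v ≫ B.p)
    (hc : c ≫ X.s = v ≫ B.p) (hc' : c ≫ X.t = v' ≫ B.p) (hd : d ≫ X.s = v' ≫ B.p)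
    (hw : d ≫ X.t = w ≫ D.p) :
    Y.comp (F.app u b v hu hv)
      (G.app v (X.comp c d (by rw [hc', hd])) w (by rw [X.comp_s, hc]) (by rw [X.comp_t, hw]))
      (by rw [F.app_t, G.app_s]) =
    Y.comp (F.app u (X.comp b c (by rw [hv, hc])) v' (by rw [X.comp_s, hu]) (by rw [X.comp_t, hc']))
      (G.app v' d w hd hw) (by rw [F.app_t, G.app_s]) := by
  have e := G.pre v c v' d w hc hc' hd hw (by rw [Anafunctor.app_t, G.app_s])
  have e' := F.post u b v c v' hu hv hc hc' (by rw [Anafunctor.app_s, F.app_t])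
  refine (Y.comp_congr rfl e.symm (by rw [F.app_t, G.app_s])).trans ?_
  refine Eq.trans ?_ (Y.comp_congr e' rfl (by rw [Y.comp_t, Anafunctor.app_t, G.app_s]))
  rw [Y.comp_assoc]

variable [J.IsSubcanonical]

theorem exists_vcomp {T : S} (u : T ⟶ A.U) (a : T ⟶ X.arr) (w : T ⟶ D.U)
    (hs : a ≫ X.s = u ≫ A.p) (ht : a ≫ X.t = w ≫ D.p) :
    ∃ d : T ⟶ Y.arr, ∀ {T' : S} (r : T' ⟶ T) (b : T' ⟶ X.arr) (v : T' ⟶ B.U) (c : T' ⟶ X.arr)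
      (hb : b ≫ X.s = (r ≫ u) ≫ A.p) (hb' : b ≫ X.t = v ≫ B.p)
      (hc : c ≫ X.s = v ≫ B.p) (hc' : c ≫ X.t = (r ≫ w) ≫ D.p),
      X.comp b c (by rw [hb', hc]) = r ≫ a →
      r ≫ d = Y.comp (F.app (r ≫ u) b v hb hb') (G.app v c (r ≫ w) hc hc')
        (by rw [F.app_t, G.app_s]) := by
  have k1 : ∀ {T' : S} (r : T' ⟶ T) (v : T' ⟶ B.U), r ≫ (u ≫ A.p) = v ≫ B.p →
    (((r ≫ u) ≫ A.p) ≫ X.e) ≫ X.s = (r ≫ u) ≫ A.p := by intros; simp [X.e_s]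
  have k2 : ∀ {T' : S} (r : T' ⟶ T) (v : T' ⟶ B.U), r ≫ (u ≫ A.p) = v ≫ B.p →
    (((r ≫ u) ≫ A.p) ≫ X.e) ≫ X.t = v ≫ B.p := by intro _ r v h; simp [X.e_t, h]
  have k3 : ∀ {T' : S} (r : T' ⟶ T) (v : T' ⟶ B.U), r ≫ (u ≫ A.p) = v ≫ B.p →
    (r ≫ a) ≫ X.s = v ≫ B.p := by intro _ r v h; simp [hs, h]
  have k4 : ∀ {T' : S} (r : T' ⟶ T), (r ≫ a) ≫ X.t = (r ≫ w) ≫ D.p := by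
    intro _ r; simp [ht]
  obtain ⟨d, hd⟩ := exists_glue B.cover (u ≫ A.p)
    (fun {T'} r v h => Y.comp (F.app (r ≫ u) (((r ≫ u) ≫ A.p) ≫ X.e) v (k1 r v h) (k2 r v h))
      (G.app v (r ≫ a) (r ≫ w) (k3 r v h) (k4 r)) (by rw [F.app_t, G.app_s]))
    (by
      intro T' T'' r v h r' h'
      rw [Y.precomp]
      refine Y.comp_congr ?_ ?_ _
      · rw [F.comp_app]; exact F.app_congr (by simp) (by simp) rfl _ _
      · rw [G.comp_app]; exact G.app_congr rfl (by simp) (by simp) _ _)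
    (by
      intro T' r v v' h h'
      have m := mid F G (r ≫ u) (((r ≫ u) ≫ A.p) ≫ X.e) v (((r ≫ u) ≫ A.p) ≫ X.e) v' (r ≫ a)
        (r ≫ w) (k1 r v h) (k2 r v h) (by simp [X.e_s, h]) (k2 r v' h') (k3 r v' h') (k4 r)
      refine Eq.trans ?_ (m.trans ?_)
      · exact Y.comp_congr rfl
          (G.app_congr rfl (X.id_comp _ _ (by simp [X.e_t, hs])).symm rfl _ _) _
      · exact Y.comp_congr
          (F.app_congr rfl (X.id_comp _ _ (by simp [X.e_t, X.e_s])) rfl _ _) rfl _)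
  refine ⟨d, fun {T'} r b v c hb hb' hc hc' hbc => ?_⟩
  apply local_eq B.cover (r ≫ u ≫ A.p)
  intro T₂ q v₀ h₀
  rw [← Category.assoc, hd _ v₀ (by simpa using h₀), Y.precomp]
  have m := mid F G (q ≫ r ≫ u) ((((q ≫ r) ≫ u) ≫ A.p) ≫ X.e) v₀ (q ≫ b) (q ≫ v) (q ≫ c)
    (q ≫ r ≫ w) (by simp [X.e_s]) (by simpa [X.e_t] using h₀) (by simpa [hb] using h₀)
    (by simp [hb']) (by simp [hc]) (by simp [hc'])
  refine Eq.trans (Y.comp_congr ?_ ?_ _) (m.trans (Y.comp_congr ?_ ?_ _))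
  · exact F.app_congr (by simp) rfl rfl _ _
  · exact G.app_congr rfl ((Category.assoc _ _ _).trans (by rw [← X.precomp _ _ _ (by rw [hb', hc]), hbc])) (by simp) _ _
  · rw [F.comp_app]
    exact F.app_congr rfl (X.id_comp _ _ (by simp [X.e_t, hb])) rfl _ _
  · rw [G.comp_app]

/-- The composite of two families. -/
noncomputable def vapp {T : S} (u : T ⟶ A.U) (a : T ⟶ X.arr) (w : T ⟶ D.U)
    (hs : a ≫ X.s = u ≫ A.p) (ht : a ≫ X.t = w ≫ D.p) : T ⟶ Y.arr :=
  (exists_vcomp F G u a w hs ht).choose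

theorem comp_vapp {T T' : S} (u : T ⟶ A.U) (a : T ⟶ X.arr) (w : T ⟶ D.U)
    (hs : a ≫ X.s = u ≫ A.p) (ht : a ≫ X.t = w ≫ D.p) (r : T' ⟶ T) (b : T' ⟶ X.arr)
    (v : T' ⟶ B.U) (c : T' ⟶ X.arr)
    (hb : b ≫ X.s = (r ≫ u) ≫ A.p) (hb' : b ≫ X.t = v ≫ B.p)
    (hc : c ≫ X.s = v ≫ B.p) (hc' : c ≫ X.t = (r ≫ w) ≫ D.p)
    (h : X.comp b c (by rw [hb', hc]) = r ≫ a) :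
    r ≫ vapp F G u a w hs ht = Y.comp (F.app (r ≫ u) b v hb hb') (G.app v c (r ≫ w) hc hc')
        (by rw [F.app_t, G.app_s]) :=
  (exists_vcomp F G u a w hs ht).choose_spec r b v c hb hb' hc hc' h

theorem vapp_eq {T : S} (u : T ⟶ A.U) (a b : T ⟶ X.arr) (v : T ⟶ B.U) (c : T ⟶ X.arr)
    (w : T ⟶ D.U) (hs : a ≫ X.s = u ≫ A.p) (ht : a ≫ X.t = w ≫ D.p)
    (hb : b ≫ X.s = u ≫ A.p) (hb' : b ≫ X.t = v ≫ B.p)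
    (hc : c ≫ X.s = v ≫ B.p) (hc' : c ≫ X.t = w ≫ D.p)
    (h : X.comp b c (by rw [hb', hc]) = a) :
    vapp F G u a w hs ht = Y.comp (F.app u b v hb hb') (G.app v c w hc hc')
        (by rw [F.app_t, G.app_s]) := by
  have := comp_vapp F G u a w hs ht (𝟙 T) b v c (by simpa using hb) hb' hc (by simpa using hc')
    (by simpa using h)
  rw [Category.id_comp] at this
  refine this.trans (Y.comp_congr (F.app_congr (by simp) rfl rfl _ _)
    (G.app_congr rfl rfl (by simp) _ _) _)

/-- The vertical composite of two families; its value at `b ; c` is `F(u, b, v) ; G(v, c, w)`. -/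
noncomputable def vcomp : Fam A D where
  app u a w hs ht := vapp F G u a w hs ht
  app_s u a w hs ht := by
    apply local_eq B.cover (u ≫ A.p)
    intro T' r v h
    rw [← Category.assoc, comp_vapp F G u a w hs ht r (((r ≫ u) ≫ A.p) ≫ X.e) v (r ≫ a)
      (by simp [X.e_s]) (by simp [X.e_t, h]) (by simp [hs, h]) (by simp [ht])
      (X.id_comp _ _ (by simp [X.e_t, hs])), Y.comp_s, F.app_s, Category.assoc]
  app_t u a w hs ht := by
    apply local_eq B.cover (u ≫ A.p)
    intro T' r v h
    rw [← Category.assoc, comp_vapp F G u a w hs ht r (((r ≫ u) ≫ A.p) ≫ X.e) v (r ≫ a)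
      (by simp [X.e_s]) (by simp [X.e_t, h]) (by simp [hs, h]) (by simp [ht])
      (X.id_comp _ _ (by simp [X.e_t, hs])), Y.comp_t, G.app_t, Category.assoc]
  comp_app u a w hs ht r := by
    apply local_eq B.cover (r ≫ u ≫ A.p)
    intro T' q v h
    have e := comp_vapp F G u a w hs ht (q ≫ r) (((q ≫ r ≫ u) ≫ A.p) ≫ X.e) v (q ≫ r ≫ a)
      (by simp [X.e_s]) (by simp [X.e_t, h]) (by simp [hs, h]) (by simp [ht])
      ((X.id_comp _ _ (by simp [X.e_t, hs])).trans (by simp))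
    have e' := comp_vapp F G (r ≫ u) (r ≫ a) (r ≫ w) (by simp [hs]) (by simp [ht]) q
      (((q ≫ r ≫ u) ≫ A.p) ≫ X.e) v (q ≫ r ≫ a)
      (by simp [X.e_s]) (by simp [X.e_t, h]) (by simp [hs, h]) (by simp [ht])
      (X.id_comp _ _ (by simp [X.e_t, hs]))
    refine (Category.assoc _ _ _).symm.trans (e.trans (Eq.trans ?_ e'.symm))
    exact Y.comp_congr (F.app_congr (by simp) rfl rfl _ _) (G.app_congr rfl rfl (by simp) _ _) _
  pre u' b u a w hs' ht' hs ht h := by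
    apply local_eq B.cover (u ≫ A.p)
    intro T' r v hv
    have e := comp_vapp F G u a w hs ht r (((r ≫ u) ≫ A.p) ≫ X.e) v (r ≫ a)
      (by simp [X.e_s]) (by simp [X.e_t, hv]) (by simp [hs, hv]) (by simp [ht])
      (X.id_comp _ _ (by simp [X.e_t, hs]))
    have e' := comp_vapp F G u' (X.comp b a (by rw [ht', hs])) w (by rw [X.comp_s, hs'])
      (by rw [X.comp_t, ht]) r (r ≫ b) v (r ≫ a)
      (by simp [hs']) (by simp [ht', hv]) (by simp [hs, hv]) (by simp [ht])
      (X.precomp _ _ _ _).symm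
    rw [e', Y.precomp]
    have c := F.pre (r ≫ u') (r ≫ b) (r ≫ u) (((r ≫ u) ≫ A.p) ≫ X.e) v (by simp [hs'])
      (by simp [ht']) (by simp [X.e_s]) (by simp [X.e_t, hv]) (by rw [Anafunctor.app_t, F.app_s])
    refine (Y.comp_congr (A.comp_app u' b u hs' ht' r) e
      (by rw [Category.assoc, Category.assoc, h])).trans ?_
    refine (Y.comp_assoc _ _ _ (by rw [Anafunctor.app_t, F.app_s])
      (by rw [Y.comp_t, F.app_t, G.app_s])).symm.trans ?_
    refine Y.comp_congr (c.trans (F.app_congr rfl ?_ rfl _ _)) rfl _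
    exact X.comp_id _ _ (by simp [X.e_s, ht'])
  post u a v b v' hs ht hs' ht' h := by
    apply local_eq B.cover (u ≫ A.p)
    intro T' r x hx
    have e := comp_vapp F G u a v hs ht r (((r ≫ u) ≫ A.p) ≫ X.e) x (r ≫ a)
      (by simp [X.e_s]) (by simp [X.e_t, hx]) (by simp [hs, hx]) (by simp [ht])
      (X.id_comp _ _ (by simp [X.e_t, hs]))
    have e' := comp_vapp F G u (X.comp a b (by rw [ht, hs'])) v' (by rw [X.comp_s, hs])
      (by rw [X.comp_t, ht']) r (((r ≫ u) ≫ A.p) ≫ X.e) x (X.comp (r ≫ a) (r ≫ b)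
        (by simp [hs', ht]))
      (by simp [X.e_s]) (by simp [X.e_t, hx]) (by rw [X.comp_s]; simp [hs, hx])
      (by rw [X.comp_t]; simp [ht'])
      ((X.id_comp _ _ (by rw [X.comp_s]; simp [X.e_t, hs])).trans (X.precomp _ _ _ _).symm)
    rw [e', Y.precomp]
    have c := G.post x (r ≫ a) (r ≫ v) (r ≫ b) (r ≫ v') (by simp [hs, hx])
      (by simp [ht]) (by simp [hs']) (by simp [ht']) (by rw [Anafunctor.app_s, G.app_t])
    refine (Y.comp_congr e (D.comp_app v b v' hs' ht' r)
      (by rw [Category.assoc, Category.assoc, h])).trans ?_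
    refine (Y.comp_assoc _ _ _ (by rw [F.app_t, G.app_s])
      (by rw [Y.comp_t, G.app_t, Anafunctor.app_s])).trans ?_
    exact Y.comp_congr rfl c _

/-- The identity family. -/
noncomputable def id (A : Anafunctor J X Y) : Fam A A where
  app := A.app
  app_s := A.app_s
  app_t := A.app_t
  comp_app u a v hs ht r := A.comp_app u a v hs ht r
  pre u' b u a v hs' ht' hs ht h := A.app_comp u' b u hs' ht' a v hs ht h
  post u a v b v' hs ht hs' ht' h := A.app_comp u a v hs ht b v' hs' ht' h

end Fam

section Category

variable [J.IsSubcanonical]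

/-- Transformations `(U, f) ⇒ (V, g) ⇒ (W, h)` are composed by descent: the composite is the unique
transformation which at `(u, w)` is locally `α(u, v) ; β(v, w)`, see `comp_ev_eq`. -/
noncomputable instance category : Category (Anafunctor J X Y) where
  Hom A B := Trans A B
  id A := ofFam (Fam.id A)
  comp α β := ofFam (Fam.vcomp (toFam α) (toFam β))
  id_comp {A B} α := by
    refine Eq.trans ?_ (ofFam_toFam α)
    congr 1
    rw [toFam_ofFam]
    apply Fam.ext'
    intro T u a v hs ht
    refine (Fam.vapp_eq _ _ u a ((u ≫ A.p) ≫ X.e) u a v hs ht (by simp [X.e_s]) (by simp [X.e_t])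
      hs ht (X.id_comp _ _ _)).trans ?_
    exact Y.id_comp' (u ≫ A.functor.obj) _ (app_id A u _ _)
  comp_id {A B} α := by
    refine Eq.trans ?_ (ofFam_toFam α)
    congr 1
    rw [toFam_ofFam]
    apply Fam.ext'
    intro T u a v hs ht
    refine (Fam.vapp_eq _ _ u a a v ((v ≫ B.p) ≫ X.e) v hs ht hs ht (by simp [X.e_s])
      (by simp [X.e_t]) (X.comp_id _ _ _)).trans ?_
    exact Y.comp_id' (v ≫ B.functor.obj) _ (app_id B v _ _)
  assoc {A B D E} α β γ := by
    congr 1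
    rw [toFam_ofFam, toFam_ofFam]
    apply Fam.ext'
    intro T u a v hs ht
    apply local_eq B.cover (u ≫ A.p)
    intro T₁ r x hx
    apply local_eq D.cover (r ≫ u ≫ A.p)
    intro T₂ q y hy
    rw [Fam.comp_app, Fam.comp_app, Fam.comp_app, Fam.comp_app]
    have i₁ : (((q ≫ r ≫ u) ≫ A.p) ≫ X.e) ≫ X.s = (q ≫ r ≫ u) ≫ A.p := by simp [X.e_s]
    have i₂ : (((q ≫ r ≫ u) ≫ A.p) ≫ X.e) ≫ X.t = y ≫ D.p := by simp [X.e_t, hy]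
    have i₂' : (((q ≫ r ≫ u) ≫ A.p) ≫ X.e) ≫ X.t = (q ≫ x) ≫ B.p := by simp [X.e_t, hx]
    have i₃ : (q ≫ r ≫ a) ≫ X.s = y ≫ D.p := by simp [hs, hy]
    have i₃' : (q ≫ r ≫ a) ≫ X.s = (q ≫ x) ≫ B.p := by simp [hs, hx]
    have i₄ : (q ≫ r ≫ a) ≫ X.t = (q ≫ r ≫ v) ≫ E.p := by simp [ht]
    have i₅ : (((q ≫ r ≫ u) ≫ A.p) ≫ X.e) ≫ X.s = (q ≫ x) ≫ B.p := by simp [X.e_s, hx]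
    have hh : (((q ≫ r ≫ u) ≫ A.p) ≫ X.e) ≫ X.t = (q ≫ r ≫ a) ≫ X.s := by simp [X.e_t, hs]
    have hh' : (((q ≫ r ≫ u) ≫ A.p) ≫ X.e) ≫ X.t = (((q ≫ r ≫ u) ≫ A.p) ≫ X.e) ≫ X.s := by
      simp [X.e_t, X.e_s]
    refine (Fam.vapp_eq ((toFam α).vcomp (toFam β)) (toFam γ) _ _ _ y (q ≫ r ≫ a) _
      (by simp [hs]) i₄ i₁ i₂ i₃ i₄ (X.id_comp _ _ hh)).trans ?_
    refine (Y.comp_congr (Fam.vapp_eq (toFam α) (toFam β) _ _ (((q ≫ r ≫ u) ≫ A.p) ≫ X.e) (q ≫ x)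
      (((q ≫ r ≫ u) ≫ A.p) ≫ X.e) _ i₁ i₂ i₁ i₂' i₅ i₂ (X.id_comp _ _ hh')) rfl
      ((Fam.app_t ((toFam α).vcomp (toFam β)) _ _ _ i₁ i₂).trans
        (Fam.app_s (toFam γ) _ _ _ _ _).symm)).trans ?_
    refine (Y.comp_assoc _ _ _ (by rw [Fam.app_t, Fam.app_s])
      (by rw [Y.comp_t, Fam.app_t, Fam.app_s])).trans ?_
    refine Eq.trans ?_ (Fam.vapp_eq (toFam α) ((toFam β).vcomp (toFam γ)) _ _
      (((q ≫ r ≫ u) ≫ A.p) ≫ X.e) (q ≫ x) (q ≫ r ≫ a) _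
      (by simp [hs]) i₄ i₁ i₂' i₃' i₄ (X.id_comp _ _ hh)).symm
    refine Y.comp_congr rfl ?_ (by rw [Y.comp_s, Fam.app_t, Fam.app_s])
    exact (Fam.vapp_eq (toFam β) (toFam γ) _ _ (((q ≫ r ≫ u) ≫ A.p) ≫ X.e) y
      (q ≫ r ≫ a) _ i₃' i₄ i₅ i₂ i₃ i₄ (X.id_comp _ _ hh)).symm

variable {A B D : Anafunctor J X Y}

/-- The value `α(u, a, v)` of a transformation, see `Trans.ext`. -/
noncomputable def ext (α : A ⟶ B) {T : S} (u : T ⟶ A.U) (a : T ⟶ X.arr) (v : T ⟶ B.U)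
    (hs : a ≫ X.s = u ≫ A.p) (ht : a ≫ X.t = v ≫ B.p) : T ⟶ Y.arr :=
  (toFam α).app u a v hs ht

theorem comp_ext' (α : A ⟶ B) {T T' : S} (u : T ⟶ A.U) (a : T ⟶ X.arr) (v : T ⟶ B.U)
    (hs : a ≫ X.s = u ≫ A.p) (ht : a ≫ X.t = v ≫ B.p) (r : T' ⟶ T) :
    r ≫ ext α u a v hs ht =
      ext α (r ≫ u) (r ≫ a) (r ≫ v) (by simp [hs]) (by simp [ht]) :=
  Fam.comp_app _ _ _ _ _ _ _

theorem ext_s' (α : A ⟶ B) {T : S} (u : T ⟶ A.U) (a : T ⟶ X.arr) (v : T ⟶ B.U)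
    (hs : a ≫ X.s = u ≫ A.p) (ht : a ≫ X.t = v ≫ B.p) :
    ext α u a v hs ht ≫ Y.s = u ≫ A.functor.obj := Fam.app_s _ _ _ _ _ _

theorem ext_t' (α : A ⟶ B) {T : S} (u : T ⟶ A.U) (a : T ⟶ X.arr) (v : T ⟶ B.U)
    (hs : a ≫ X.s = u ≫ A.p) (ht : a ≫ X.t = v ≫ B.p) :
    ext α u a v hs ht ≫ Y.t = v ≫ B.functor.obj := Fam.app_t _ _ _ _ _ _

theorem ext_pre' (α : A ⟶ B) {T : S} (u' : T ⟶ A.U) (b : T ⟶ X.arr) (u : T ⟶ A.U)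
    (a c : T ⟶ X.arr) (v : T ⟶ B.U)
    (hs' : b ≫ X.s = u' ≫ A.p) (ht' : b ≫ X.t = u ≫ A.p)
    (hs : a ≫ X.s = u ≫ A.p) (ht : a ≫ X.t = v ≫ B.p)
    (h : A.app u' b u hs' ht' ≫ Y.t = ext α u a v hs ht ≫ Y.s)
    (hc : X.comp b a (by rw [ht', hs]) = c) :
    Y.comp (A.app u' b u hs' ht') (ext α u a v hs ht) h =
      ext α u' c v (by rw [← hc, X.comp_s, hs']) (by rw [← hc, X.comp_t, ht]) := by
  subst hc
  exact Fam.pre _ _ _ _ _ _ _ _ _ _ _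

theorem ext_post' (α : A ⟶ B) {T : S} (u : T ⟶ A.U) (a : T ⟶ X.arr) (v : T ⟶ B.U)
    (b c : T ⟶ X.arr) (v' : T ⟶ B.U)
    (hs : a ≫ X.s = u ≫ A.p) (ht : a ≫ X.t = v ≫ B.p)
    (hs' : b ≫ X.s = v ≫ B.p) (ht' : b ≫ X.t = v' ≫ B.p)
    (h : ext α u a v hs ht ≫ Y.t = B.app v b v' hs' ht' ≫ Y.s)
    (hc : X.comp a b (by rw [ht, hs']) = c) :
    Y.comp (ext α u a v hs ht) (B.app v b v' hs' ht') h =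
      ext α u c v' (by rw [← hc, X.comp_s, hs]) (by rw [← hc, X.comp_t, ht']) := by
  subst hc
  exact Fam.post _ _ _ _ _ _ _ _ _ _ _

theorem ext_injective {α β : A ⟶ B} (h : ∀ {T : S} (u : T ⟶ A.U) (a : T ⟶ X.arr) (v : T ⟶ B.U)
    (hs : a ≫ X.s = u ≫ A.p) (ht : a ≫ X.t = v ≫ B.p), ext α u a v hs ht = ext β u a v hs ht) :
    α = β := by
  have : toFam α = toFam β := Fam.ext' h
  rw [← ofFam_toFam α, this]
  exact ofFam_toFam β

theorem ext_ofFam (F : Fam A B) {T : S} (u : T ⟶ A.U) (a : T ⟶ X.arr) (v : T ⟶ B.U)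
    (hs : a ≫ X.s = u ≫ A.p) (ht : a ≫ X.t = v ≫ B.p) :
    ext (ofFam F : A ⟶ B) u a v hs ht = F.app u a v hs ht := by
  unfold ext
  rw [toFam_ofFam]

theorem ext_congr' (α : A ⟶ B) {T : S} {u u' : T ⟶ A.U} {a a' : T ⟶ X.arr} {v v' : T ⟶ B.U}
    (hu : u = u') (ha : a = a') (hv : v = v') (hs : a ≫ X.s = u ≫ A.p) (ht : a ≫ X.t = v ≫ B.p) :
    ext α u a v hs ht = ext α u' a' v' (by rw [← hu, ← ha, hs]) (by rw [← hv, ← ha, ht]) := by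
  subst hu ha hv; rfl

theorem ext_id (A : Anafunctor J X Y) {T : S} (u : T ⟶ A.U) (a : T ⟶ X.arr) (v : T ⟶ A.U)
    (hs : a ≫ X.s = u ≫ A.p) (ht : a ≫ X.t = v ≫ A.p) :
    ext (𝟙 A) u a v hs ht = A.app u a v hs ht :=
  ext_ofFam _ _ _ _ _ _

theorem ext_comp (α : A ⟶ B) (β : B ⟶ D) {T : S} (u : T ⟶ A.U) (a b : T ⟶ X.arr) (v : T ⟶ B.U)
    (c : T ⟶ X.arr) (w : T ⟶ D.U) (hs : a ≫ X.s = u ≫ A.p) (ht : a ≫ X.t = w ≫ D.p)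
    (hb : b ≫ X.s = u ≫ A.p) (hb' : b ≫ X.t = v ≫ B.p)
    (hc : c ≫ X.s = v ≫ B.p) (hc' : c ≫ X.t = w ≫ D.p)
    (h : X.comp b c (by rw [hb', hc]) = a) :
    ext (α ≫ β) u a w hs ht = Y.comp (ext α u b v hb hb') (ext β v c w hc hc')
        (by unfold ext; rw [Fam.app_t, Fam.app_s]) :=
  (ext_ofFam _ _ _ _ _ _).trans (Fam.vapp_eq _ _ u a b v c w hs ht hb hb' hc hc' h)

/-- Composition at a lift `v` of the source of `a`. -/
theorem ext_comp_src (α : A ⟶ B) (β : B ⟶ D) {T : S} (u : T ⟶ A.U) (a : T ⟶ X.arr) (v : T ⟶ B.U)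
    (w : T ⟶ D.U) (hs : a ≫ X.s = u ≫ A.p) (ht : a ≫ X.t = w ≫ D.p) (h : u ≫ A.p = v ≫ B.p) :
    ext (α ≫ β) u a w hs ht = Y.comp (ext α u ((u ≫ A.p) ≫ X.e) v (by simp [X.e_s])
        (by simp [X.e_t, h])) (ext β v a w (by rw [hs, h]) ht)
        (by unfold ext; rw [Fam.app_t, Fam.app_s]) :=
  ext_comp α β u a _ v a w hs ht _ _ _ _ (X.id_comp _ _ (by simp [X.e_t, hs]))

/-- Composition at a lift `v` of the target of `a`. -/
theorem ext_comp_tgt (α : A ⟶ B) (β : B ⟶ D) {T : S} (u : T ⟶ A.U) (a : T ⟶ X.arr) (v : T ⟶ B.U)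
    (w : T ⟶ D.U) (hs : a ≫ X.s = u ≫ A.p) (ht : a ≫ X.t = w ≫ D.p) (h : w ≫ D.p = v ≫ B.p) :
    ext (α ≫ β) u a w hs ht = Y.comp (ext α u a v hs (by rw [ht, h]))
        (ext β v ((w ≫ D.p) ≫ X.e) w (by simp [X.e_s, h]) (by simp [X.e_t]))
        (by unfold ext; rw [Fam.app_t, Fam.app_s]) :=
  ext_comp α β u a a v _ w hs ht _ _ _ _ (X.comp_id _ _ (by simp [X.e_s, ht]))

theorem ev_eq_ext (α : A ⟶ B) {T : S} (u : T ⟶ A.U) (v : T ⟶ B.U) (h : u ≫ A.p = v ≫ B.p) :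
    Trans.ev α u v h = ext α u ((u ≫ A.p) ≫ X.e) v (by simp [X.e_s]) (by simp [X.e_t, h]) := by
  conv_lhs => rw [← ofFam_toFam α]
  rw [ofFam_ev]
  rfl

/-- The characterisation of vertical composition: `(α ≫ β)(u, w) = α(u, v) ; β(v, w)`. -/
theorem comp_ev_eq (α : A ⟶ B) (β : B ⟶ D) {T : S} (u : T ⟶ A.U) (v : T ⟶ B.U) (w : T ⟶ D.U)
    (h : u ≫ A.p = v ≫ B.p) (h' : v ≫ B.p = w ≫ D.p) :
    Trans.ev (α ≫ β) u w (h.trans h') = Y.comp (Trans.ev α u v h) (Trans.ev β v w h')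
      (by rw [Trans.ev_t, Trans.ev_s]) := by
  rw [ev_eq_ext, ext_comp_src α β _ _ v _ _ _ h]
  refine Y.comp_congr (ev_eq_ext _ _ _ _).symm ?_ _
  rw [ev_eq_ext]
  exact ext_congr' _ rfl (by rw [h]) rfl _ _

/-- A map `θ` between the covers of two anafunctors, over `X₀` and compatible with the functors. -/
structure IsRefinement (A B : Anafunctor J X Y) (θ : A.U ⟶ B.U) : Prop where
  p : θ ≫ B.p = A.p
  obj : θ ≫ B.functor.obj = A.functor.obj
  app : ∀ {T : S} (u : T ⟶ A.U) (a : T ⟶ X.arr) (v : T ⟶ A.U) (hs : a ≫ X.s = u ≫ A.p)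
      (ht : a ≫ X.t = v ≫ A.p),
      A.app u a v hs ht = B.app (u ≫ θ) a (v ≫ θ) (by simp [hs, p]) (by simp [ht, p])

/-- The family `g(θ(u), a, v)` for a refinement `θ` of covers compatible with the functors. -/
noncomputable def mapFam (θ : A.U ⟶ B.U) (h : IsRefinement A B θ) :
    Fam A B where
  app u a v hs ht := B.app (u ≫ θ) a v (by simp [hs, h.p]) ht
  app_s u a v hs ht := (app_s _ _ _ _ _ _).trans (by rw [Category.assoc, h.obj])
  app_t u a v hs ht := app_t _ _ _ _ _ _
  comp_app u a v hs ht r :=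
    (B.comp_app _ _ _ _ _ _).trans (app_congr _ _ _ _ _ _ (by simp) rfl rfl)
  pre u' b u a v hs' ht' hs ht k := (Y.comp_congr (h.app _ _ _ hs' ht') rfl _).trans
    (B.app_comp _ _ _ _ _ _ _ _ _ (by rw [Anafunctor.app_t, Anafunctor.app_s]))
  post u a v b v' hs ht hs' ht' k := app_comp _ _ _ _ _ _ _ _ _ _ _

/-- The family `g(u, a, θ(v))` for a refinement `θ` of covers compatible with the functors. -/
noncomputable def mapFamInv (θ : A.U ⟶ B.U) (h : IsRefinement A B θ) :
    Fam B A where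
  app u a v hs ht := B.app u a (v ≫ θ) hs (by simp [ht, h.p])
  app_s u a v hs ht := app_s _ _ _ _ _ _
  app_t u a v hs ht := (app_t _ _ _ _ _ _).trans (by rw [Category.assoc, h.obj])
  comp_app u a v hs ht r :=
    (B.comp_app _ _ _ _ _ _).trans (app_congr _ _ _ _ _ _ rfl rfl (by simp))
  pre u' b u a v hs' ht' hs ht k := app_comp _ _ _ _ _ _ _ _ _ _ _
  post u a v b v' hs ht hs' ht' k := (Y.comp_congr rfl (h.app _ _ _ hs' ht') _).trans
    (B.app_comp _ _ _ _ _ _ _ _ _ (by rw [Anafunctor.app_t, Anafunctor.app_s]))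

/-- A refinement `θ` of covers which is compatible with the functors gives an invertible
transformation, with component `g(θ(u), id, v)` at `(u, v)`. -/
@[reducible] noncomputable def isoOfMap (θ : A.U ⟶ B.U) (h : IsRefinement A B θ) :
    A ≅ B where
  hom := ofFam (mapFam θ h)
  inv := ofFam (mapFamInv θ h)
  hom_inv_id := by
    apply ext_injective
    intro T u a v hs ht
    rw [ext_comp_src _ _ _ _ (u ≫ θ) _ hs ht (by simp [h.p]), ext_id, h.app]
    refine Y.comp_congr (ext_ofFam _ _ _ _ _ _) (ext_ofFam _ _ _ _ _ _) _ |>.trans ?_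
    exact Y.id_comp' ((u ≫ θ) ≫ B.functor.obj) _ ((app_congr _ _ _ _ _ _ rfl
      (by simp [h.p]) rfl).trans (app_id B (u ≫ θ) (by simp [X.e_s]) (by simp [X.e_t])))
  inv_hom_id := by
    apply ext_injective
    intro T u a v hs ht
    apply local_eq A.cover (u ≫ B.p)
    intro T' r x hx
    rw [show r ≫ ext (_ ≫ _) u a v hs ht = _ from Fam.comp_app _ _ _ _ _ _ _,
      show r ≫ ext (𝟙 B) u a v hs ht = _ from Fam.comp_app _ _ _ _ _ _ _]
    refine (ext_comp_src _ _ (r ≫ u) (r ≫ a) x (r ≫ v) (by simp [hs]) (by simp [ht])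
      (by simpa using hx)).trans (Eq.trans ?_ (ext_id _ _ _ _ (by simp [hs]) (by simp [ht])).symm)
    refine (Y.comp_congr (ext_ofFam _ _ _ _ _ _) (ext_ofFam _ _ _ _ _ _) _).trans ?_
    refine (app_comp _ _ _ _ _ _ _ _ _ _ _).trans (app_congr _ _ _ _ _ _ rfl ?_ rfl)
    exact X.id_comp _ _ (by simp [hs, X.e_t])

end Category

section Composition

/-- The identity anafunctor `(X₀, id)`. -/
@[reducible] noncomputable def id (J : UnarySite S) (X : InternalCat S) : Anafunctor J X X where
  U := X.obj
  p := 𝟙 X.obj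
  cover := cover_id X.obj
  functor := J.baseProj X (𝟙 X.obj) (cover_id X.obj)

/-- The cover `U ×_{Y₀} V ⟶ U` used to compose `(U, f)` and `(V, g)`. -/
@[reducible] noncomputable def compPb (A : Anafunctor J X Y) (B : Anafunctor J Y Z) :
    SpecifiedPullback A.functor.obj B.p :=
  J.pb A.functor.obj B.p B.cover

/-- The composite `X[U ×_{Y₀} V] ⟶ Y[V] ⟶ Z` of the anafunctors `(U, f)` and `(V, g)`. -/
@[reducible] noncomputable def comp (A : Anafunctor J X Y) (B : Anafunctor J Y Z) :
    Anafunctor J X Z where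
  U := (compPb A B).pt
  p := (compPb A B).fst ≫ A.p
  cover := cover_fst_comp _ _ _ _ A.cover
  functor := InternalFunctor.comp
    (J.baseLift B.cover
      ((J.baseMap X A.cover (cover_fst_comp _ _ B.cover _ A.cover) (compPb A B).fst rfl).comp
        A.functor)
      (compPb A B).snd (compPb A B).w.symm) B.functor

theorem id_app {T : S} (u : T ⟶ (id J X).U) (a : T ⟶ X.arr) (v : T ⟶ (id J X).U)
    (hs : a ≫ X.s = u ≫ (id J X).p) (ht : a ≫ X.t = v ≫ (id J X).p) :
    (id J X).app u a v hs ht = a :=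
  J.el_A _ _ _ _ _ _

section

variable (A : Anafunctor J X Y) (B : Anafunctor J Y Z) {T : S} (u : T ⟶ (comp A B).U)
    (a : T ⟶ X.arr) (v : T ⟶ (comp A B).U)
    (hs : a ≫ X.s = u ≫ (comp A B).p) (ht : a ≫ X.t = v ≫ (comp A B).p)

theorem comp_app_aux :
    A.app (u ≫ (compPb A B).fst) a (v ≫ (compPb A B).fst) (by simpa using hs) (by simpa using ht) ≫
      Y.s = (u ≫ (compPb A B).snd) ≫ B.p := by
  rw [app_s, Category.assoc, Category.assoc, (compPb A B).w]

theorem comp_app_aux' :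
    A.app (u ≫ (compPb A B).fst) a (v ≫ (compPb A B).fst) (by simpa using hs) (by simpa using ht) ≫
      Y.t = (v ≫ (compPb A B).snd) ≫ B.p := by
  rw [app_t, Category.assoc, Category.assoc, (compPb A B).w]

theorem comp_app_eq : (comp A B).app u a v hs ht =
    B.app (u ≫ (compPb A B).snd) (A.app (u ≫ (compPb A B).fst) a (v ≫ (compPb A B).fst)
      (by simpa using hs) (by simpa using ht)) (v ≫ (compPb A B).snd)
      (comp_app_aux A B u a v hs ht) (comp_app_aux' A B u a v hs ht) := by
  have h := map_el A (cover_fst_comp _ _ B.cover _ A.cover) (compPb A B).fst rfl u a v hs ht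
  refine (Category.assoc _ _ _).symm.trans ?_
  refine congrArg (· ≫ B.functor.arr) ?_
  apply eq_el'
  · rw [Category.assoc, el_S, ← Category.assoc, el_S]
  · rw [Category.assoc, el_A]; exact h
  · rw [Category.assoc, el_T, ← Category.assoc, el_T]

end

/-- The canonical map `(U ×_{Y₀} V) ×_{Z₀} W ⟶ U ×_{Y₀} (V ×_{Z₀} W)`. -/
noncomputable def assocMap (A : Anafunctor J X Y) (B : Anafunctor J Y Z) (C : Anafunctor J Z W) :
    (comp (comp A B) C).U ⟶ (comp A (comp B C)).U :=
  (compPb A (comp B C)).lift ((compPb (comp A B) C).fst ≫ (compPb A B).fst)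
    ((compPb B C).lift ((compPb (comp A B) C).fst ≫ (compPb A B).snd) (compPb (comp A B) C).snd
      ((Category.assoc _ _ _).trans (compPb (comp A B) C).w))
    (by rw [Category.assoc, (compPb A B).w]; simp)

section

variable (A : Anafunctor J X Y) (B : Anafunctor J Y Z) (C : Anafunctor J Z W)

theorem assocMap_fst : assocMap A B C ≫ (compPb A (comp B C)).fst =
    (compPb (comp A B) C).fst ≫ (compPb A B).fst := SpecifiedPullback.lift_fst _ _ _ _

theorem assocMap_snd_fst : assocMap A B C ≫ (compPb A (comp B C)).snd ≫ (compPb B C).fst =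
    (compPb (comp A B) C).fst ≫ (compPb A B).snd := by
  rw [assocMap, SpecifiedPullback.lift_snd_assoc, SpecifiedPullback.lift_fst]

theorem assocMap_snd_snd : assocMap A B C ≫ (compPb A (comp B C)).snd ≫ (compPb B C).snd =
    (compPb (comp A B) C).snd := by
  rw [assocMap, SpecifiedPullback.lift_snd_assoc, SpecifiedPullback.lift_snd]

theorem assocMap_isRefinement :
    IsRefinement (comp (comp A B) C) (comp A (comp B C)) (assocMap A B C) where
  p := by rw [← Category.assoc, assocMap_fst, Category.assoc]
  obj := by
    have := assocMap_snd_snd A B C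
    change assocMap A B C ≫ (compPb A (comp B C)).snd ≫ (compPb B C).snd ≫ C.functor.obj = _
    rw [reassoc_of% this]
  app := by
    intro T u a v hs ht
    refine (comp_app_eq _ _ _ _ _ _ _).trans (Eq.trans ?_ (comp_app_eq _ _ _ _ _ _ _).symm)
    refine (app_congr _ _ _ _ _ _ ?_ (comp_app_eq _ _ _ _ _ _ _) ?_).trans
      ((app_congr _ _ _ _ _ _ rfl (app_congr _ _ _ _ _ _ ?_ (app_congr _ _ _ _ _ _ ?_ rfl ?_)
        ?_) rfl).trans (comp_app_eq B C _ _ _ _ _).symm)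
    all_goals simp only [Category.assoc, assocMap_fst, assocMap_snd_fst, assocMap_snd_snd]

theorem snd_isRefinement : IsRefinement (comp (id J X) A) A (compPb (id J X) A).snd where
  p := (compPb (id J X) A).w.symm
  obj := rfl
  app := by
    intro T u a v hs ht
    rw [comp_app_eq]
    exact app_congr _ _ _ _ _ _ rfl (id_app _ _ _ _ _) rfl

theorem fst_isRefinement : IsRefinement (comp A (id J Y)) A (compPb A (id J Y)).fst where
  p := rfl
  obj := (compPb A (id J Y)).w
  app := by
    intro T u a v hs ht
    exact (comp_app_eq _ _ _ _ _ _ _).trans (id_app _ _ _ _ _)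

end

variable [J.IsSubcanonical]

/-- Left whiskering: the value of `A ◁ β` at `((u, v), a, (u', v'))` is `β(v, f(u, a, u'), v')`,
where `A = (U, f)`. -/
noncomputable def whiskerLeft (A : Anafunctor J X Y) {B B' : Anafunctor J Y Z} (β : B ⟶ B') :
    comp A B ⟶ comp A B' := ofFam
  { app := fun u a v hs ht => ext β (u ≫ (compPb A B).snd)
      (A.app (u ≫ (compPb A B).fst) a (v ≫ (compPb A B').fst)
        (by simpa using hs) (by simpa using ht)) (v ≫ (compPb A B').snd)
      (by rw [app_s, Category.assoc, Category.assoc, (compPb A B).w])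
      (by rw [app_t, Category.assoc, Category.assoc, (compPb A B').w])
    app_s := fun u a v hs ht => (ext_s' _ _ _ _ _ _).trans (Category.assoc _ _ _)
    app_t := fun u a v hs ht => (ext_t' _ _ _ _ _ _).trans (Category.assoc _ _ _)
    comp_app := fun u a v hs ht r => (comp_ext' _ _ _ _ _ _ _).trans
      (ext_congr' _ (Category.assoc _ _ _).symm ((A.comp_app _ _ _ _ _ _).trans
        (A.app_congr _ _ _ _ _ (Category.assoc _ _ _).symm rfl (Category.assoc _ _ _).symm))
        (Category.assoc _ _ _).symm _ _)
    pre := fun u' b u a v hs' ht' hs ht k => by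
      refine (Z.comp_congr (comp_app_eq A B u' b u hs' ht') rfl _).trans ?_
      refine (ext_pre' _ _ _ _ _ _ _ _ _ _ _ _ rfl).trans (ext_congr' _ rfl ?_ rfl _ _)
      exact A.app_comp _ _ _ _ _ _ _ _ _ _
    post := fun u a v b v' hs ht hs' ht' k => by
      refine (Z.comp_congr rfl (comp_app_eq A B' v b v' hs' ht') _).trans ?_
      refine (ext_post' _ _ _ _ _ _ _ _ _ _ _ _ rfl).trans (ext_congr' _ rfl ?_ rfl _ _)
      exact A.app_comp _ _ _ _ _ _ _ _ _ _ }

/-- Right whiskering: the value of `α ▷ B` at `((u, w), a, (u', w'))` is `g(w, α(u, a, u'), w')`,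
where `B = (W, g)`. -/
noncomputable def whiskerRight {A A' : Anafunctor J X Y} (α : A ⟶ A') (B : Anafunctor J Y Z) :
    comp A B ⟶ comp A' B := ofFam
  { app := fun u a v hs ht => B.app (u ≫ (compPb A B).snd)
      (ext α (u ≫ (compPb A B).fst) a (v ≫ (compPb A' B).fst)
        (by simpa using hs) (by simpa using ht)) (v ≫ (compPb A' B).snd)
      ((ext_s' _ _ _ _ _ _).trans
        (by rw [Category.assoc, Category.assoc, (compPb A B).w]))
      ((ext_t' _ _ _ _ _ _).trans
        (by rw [Category.assoc, Category.assoc, (compPb A' B).w]))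
    app_s := fun u a v hs ht => (app_s _ _ _ _ _ _).trans (Category.assoc _ _ _)
    app_t := fun u a v hs ht => (app_t _ _ _ _ _ _).trans (Category.assoc _ _ _)
    comp_app := fun u a v hs ht r => (B.comp_app _ _ _ _ _ _).trans
      (app_congr _ _ _ _ _ _ (Category.assoc _ _ _).symm ((comp_ext' _ _ _ _ _ _ _).trans
        (ext_congr' _ (Category.assoc _ _ _).symm rfl (Category.assoc _ _ _).symm _ _))
        (Category.assoc _ _ _).symm)
    pre := fun u' b u a v hs' ht' hs ht k => by
      refine (Z.comp_congr (comp_app_eq A B u' b u hs' ht') rfl _).trans ?_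
      refine (app_comp _ _ _ _ _ _ _ _ _ _ _).trans (app_congr _ _ _ _ _ _ rfl ?_ rfl)
      exact ext_pre' _ _ _ _ _ _ _ _ _ _ _ _ rfl
    post := fun u a v b v' hs ht hs' ht' k => by
      refine (Z.comp_congr rfl (comp_app_eq A' B v b v' hs' ht') _).trans ?_
      refine (app_comp _ _ _ _ _ _ _ _ _ _ _).trans (app_congr _ _ _ _ _ _ rfl ?_ rfl)
      exact ext_post' _ _ _ _ _ _ _ _ _ _ _ _ rfl }

theorem ext_whiskerLeft (A : Anafunctor J X Y) {B B' : Anafunctor J Y Z} (β : B ⟶ B') {T : S}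
    (u : T ⟶ (comp A B).U) (a : T ⟶ X.arr) (v : T ⟶ (comp A B').U)
    (hs : a ≫ X.s = u ≫ (comp A B).p) (ht : a ≫ X.t = v ≫ (comp A B').p) :
    ext (whiskerLeft A β) u a v hs ht = ext β (u ≫ (compPb A B).snd)
      (A.app (u ≫ (compPb A B).fst) a (v ≫ (compPb A B').fst)
        (by simpa using hs) (by simpa using ht)) (v ≫ (compPb A B').snd)
      (by rw [app_s, Category.assoc, Category.assoc, (compPb A B).w])
      (by rw [app_t, Category.assoc, Category.assoc, (compPb A B').w]) :=
  ext_ofFam _ _ _ _ _ _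

theorem ext_whiskerRight {A A' : Anafunctor J X Y} (α : A ⟶ A') (B : Anafunctor J Y Z) {T : S}
    (u : T ⟶ (comp A B).U) (a : T ⟶ X.arr) (v : T ⟶ (comp A' B).U)
    (hs : a ≫ X.s = u ≫ (comp A B).p) (ht : a ≫ X.t = v ≫ (comp A' B).p) :
    ext (whiskerRight α B) u a v hs ht = B.app (u ≫ (compPb A B).snd)
      (ext α (u ≫ (compPb A B).fst) a (v ≫ (compPb A' B).fst)
        (by simpa using hs) (by simpa using ht)) (v ≫ (compPb A' B).snd)
      ((ext_s' _ _ _ _ _ _).trans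
        (by rw [Category.assoc, Category.assoc, (compPb A B).w]))
      ((ext_t' _ _ _ _ _ _).trans
        (by rw [Category.assoc, Category.assoc, (compPb A' B).w])) :=
  ext_ofFam _ _ _ _ _ _

variable (A : Anafunctor J X Y) (B : Anafunctor J Y Z) (C : Anafunctor J Z W)

/-- The associator: at `(((u, v), w), (u', (v', w')))` it is `h(w, g(v, f(u, id, u'), v'), w')`. -/
@[reducible] noncomputable def associator : comp (comp A B) C ≅ comp A (comp B C) :=
  isoOfMap (assocMap A B C) (assocMap_isRefinement A B C)

/-- The left unitor, with cover map the projection `X₀ ×_{X₀} U ⟶ U`. -/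
@[reducible] noncomputable def leftUnitor : comp (id J X) A ≅ A :=
  isoOfMap (compPb (id J X) A).snd (snd_isRefinement A)

/-- The right unitor, with cover map the projection `U ×_{Y₀} Y₀ ⟶ U`. -/
@[reducible] noncomputable def rightUnitor : comp A (id J Y) ≅ A :=
  isoOfMap (compPb A (id J Y)).fst (fst_isRefinement A)

end Composition

section Axioms

variable [J.IsSubcanonical]

section

variable {A B D : Anafunctor J X Y}

theorem ext_map_comp (σ : A ⟶ B) (θ : A.U ⟶ B.U) (hθ : θ ≫ B.p = A.p)
    (hσ : ∀ {T : S} (u : T ⟶ A.U) (a : T ⟶ X.arr) (v : T ⟶ B.U) (hs : a ≫ X.s = u ≫ A.p)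
      (ht : a ≫ X.t = v ≫ B.p), ext σ u a v hs ht = B.app (u ≫ θ) a v (by simp [hs, hθ]) ht)
    (η : B ⟶ D) {T : S} (u : T ⟶ A.U) (a : T ⟶ X.arr) (v : T ⟶ D.U) (hs : a ≫ X.s = u ≫ A.p)
    (ht : a ≫ X.t = v ≫ D.p) :
    ext (σ ≫ η) u a v hs ht = ext η (u ≫ θ) a v (by simp [hs, hθ]) ht := by
  rw [ext_comp_src σ η u a (u ≫ θ) v hs ht (by simp [hθ])]
  refine (Y.comp_congr (hσ _ _ _ _ _) rfl (by rw [ext_t', ext_s'])).trans ?_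
  refine ext_pre' _ _ _ _ _ _ _ _ _ _ _ _ ?_
  exact X.id_comp _ _ (by simp [X.e_t, hs])

theorem ext_comp_map (η : D ⟶ B) (σ : B ⟶ A) (θ : A.U ⟶ B.U) (hθ : θ ≫ B.p = A.p)
    (hσ : ∀ {T : S} (u : T ⟶ B.U) (a : T ⟶ X.arr) (v : T ⟶ A.U) (hs : a ≫ X.s = u ≫ B.p)
      (ht : a ≫ X.t = v ≫ A.p), ext σ u a v hs ht = B.app u a (v ≫ θ) hs (by simp [ht, hθ]))
    {T : S} (u : T ⟶ D.U) (a : T ⟶ X.arr) (v : T ⟶ A.U) (hs : a ≫ X.s = u ≫ D.p)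
    (ht : a ≫ X.t = v ≫ A.p) :
    ext (η ≫ σ) u a v hs ht = ext η u a (v ≫ θ) hs (by simp [ht, hθ]) := by
  rw [ext_comp_tgt η σ u a (v ≫ θ) v hs ht (by simp [hθ])]
  refine (Y.comp_congr rfl (hσ _ _ _ _ _) (by rw [ext_t', ext_s'])).trans ?_
  refine ext_post' _ _ _ _ _ _ _ _ _ _ _ _ ?_
  exact X.comp_id _ _ (by simp [X.e_s, ht])

/-- Equality of transformations may be checked after choosing a local point of any cover over the
source. -/
theorem ext_local {V : S} {q : V ⟶ X.obj} (hq : J.IsCover q) {α β : A ⟶ B}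
    (h : ∀ {T : S} (u : T ⟶ A.U) (a : T ⟶ X.arr) (v : T ⟶ B.U)
      (hs : a ≫ X.s = u ≫ A.p) (ht : a ≫ X.t = v ≫ B.p) (x : T ⟶ V), u ≫ A.p = x ≫ q →
      ext α u a v hs ht = ext β u a v hs ht) : α = β := by
  apply ext_injective
  intro T u a v hs ht
  apply local_eq hq (u ≫ A.p)
  intro T' r x hx
  rw [comp_ext', comp_ext']
  exact h _ _ _ _ _ x (by simpa using hx)

theorem ext_local_tgt {V : S} {q : V ⟶ X.obj} (hq : J.IsCover q) {α β : A ⟶ B}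
    (h : ∀ {T : S} (u : T ⟶ A.U) (a : T ⟶ X.arr) (v : T ⟶ B.U)
      (hs : a ≫ X.s = u ≫ A.p) (ht : a ≫ X.t = v ≫ B.p) (x : T ⟶ V), v ≫ B.p = x ≫ q →
      ext α u a v hs ht = ext β u a v hs ht) : α = β := by
  apply ext_injective
  intro T u a v hs ht
  apply local_eq hq (v ≫ B.p)
  intro T' r x hx
  rw [comp_ext', comp_ext']
  exact h _ _ _ _ _ x (by simpa using hx)

end

theorem whiskerLeft_id (A : Anafunctor J X Y) (B : Anafunctor J Y Z) :
    whiskerLeft A (𝟙 B) = 𝟙 (comp A B) := by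
  apply ext_injective
  intro T u a v hs ht
  rw [ext_whiskerLeft, ext_id, ext_id, comp_app_eq]

theorem id_whiskerRight (A : Anafunctor J X Y) (B : Anafunctor J Y Z) :
    whiskerRight (𝟙 A) B = 𝟙 (comp A B) := by
  apply ext_injective
  intro T u a v hs ht
  refine (ext_whiskerRight _ _ _ _ _ _ _).trans (Eq.trans ?_ (ext_id _ _ _ _ _ _).symm)
  refine Eq.trans ?_ (comp_app_eq _ _ _ _ _ _ _).symm
  exact app_congr _ _ _ _ _ _ rfl (ext_id _ _ _ _ _ _) rfl

theorem whiskerLeft_comp (A : Anafunctor J X Y) {B B' B'' : Anafunctor J Y Z} (β : B ⟶ B')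
    (γ : B' ⟶ B'') : whiskerLeft A (β ≫ γ) = whiskerLeft A β ≫ whiskerLeft A γ := by
  apply ext_injective
  intro T u a v hs ht
  apply local_eq B'.cover ((u ≫ (compPb A B).fst) ≫ A.functor.obj)
  intro T' r y hy
  rw [comp_ext', comp_ext', ext_whiskerLeft]
  have h : (r ≫ u ≫ (compPb A B).fst) ≫ A.functor.obj = y ≫ B'.p := by simpa using hy
  let x := (compPb A B').lift _ _ h
  have hx₁ : x ≫ (compPb A B').fst = r ≫ u ≫ (compPb A B).fst := SpecifiedPullback.lift_fst _ _ _ _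
  have hx₂ : x ≫ (compPb A B').snd = y := SpecifiedPullback.lift_snd _ _ _ _
  have e := ext_comp_src (whiskerLeft A β) (whiskerLeft A γ) (r ≫ u) (r ≫ a) x (r ≫ v)
    (by simp [hs]) (by simp [ht]) (by rw [reassoc_of% hx₁]; simp)
  refine Eq.trans ?_ e.symm
  refine Eq.trans ?_ (Z.comp_congr (ext_whiskerLeft _ _ _ _ _ _ _) (ext_whiskerLeft _ _ _ _ _ _ _)
    _).symm
  refine ext_comp _ _ _ _ _ _ _ _ _ _ _ _ _ _ ?_
  refine (app_comp _ _ _ _ _ _ _ _ _ _ _).trans (app_congr _ _ _ _ _ _ rfl ?_ rfl)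
  exact X.id_comp _ _ (by simp [X.e_t, hs])

theorem comp_whiskerRight {A A' A'' : Anafunctor J X Y} (α : A ⟶ A') (β : A' ⟶ A'')
    (B : Anafunctor J Y Z) : whiskerRight (α ≫ β) B = whiskerRight α B ≫ whiskerRight β B := by
  apply ext_local (comp A' B).cover
  intro T u a v hs ht x hx
  rw [ext_whiskerRight]
  rw [ext_comp_src (whiskerRight α B) (whiskerRight β B) u a x v hs ht hx]
  refine Eq.trans ?_ (Z.comp_congr (ext_whiskerRight _ _ _ _ _ _ _)
    (ext_whiskerRight _ _ _ _ _ _ _) _).symm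
  refine Eq.trans ?_ (app_comp _ _ _ _ _ _ _ _ _ _ _).symm
  refine app_congr _ _ _ _ _ _ rfl ?_ rfl
  refine ext_comp _ _ _ _ _ _ _ _ _ _ _ _ _ _ ?_
  exact X.id_comp _ _ (by simp [X.e_t, hs])

theorem whisker_exchange {A A' : Anafunctor J X Y} {B B' : Anafunctor J Y Z} (α : A ⟶ A')
    (β : B ⟶ B') : whiskerLeft A β ≫ whiskerRight α B' = whiskerRight α B ≫ whiskerLeft A' β := by
  apply ext_injective
  intro T u a v hs ht
  apply local_eq B'.cover ((u ≫ (compPb A B).fst) ≫ A.functor.obj)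
  intro T₁ r y hy
  apply local_eq B.cover ((r ≫ v ≫ (compPb A' B').fst) ≫ A'.functor.obj)
  intro T₂ q z hz
  simp only [comp_ext']
  have h₁ : (q ≫ r ≫ u ≫ (compPb A B).fst) ≫ A.functor.obj = (q ≫ y) ≫ B'.p := by
    simp only [Category.assoc] at hy ⊢
    rw [hy]
  have h₂ : (q ≫ r ≫ v ≫ (compPb A' B').fst) ≫ A'.functor.obj = z ≫ B.p := by simpa using hz
  let x := (compPb A B').lift _ _ h₁
  have hx₁ : x ≫ (compPb A B').fst = q ≫ r ≫ u ≫ (compPb A B).fst :=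
    SpecifiedPullback.lift_fst _ _ _ _
  have hx₂ : x ≫ (compPb A B').snd = q ≫ y := SpecifiedPullback.lift_snd _ _ _ _
  let w := (compPb A' B).lift _ _ h₂
  have hw₁ : w ≫ (compPb A' B).fst = q ≫ r ≫ v ≫ (compPb A' B').fst :=
    SpecifiedPullback.lift_fst _ _ _ _
  have hw₂ : w ≫ (compPb A' B).snd = z := SpecifiedPullback.lift_snd _ _ _ _
  have hs' : (q ≫ r ≫ a) ≫ X.s = (q ≫ r ≫ u ≫ (compPb A B).fst) ≫ A.p := by simp [hs]
  have ht' : (q ≫ r ≫ a) ≫ X.t = (q ≫ r ≫ v ≫ (compPb A' B').fst) ≫ A'.p := by simp [ht]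
  have hc₁ : ext α (q ≫ r ≫ u ≫ (compPb A B).fst) (q ≫ r ≫ a)
      (q ≫ r ≫ v ≫ (compPb A' B').fst) hs' ht' ≫ Y.s = (q ≫ r ≫ u ≫ (compPb A B).snd) ≫ B.p := by
    rw [ext_s']; simp only [Category.assoc]; rw [(compPb A B).w]
  have hc₂ : ext α (q ≫ r ≫ u ≫ (compPb A B).fst) (q ≫ r ≫ a)
      (q ≫ r ≫ v ≫ (compPb A' B').fst) hs' ht' ≫ Y.t = (q ≫ r ≫ v ≫ (compPb A' B').snd) ≫ B'.p := by
    rw [ext_t']; simp only [Category.assoc]; rw [(compPb A' B').w]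
  trans ext β (q ≫ r ≫ u ≫ (compPb A B).snd)
    (ext α (q ≫ r ≫ u ≫ (compPb A B).fst) (q ≫ r ≫ a) (q ≫ r ≫ v ≫ (compPb A' B').fst) hs' ht')
    (q ≫ r ≫ v ≫ (compPb A' B').snd) hc₁ hc₂
  · refine (ext_comp_src (whiskerLeft A β) (whiskerRight α B') (q ≫ r ≫ u) (q ≫ r ≫ a) x (q ≫ r ≫ v)
      (by simp [hs]) (by simp [ht]) (by rw [reassoc_of% hx₁]; simp)).trans ?_
    refine (Z.comp_congr (ext_whiskerLeft _ _ _ _ _ _ _) (ext_whiskerRight _ _ _ _ _ _ _)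
      _).trans ?_
    refine (ext_post' _ _ _ _ _ _ _ _ _ _ _ _ rfl).trans
      (ext_congr' _ (by simp) ?_ (by simp) _ _)
    refine (ext_pre' _ _ _ _ _ _ _ _ _ _ _ (by rw [Anafunctor.app_t, ext_s']) rfl).trans
      (ext_congr' _ (by simp) ?_ (by simp) _ _)
    exact X.id_comp _ _ (by simp [X.e_t, hs])
  · symm
    refine (ext_comp_tgt (whiskerRight α B) (whiskerLeft A' β) (q ≫ r ≫ u) (q ≫ r ≫ a) w (q ≫ r ≫ v)
      (by simp [hs]) (by simp [ht]) (by rw [reassoc_of% hw₁]; simp)).trans ?_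
    refine (Z.comp_congr (ext_whiskerRight _ _ _ _ _ _ _) (ext_whiskerLeft _ _ _ _ _ _ _)
      _).trans ?_
    refine (ext_pre' _ _ _ _ _ _ _ _ _ _ _ _ rfl).trans
      (ext_congr' _ (by simp) ?_ (by simp) _ _)
    refine (ext_post' _ _ _ _ _ _ _ _ _ _ _ (by rw [Anafunctor.app_s, ext_t']) rfl).trans
      (ext_congr' _ (by simp) ?_ (by simp) _ _)
    exact X.comp_id _ _ (by simp [X.e_s, ht])

section

variable {A B A' B' D : Anafunctor J X Y} (θ : A.U ⟶ B.U) (h : IsRefinement A B θ)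
    (θ' : A'.U ⟶ B'.U) (h' : IsRefinement A' B' θ')

theorem isoOfMap_hom_ext {T : S} (u : T ⟶ A.U) (a : T ⟶ X.arr) (v : T ⟶ B.U)
    (hs : a ≫ X.s = u ≫ A.p) (ht : a ≫ X.t = v ≫ B.p) :
    ext (isoOfMap θ h).hom u a v hs ht = B.app (u ≫ θ) a v (by simp [hs, h.p]) ht :=
  ext_ofFam _ _ _ _ _ _

theorem isoOfMap_hom_comp (η : B ⟶ D) {T : S} (u : T ⟶ A.U) (a : T ⟶ X.arr) (v : T ⟶ D.U)
    (hs : a ≫ X.s = u ≫ A.p) (ht : a ≫ X.t = v ≫ D.p) :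
    ext ((isoOfMap θ h).hom ≫ η) u a v hs ht = ext η (u ≫ θ) a v (by simp [hs, h.p]) ht :=
  ext_map_comp _ θ h.p (isoOfMap_hom_ext θ h) _ _ _ _ _ _

theorem comp_isoOfMap_inv (η : D ⟶ B) {T : S} (u : T ⟶ D.U) (a : T ⟶ X.arr) (v : T ⟶ A.U)
    (hs : a ≫ X.s = u ≫ D.p) (ht : a ≫ X.t = v ≫ A.p) :
    ext (η ≫ (isoOfMap θ h).inv) u a v hs ht = ext η u a (v ≫ θ) hs (by simp [ht, h.p]) :=
  ext_comp_map _ _ θ h.p (fun _ _ _ _ _ => ext_ofFam _ _ _ _ _ _) _ _ _ _ _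

/-- Conjugation with two refinement isomorphisms. -/
theorem isoOfMap_conj (η : B ⟶ B') {T : S} (u : T ⟶ A.U) (a : T ⟶ X.arr) (v : T ⟶ A'.U)
    (hs : a ≫ X.s = u ≫ A.p) (ht : a ≫ X.t = v ≫ A'.p) :
    ext ((isoOfMap θ h).hom ≫ η ≫ (isoOfMap θ' h').inv) u a v hs ht =
      ext η (u ≫ θ) a (v ≫ θ') (by simp [hs, h.p]) (by simp [ht, h'.p]) :=
  (isoOfMap_hom_comp _ _ _ _ _ _ _ _).trans (comp_isoOfMap_inv _ _ _ _ _ _ _ _)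

end

theorem id_whiskerLeft {A B : Anafunctor J X Y} (η : A ⟶ B) :
    whiskerLeft (id J X) η = (leftUnitor A).hom ≫ η ≫ (leftUnitor B).inv := by
  apply ext_injective
  intro T u a v hs ht
  refine (ext_whiskerLeft _ _ _ _ _ _ _).trans (Eq.trans ?_ (isoOfMap_conj _
    (snd_isRefinement A) _ (snd_isRefinement B) _ _ _ _ _ _).symm)
  exact ext_congr' _ rfl (id_app _ _ _ _ _) rfl _ _

theorem whiskerRight_id {A B : Anafunctor J X Y} (η : A ⟶ B) :
    whiskerRight η (id J Y) = (rightUnitor A).hom ≫ η ≫ (rightUnitor B).inv := by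
  apply ext_injective
  intro T u a v hs ht
  refine (ext_whiskerRight _ _ _ _ _ _ _).trans (Eq.trans ?_ (isoOfMap_conj _
    (fst_isRefinement A) _ (fst_isRefinement B) _ _ _ _ _ _).symm)
  exact id_app _ _ _ _ _

theorem comp_whiskerLeft (A : Anafunctor J X Y) (B : Anafunctor J Y Z) {C C' : Anafunctor J Z W}
    (η : C ⟶ C') : whiskerLeft (comp A B) η =
      (associator A B C).hom ≫ whiskerLeft A (whiskerLeft B η) ≫ (associator A B C').inv := by
  apply ext_injective
  intro T u a v hs ht
  refine (ext_whiskerLeft _ _ _ _ _ _ _).trans (Eq.trans ?_ (isoOfMap_conj _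
    (assocMap_isRefinement A B C) _ (assocMap_isRefinement A B C') _ _ _ _ _ _).symm)
  refine Eq.trans ?_ (ext_whiskerLeft _ _ _ _ _ _ _).symm
  refine Eq.trans ?_ (ext_whiskerLeft _ _ _ _ _ _ _).symm
  refine ext_congr' _ ?_ ((comp_app_eq _ _ _ _ _ _ _).trans (app_congr _ _ _ _ _ _ ?_
    (app_congr _ _ _ _ _ _ ?_ rfl ?_) ?_)) ?_ _ _
  all_goals simp only [Category.assoc, assocMap_fst, assocMap_snd_fst, assocMap_snd_snd]

theorem whiskerRight_comp {A A' : Anafunctor J X Y} (η : A ⟶ A') (B : Anafunctor J Y Z)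
    (C : Anafunctor J Z W) : whiskerRight η (comp B C) =
      (associator A B C).inv ≫ whiskerRight (whiskerRight η B) C ≫ (associator A' B C).hom := by
  rw [← Category.assoc, ← Iso.comp_inv_eq, Iso.eq_inv_comp]
  apply ext_injective
  intro T u a v hs ht
  refine (isoOfMap_conj _
    (assocMap_isRefinement A B C) _ (assocMap_isRefinement A' B C) _ _ _ _ _ _).trans ?_
  refine (ext_whiskerRight _ _ _ _ _ _ _).trans (Eq.trans ?_ (ext_whiskerRight _ _ _ _ _ _ _).symm)
  refine (comp_app_eq _ _ _ _ _ _ _).trans ?_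
  refine app_congr _ _ _ _ _ _ ?_ (Eq.trans ?_ (ext_whiskerRight _ _ _ _ _ _ _).symm) ?_
  rotate_left
  refine app_congr _ _ _ _ _ _ ?_ (ext_congr' _ ?_ rfl ?_ _ _) ?_
  all_goals simp only [Category.assoc, assocMap_fst, assocMap_snd_fst, assocMap_snd_snd]

theorem whisker_assoc (A : Anafunctor J X Y) {B B' : Anafunctor J Y Z} (η : B ⟶ B')
    (C : Anafunctor J Z W) : whiskerRight (whiskerLeft A η) C =
      (associator A B C).hom ≫ whiskerLeft A (whiskerRight η C) ≫ (associator A B' C).inv := by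
  apply ext_injective
  intro T u a v hs ht
  refine (ext_whiskerRight _ _ _ _ _ _ _).trans (Eq.trans ?_ (isoOfMap_conj _
    (assocMap_isRefinement A B C) _ (assocMap_isRefinement A B' C) _ _ _ _ _ _).symm)
  refine Eq.trans ?_ (ext_whiskerLeft _ _ _ _ _ _ _).symm
  refine Eq.trans ?_ (ext_whiskerRight _ _ _ _ _ _ _).symm
  refine app_congr _ _ _ _ _ _ ?_ ((ext_whiskerLeft _ _ _ _ _ _ _).trans (ext_congr' _ ?_
    (app_congr _ _ _ _ _ _ ?_ rfl ?_) ?_ _ _)) ?_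
  all_goals simp only [Category.assoc, assocMap_fst, assocMap_snd_fst, assocMap_snd_snd]

theorem pentagon {V : InternalCat S} (A : Anafunctor J X Y) (B : Anafunctor J Y Z)
    (C : Anafunctor J Z W) (D : Anafunctor J W V) :
    whiskerRight (associator A B C).hom D ≫ (associator A (comp B C) D).hom ≫
        whiskerLeft A (associator B C D).hom =
      (associator (comp A B) C D).hom ≫ (associator A B (comp C D)).hom := by
  have hθ := (assocMap_isRefinement A B C)
  let P := compPb (comp (comp A B) C) D
  let P' := compPb (comp A (comp B C)) D
  have hw : (P.fst ≫ assocMap A B C) ≫ (comp A (comp B C)).functor.obj = P.snd ≫ D.p := by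
    rw [Category.assoc, hθ.obj, P.w]
  let θ : P.pt ⟶ P'.pt := P'.lift (P.fst ≫ assocMap A B C) P.snd hw
  have hθ₁ : θ ≫ P'.fst = P.fst ≫ assocMap A B C := P'.lift_fst _ _ _
  have hθ₂ : θ ≫ P'.snd = P.snd := P'.lift_snd _ _ _
  have hp : θ ≫ P'.fst ≫ (comp A (comp B C)).p = P.fst ≫ (comp (comp A B) C).p := by
    rw [reassoc_of% hθ₁, hθ.p]
  apply ext_injective
  intro T u a v hs ht
  refine (ext_map_comp (whiskerRight (associator A B C).hom D) θ hp ?_ _ _ _ _ _ _).trans ?_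
  · intro T u a v hs ht
    refine (ext_whiskerRight _ _ _ _ _ _ _).trans (Eq.trans ?_ (comp_app_eq _ _ _ _ _ _ _).symm)
    refine app_congr _ _ _ _ _ _ ?_ ((isoOfMap_hom_ext _ hθ _ _ _ _ _).trans ?_) rfl
    rotate_left
    · refine app_congr _ _ _ _ _ _ ?_ rfl rfl
      simp only [Category.assoc]
      exact congrArg (u ≫ ·) hθ₁.symm
    · simp only [Category.assoc]
      exact congrArg (u ≫ ·) hθ₂.symm
  refine (isoOfMap_hom_comp _ (assocMap_isRefinement A (comp B C) D) _ _ _ _ _ _).trans ?_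
  refine Eq.trans ?_ (isoOfMap_hom_comp _ (assocMap_isRefinement (comp A B) C D) _ _ _ _ _ _).symm
  refine Eq.trans ?_ (isoOfMap_hom_ext _ (assocMap_isRefinement A B (comp C D)) _ _ _ _ _).symm
  refine (ext_whiskerLeft _ _ _ _ _ _ _).trans (Eq.trans ?_ (comp_app_eq _ _ _ _ _ _ _).symm)
  refine (isoOfMap_hom_ext _ (assocMap_isRefinement B C D) _ _ _ _ _).trans ?_
  have e₁ : θ ≫ assocMap A (comp B C) D ≫ (compPb A (comp (comp B C) D)).fst =
      assocMap (comp A B) C D ≫ assocMap A B (comp C D) ≫ (compPb A (comp B (comp C D))).fst := by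
    rw [assocMap_fst, assocMap_fst]
    have := assocMap_fst (comp A B) C D
    rw [reassoc_of% this, reassoc_of% hθ₁, assocMap_fst]
  have e₂ : θ ≫ assocMap A (comp B C) D ≫ (compPb A (comp (comp B C) D)).snd ≫ assocMap B C D =
      assocMap (comp A B) C D ≫ assocMap A B (comp C D) ≫ (compPb A (comp B (comp C D))).snd := by
    have f₁ := assocMap_snd_fst A (comp B C) D
    have f₂ := assocMap_snd_snd A (comp B C) D
    have f₃ := assocMap_snd_fst A B (comp C D)
    have f₄ := assocMap_snd_snd A B (comp C D)
    have f₅ := assocMap_fst (comp A B) C D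
    have f₆ := assocMap_snd_fst A B C
    have f₇ := assocMap_snd_snd A B C
    apply SpecifiedPullback.hom_ext
    · simp only [Category.assoc]
      rw [f₃, assocMap_fst, reassoc_of% f₅, reassoc_of% f₁, reassoc_of% hθ₁, f₆]
    · simp only [Category.assoc]
      rw [f₄]
      apply SpecifiedPullback.hom_ext
      · simp only [Category.assoc]
        rw [assocMap_snd_fst, assocMap_snd_fst, reassoc_of% f₁, reassoc_of% hθ₁, f₇]
      · simp only [Category.assoc]
        have f₈ := assocMap_snd_snd (comp A B) C D
        rw [assocMap_snd_snd, f₂, f₈]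
        exact hθ₂
  refine app_congr _ _ _ _ _ _ ?_ (app_congr _ _ _ _ _ _ ?_ rfl rfl) rfl
  · simp only [Category.assoc]
    exact congrArg (u ≫ ·) e₂
  · simp only [Category.assoc]
    exact congrArg (u ≫ ·) e₁

theorem triangle (A : Anafunctor J X Y) (B : Anafunctor J Y Z) :
    (associator A (id J Y) B).hom ≫ whiskerLeft A (leftUnitor B).hom =
      whiskerRight (rightUnitor A).hom B := by
  apply ext_injective
  intro T u a v hs ht
  refine (isoOfMap_hom_comp _ (assocMap_isRefinement A (id J Y) B) _ _ _ _ _ _).trans ?_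
  refine (ext_whiskerLeft _ _ _ _ _ _ _).trans (Eq.trans ?_ (ext_whiskerRight _ _ _ _ _ _ _).symm)
  refine (isoOfMap_hom_ext _ (snd_isRefinement B) _ _ _ _ _).trans ?_
  refine app_congr _ _ _ _ _ _ ?_ (Eq.trans ?_
    (isoOfMap_hom_ext _ (fst_isRefinement A) _ _ _ _ _).symm) rfl
  rotate_left
  refine app_congr _ _ _ _ _ _ ?_ rfl rfl
  all_goals simp only [Category.assoc, assocMap_fst, assocMap_snd_snd]

end Axioms

end Anafunctor


/-! ### The bicategory of internal categories and anafunctors -/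

/-- The objects of `Cat_ana(S, J)`: a type synonym for the internal categories in `S`. -/
def CatAna (_J : UnarySite S) : Type (max u v) := InternalCat S

/-- The bicategory `Cat_ana(S, J)` of internal categories, anafunctors and transformations. -/
noncomputable instance (J : UnarySite S) [J.IsSubcanonical] : Bicategory (CatAna J) where
  Hom X Y := Anafunctor J X Y
  id X := Anafunctor.id J X
  comp A B := Anafunctor.comp A B
  homCategory X Y := Anafunctor.category (J := J) (X := X) (Y := Y)
  whiskerLeft A _ _ β := Anafunctor.whiskerLeft A β
  whiskerRight α B := Anafunctor.whiskerRight α B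
  associator A B C := Anafunctor.associator A B C
  leftUnitor A := Anafunctor.leftUnitor A
  rightUnitor A := Anafunctor.rightUnitor A
  whiskerLeft_id A B := Anafunctor.whiskerLeft_id A B
  whiskerLeft_comp A _ _ _ β γ := Anafunctor.whiskerLeft_comp A β γ
  id_whiskerLeft η := Anafunctor.id_whiskerLeft η
  comp_whiskerLeft A B _ _ η := Anafunctor.comp_whiskerLeft A B η
  id_whiskerRight A B := Anafunctor.id_whiskerRight A B
  comp_whiskerRight α β B := Anafunctor.comp_whiskerRight α β B
  whiskerRight_id η := Anafunctor.whiskerRight_id η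
  whiskerRight_comp η B C := Anafunctor.whiskerRight_comp η B C
  whisker_assoc A _ _ η C := Anafunctor.whisker_assoc A η C
  whisker_exchange α β := Anafunctor.whisker_exchange α β
  pentagon A B C D := Anafunctor.pentagon A B C D
  triangle A B := Anafunctor.triangle A B

theorem InternalTrans.eqToHom_app {X Y : InternalCat S} {f g : InternalFunctor X Y} (h : f = g) :
    InternalTrans.app (eqToHom h) = f.obj ≫ Y.e := by
  subst h; rfl

/-- The 2-category `Cat(S)` is strict. -/
instance : Bicategory.Strict (InternalCat S) where
  id_comp _ := InternalFunctor.ext (Category.id_comp _) (Category.id_comp _)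
  comp_id _ := InternalFunctor.ext (Category.comp_id _) (Category.comp_id _)
  assoc _ _ _ := InternalFunctor.ext (Category.assoc _ _ _) (Category.assoc _ _ _)
  leftUnitor_eqToIso _ := Iso.ext (InternalTrans.ext (InternalTrans.eqToHom_app
    (InternalFunctor.ext (Category.id_comp _) (Category.id_comp _))).symm)
  rightUnitor_eqToIso _ := Iso.ext (InternalTrans.ext (InternalTrans.eqToHom_app
    (InternalFunctor.ext (Category.comp_id _) (Category.comp_id _))).symm)
  associator_eqToIso _ _ _ := Iso.ext (InternalTrans.ext (InternalTrans.eqToHom_app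
    (InternalFunctor.ext (Category.assoc _ _ _) (Category.assoc _ _ _))).symm)

/-! ### `J`-equivalences -/

namespace InternalFunctor

variable {X Y : InternalCat S}

/-- A functor `f` is fully faithful if `X₁`, with `(s, t)` and `f₁`, is the pullback of
`(s, t) : Y₁ ⟶ Y₀ × Y₀` along `f₀ × f₀ : X₀ × X₀ ⟶ Y₀ × Y₀`.  The universal property is spelled out,
as `S` need not have products. -/
def FullyFaithful (f : InternalFunctor X Y) : Prop :=
  ∀ {T : S} (x x' : T ⟶ X.obj) (b : T ⟶ Y.arr), b ≫ Y.s = x ≫ f.obj → b ≫ Y.t = x' ≫ f.obj →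
    ∃! a : T ⟶ X.arr, a ≫ X.s = x ∧ a ≫ X.t = x' ∧ a ≫ f.arr = b

/-- A `J`-local splitting of `f : X ⟶ Y`: a cover `p : U ⟶ Y₀`, a functor `Y[U] ⟶ X`, and a natural
isomorphism between `Y[U] ⟶ X ⟶ Y` and the canonical functor `Y[U] ⟶ Y`. -/
structure LocalSplitting (J : UnarySite S) (f : InternalFunctor X Y) where
  /-- the total object of the cover -/
  U : S
  /-- the cover -/
  p : U ⟶ Y.obj
  cover : J.IsCover p
  /-- the functor `Y[U] ⟶ X` -/
  lift : InternalFunctor (J.base Y p cover) X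
  /-- the natural isomorphism -/
  iso : lift.comp f ≅ J.baseProj Y p cover

/-- The anafunctor from `Y` to `X` given by a `J`-local splitting of `f : X ⟶ Y`. -/
def LocalSplitting.toAnafunctor {J : UnarySite S} {f : InternalFunctor X Y}
    (σ : f.LocalSplitting J) : Anafunctor J Y X := ⟨σ.U, σ.p, σ.cover, σ.lift⟩

/-- A `J`-equivalence: a fully faithful and `J`-locally split functor. -/
def IsJEquivalence (J : UnarySite S) (f : InternalFunctor X Y) : Prop :=
  f.FullyFaithful ∧ Nonempty (f.LocalSplitting J)

end InternalFunctor

/-! ### Functors as anafunctors -/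

/-- The anafunctor `(X₀, f)` given by a functor `f`; note that `X[X₀] = X`. -/
@[reducible] noncomputable def Anafunctor.ofFunctor (J : UnarySite S) {X Y : InternalCat S}
    (f : InternalFunctor X Y) : Anafunctor J X Y where
  U := X.obj
  p := 𝟙 X.obj
  cover := UnarySite.cover_id X.obj
  functor := (J.baseProj X (𝟙 X.obj) (UnarySite.cover_id X.obj)).comp f

theorem Anafunctor.ofFunctor_app (J : UnarySite S) {X Y : InternalCat S}
    (f : InternalFunctor X Y) {T : S} (u : T ⟶ (ofFunctor J f).U) (a : T ⟶ X.arr)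
    (v : T ⟶ (ofFunctor J f).U) (hs : a ≫ X.s = u ≫ (ofFunctor J f).p)
    (ht : a ≫ X.t = v ≫ (ofFunctor J f).p) : (ofFunctor J f).app u a v hs ht = a ≫ f.arr := by
  refine (Category.assoc _ _ _).symm.trans (congrArg (· ≫ f.arr) ?_)
  exact J.el_A _ _ _ _ _ _

/-- The transformation `(X₀, f) ⇒ (X₀, g)` given by a natural transformation `a : f ⇒ g`; its
component is `X₀ ×_{X₀} X₀ = X₀ ⟶ Y₁`. -/
noncomputable def Anafunctor.ofTrans (J : UnarySite S) {X Y : InternalCat S}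
    {f g : InternalFunctor X Y} (a : InternalTrans f g) :
    Anafunctor.Trans (Anafunctor.ofFunctor J f) (Anafunctor.ofFunctor J g) where
  app := (Anafunctor.prod (Anafunctor.ofFunctor J f) (Anafunctor.ofFunctor J g)).fst ≫ a.app
  app_s := by
    rw [Category.assoc, a.app_s]
    change _ = (_ ≫ 𝟙 _ ≫ f.obj)
    rw [Category.id_comp]
  app_t := by
    have h := (Anafunctor.prod (ofFunctor J f) (ofFunctor J g)).w
    rw [Category.comp_id, Category.comp_id] at h
    rw [Category.assoc, a.app_t]
    change _ = (_ ≫ 𝟙 _ ≫ g.obj)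
    rw [Category.id_comp]
    exact congrArg (· ≫ g.obj) h
  naturality := by
    let A := ofFunctor J f
    let B := ofFunctor J g
    have h := (prod A B).w
    rw [Category.comp_id, Category.comp_id] at h
    have hA := A.map_el (prod_cover A B) (prod A B).fst rfl (J.bcS (prod_cover A B))
      (J.bcA (prod_cover A B)) (J.bcT (prod_cover A B)) (J.bcA_s _) (J.bcA_t _)
    have hB := B.map_el (prod_cover A B) (prod A B).snd (prod A B).w.symm (J.bcS (prod_cover A B))
      (J.bcA (prod_cover A B)) (J.bcT (prod_cover A B)) (J.bcA_s _) (J.bcA_t _)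
    have h1 : J.el (prod_cover A B) (J.bcS (prod_cover A B)) (J.bcA (prod_cover A B))
        (J.bcT (prod_cover A B)) (J.bcA_s _) (J.bcA_t _) = 𝟙 _ := by
      apply UnarySite.bc_hom_ext <;> simp
    rw [h1, Category.id_comp, ofFunctor_app] at hA hB
    have e₁ : J.bcA (prod_cover A B) ≫ X.s = J.bcS (prod_cover A B) ≫ (prod A B).fst := by
      exact (J.bcA_s (prod_cover A B)).trans (congrArg (_ ≫ ·) (Category.comp_id _))
    have e₂ : J.bcA (prod_cover A B) ≫ X.t = J.bcT (prod_cover A B) ≫ (prod A B).fst := by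
      exact (J.bcA_t (prod_cover A B)).trans (congrArg (_ ≫ ·) (Category.comp_id _))
    refine Eq.trans (Y.comp_congr hA ?_ _)
      ((a.nat (J.bcA (prod_cover A B))).trans (Y.comp_congr ?_ hB.symm _))
    · rw [e₂, Category.assoc]
    · rw [e₁, Category.assoc]

/-! ### Sub-2-categories -/

/-- The full sub-2-category of `Cat(S)` on the internal categories satisfying `P`. -/
abbrev FullCat (P : InternalCat S → Prop) : Type (max u v) :=
  Bicategory.InducedBicategory (InternalCat S) (fun X : {X : InternalCat S // P X} => X.1)

/-- The inclusion of the internal categories satisfying `P` into the objects of `Cat_ana(S, J)`. -/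
def CatAna.incl (J : UnarySite S) (P : InternalCat S → Prop) :
    {X : InternalCat S // P X} → CatAna J := fun X => X.1

/-- The full sub-bicategory of `Cat_ana(S, J)` on the internal categories satisfying `P`. -/
abbrev FullAna (J : UnarySite S) [J.IsSubcanonical] (P : InternalCat S → Prop) : Type (max u v) :=
  Bicategory.InducedBicategory (CatAna J) (CatAna.incl J P)

/-- The inclusion `C ⟶ Cat(S)`. -/
noncomputable abbrev FullCat.inclusion (P : InternalCat S → Prop) :
    StrictPseudofunctor (FullCat P) (InternalCat S) :=
  Bicategory.InducedBicategory.forget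

/-- The inclusion `C_ana(J) ⟶ Cat_ana(S, J)`. -/
noncomputable abbrev FullAna.inclusion (J : UnarySite S) [J.IsSubcanonical] (P : InternalCat S → Prop) :
    StrictPseudofunctor (FullAna J P) (CatAna J) :=
  Bicategory.InducedBicategory.forget

/-- An anafunctor as a 1-arrow of `C_ana(J)`. -/
noncomputable abbrev FullAna.ofAnafunctor {J : UnarySite S} [J.IsSubcanonical] {P : InternalCat S → Prop}
    {X Y : FullAna J P} (A : Anafunctor J X.1 Y.1) : X ⟶ Y :=
  Bicategory.InducedBicategory.mkHom (C := CatAna J) (F := CatAna.incl J P) A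

/-- The full sub-2-category given by `P` admits base change along covers: for every `X` in it and
every cover `p : U ⟶ X₀` it contains a base change of `X` along `p`, i.e. a category `X'` with object
of objects `U` and with object of arrows `U² ×_{X₀²} X₁`. -/
def AdmitsBaseChange (J : UnarySite S) (P : InternalCat S → Prop) : Prop :=
  ∀ X : InternalCat S, P X → ∀ {U : S} (p : U ⟶ X.obj), J.IsCover p →
    ∃ X' : InternalCat S, P X' ∧ ∃ (h : X'.obj = U) (F : InternalFunctor X' X),
      F.obj = eqToHom h ≫ p ∧ F.FullyFaithful

/-- The data of the 2-functor `Cat(S) ⟶ Cat_ana(S, J)`: it is the identity on objects and is given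
by `f ↦ (X₀, f)` and `a ↦ a` on 1-arrows and 2-arrows. -/
noncomputable def alphaCat (J : UnarySite S) [J.IsSubcanonical] :
    PrelaxFunctorStruct (InternalCat S) (CatAna J) where
  obj X := X
  map f := Anafunctor.ofFunctor J f
  map₂ a := Anafunctor.ofTrans J a

/-- The data of `α_J : C ⟶ C_ana(J)`, for the full sub-2-category `C` given by `P`. -/
noncomputable def alpha (J : UnarySite S) [J.IsSubcanonical] (P : InternalCat S → Prop) :
    PrelaxFunctorStruct (FullCat P) (FullAna J P) where
  obj X := X
  map f := Bicategory.InducedBicategory.mkHom (C := CatAna J) (F := CatAna.incl J P)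
    ((alphaCat J).map f.hom)
  map₂ a := Bicategory.InducedBicategory.mkHom₂ (C := CatAna J) (F := CatAna.incl J P)
    ((alphaCat J).map₂ a.hom)

end Anafunctors

open Anafunctors

namespace Anafunctors

variable {S : Type u} [Category.{v} S]

/-! ### Strict equality of anafunctors -/

namespace Anafunctor

open UnarySite

variable {J : UnarySite S} {X Y Z W : InternalCat S}

/-! Everything is computed with generalised elements. An anafunctor `(U, f)` has values `f(u, a, v)`
(`app`) at an arrow `a` of `X` with lifts `u`, `v` of its ends, and a transformation `α : (U, f) ⇒
(V, g)` has values `α(u, a, v) : f(u) ⟶ g(v)` (`ext`). These values determine `α` (`ext_injective`),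
and a vertical composite takes the value `α(u, b, v) ; β(v, c, w)` at `b ; c` (`ext_comp`). The
construction of `ext` has already absorbed most of the descent along covers, so what remains is
largely ordinary category theory inside `X` and `Y`.

Strictness on 1-arrows. The cover of `(Y₀, g)` is an identity, and the convention `B ×_A A = B`
makes the specified pullback used in `(U, f) ; (Y₀, g)` equal to `U` itself. Hence this composite is
equal, not just isomorphic, to `(U, f ; g)` (`comp_ofFunctor`); taking `(U, f)` to be a functor
gives `ofFunctor_comp`. As the equality of covers is only propositional, equality of anafunctors is
tested by a refinement whose map of covers is an `eqToHom` (`eq_of_isRefinement`).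

Strictness on 2-arrows. The value of `ofTrans α` at `(u, a, v)` is `α(s a) ; g(a)`, in which `u` and
`v` do not occur (`ext_ofTrans`). An `eqToHom` between anafunctors merely transports `u` and `v`
(`eqToHom_conj`), so it disappears from every equation between such values. Compatibility with
vertical composition and with whiskering then reduces to associativity and unit laws in the target
and to functoriality of the functors. For the unitors and the associator, the value on either side
is the target functor applied to `a`. The same formulas restrict to `C`, and commutation with the
inclusions holds by definition on the data; the structure isomorphisms of a strict pseudofunctor are
determined by that data (`strictPseudofunctor_ext`).

Equivalences. Let `f` be fully faithful with a local splitting `(U, f̄, τ)`. The composite `(U, f̄)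
; (X₀, f)` equals `(U, f̄ ; f)`, and `τ` identifies `f̄ ; f` with the canonical functor `Y[U] ⟶ Y`.
The families `τ(u) ; a` and `a ; τ⁻¹(v)` are then inverse transformations between `(U, f̄ ; f)` and
the identity anafunctor (`isoId`), which gives the counit. For the unit, whiskering the inverse
counit with `(X₀, f)` gives an isomorphism between `1 ; f` and `(f ; f̄) ; f`. Since `f` is fully
faithful, each value of a transformation between anafunctors followed by `f` lifts uniquely to an
arrow of `X`, and uniqueness makes the lifts natural and mutually inverse (`liftFam`, `liftIso`). So
the isomorphism comes from one between `1` and `f ; f̄`. Correcting the counit yields an adjoint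
equivalence with the prescribed 1-arrows (`alphaEquivalence`). -/

/-- The universal arrow of `X[U]` is the generalised element made of its own source lift, underlying
arrow and target lift. A functor on `X[U]` can thus be recovered from its values. -/
theorem functor_arr_eq_app (A : Anafunctor J X Y) :
    A.functor.arr = A.app (J.bcS A.cover) (J.bcA A.cover) (J.bcT A.cover) (J.bcA_s _)
      (J.bcA_t _) := by
  have h : J.el A.cover (J.bcS A.cover) (J.bcA A.cover) (J.bcT A.cover) (J.bcA_s _) (J.bcA_t _) =
      𝟙 _ := by
    apply UnarySite.bc_hom_ext <;> simp
  rw [app, h, Category.id_comp]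

/-- Two anafunctors are equal if a refinement between them is an identity of objects of `S`. -/
theorem eq_of_isRefinement {A B : Anafunctor J X Y} (h : A.U = B.U)
    (hθ : IsRefinement A B (eqToHom h)) : A = B := by
  obtain ⟨U, p, hp, F⟩ := A
  obtain ⟨V, q, hq, G⟩ := B
  change U = V at h
  subst h
  obtain rfl : q = p := by simpa using hθ.p
  have hF : F = G := by
    refine InternalFunctor.ext ?_ ?_
    · simpa using hθ.obj.symm
    -- Both arrow maps are values at the universal arrow, and the refinement condition compares
    -- these values.
    · refine (functor_arr_eq_app ⟨U, q, hp, F⟩).trans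
        (Eq.trans ?_ (functor_arr_eq_app ⟨U, q, hq, G⟩).symm)
      refine (hθ.app _ _ _ _ _).trans ?_
      exact app_congr _ _ _ _ _ _ (by simp) rfl (by simp)
  rw [hF]

/-! ### The 2-functor from functors to anafunctors -/

theorem ofFunctor_id (J : UnarySite S) (X : InternalCat S) :
    ofFunctor J (InternalFunctor.id X) = id J X := by
  refine eq_of_isRefinement rfl ⟨?_, ?_, ?_⟩
  · simp
  · simp
  · intro T u a v hs ht
    rw [ofFunctor_app, id_app]
    exact Category.comp_id _

/-- The convention `B ×_A A = B` enters here, because the cover of `(Y₀, g)` is an identity. It is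
the source of strict, rather than pseudo, functoriality. -/
theorem compPb_ofFunctor (A : Anafunctor J X Y) (g : InternalFunctor Y Z) :
    compPb A (ofFunctor J g) =
      ⟨A.U, 𝟙 A.U, A.functor.obj, IsPullback.of_horiz_isIso ⟨by simp⟩⟩ :=
  J.pb_of_id _ _

theorem comp_ofFunctor_U (A : Anafunctor J X Y) (g : InternalFunctor Y Z) :
    (comp A (ofFunctor J g)).U = A.U := by
  change (compPb A (ofFunctor J g)).pt = _
  rw [compPb_ofFunctor]

theorem compPb_ofFunctor_fst (A : Anafunctor J X Y) (g : InternalFunctor Y Z) :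
    (compPb A (ofFunctor J g)).fst = eqToHom (comp_ofFunctor_U A g) := by
  -- The equality `compPb_ofFunctor` relates two fixed terms and cannot be substituted. With
  -- arbitrary `P = Q` it can, and the proof `h'` of equality of the vertices is left free so that
  -- any such proof will do.
  have key : ∀ (P Q : SpecifiedPullback A.functor.obj (ofFunctor J g).p) (e : P = Q)
      (h : Q.pt = A.U), Q.fst = eqToHom h → ∀ h' : P.pt = A.U, P.fst = eqToHom h' := by
    rintro P Q rfl h hQ _
    exact hQ
  exact key _ _ (compPb_ofFunctor A g) rfl rfl _

/-- The anafunctor of `g` ignores the lifts, so the second projections drop out of the value of the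
composite. -/
theorem comp_ofFunctor_app (A : Anafunctor J X Y) (g : InternalFunctor Y Z) {T : S}
    (u : T ⟶ (comp A (ofFunctor J g)).U) (a : T ⟶ X.arr) (v : T ⟶ (comp A (ofFunctor J g)).U)
    (hs : a ≫ X.s = u ≫ (comp A (ofFunctor J g)).p)
    (ht : a ≫ X.t = v ≫ (comp A (ofFunctor J g)).p) :
    (comp A (ofFunctor J g)).app u a v hs ht =
      A.app (u ≫ (compPb A (ofFunctor J g)).fst) a (v ≫ (compPb A (ofFunctor J g)).fst)
        (by simpa using hs) (by simpa using ht) ≫ g.arr := by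
  rw [comp_app_eq, ofFunctor_app]

/-- The anafunctor `(U, f ≫ g)`, for an anafunctor `(U, f)` and a functor `g`. -/
@[reducible] noncomputable def postcomp (A : Anafunctor J X Y) (g : InternalFunctor Y Z) :
    Anafunctor J X Z :=
  ⟨A.U, A.p, A.cover, A.functor.comp g⟩

theorem postcomp_app (A : Anafunctor J X Y) (g : InternalFunctor Y Z) {T : S} (u : T ⟶ A.U)
    (a : T ⟶ X.arr) (v : T ⟶ A.U) (hs : a ≫ X.s = u ≫ A.p) (ht : a ≫ X.t = v ≫ A.p) :
    (A.postcomp g).app u a v hs ht = A.app u a v hs ht ≫ g.arr :=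
  (Category.assoc _ _ _).symm

/-- The first projection of the specified pullback is an identity up to `eqToHom` and is compatible
with the functors. The result gives strict functoriality of `ofFunctor`; it is also what lets a
composite with `(X₀, f)` be replaced by plain postcomposition with `f` in the counit and the unit.
-/
theorem comp_ofFunctor (A : Anafunctor J X Y) (g : InternalFunctor Y Z) :
    comp A (ofFunctor J g) = A.postcomp g := by
  refine eq_of_isRefinement (comp_ofFunctor_U _ _) ?_
  -- The `eqToHom` is traded for the projection, whose compatibilities come from the pullback
  -- square.
  rw [← compPb_ofFunctor_fst]
  refine ⟨rfl, ?_, ?_⟩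
  · have := (compPb A (ofFunctor J g)).w
    simp only [Category.id_comp, Category.comp_id] at this ⊢
    rw [reassoc_of% this]
  · intro T u a v hs ht
    rw [comp_ofFunctor_app, postcomp_app]

theorem ofFunctor_comp (f : InternalFunctor X Y) (g : InternalFunctor Y Z) :
    ofFunctor J (f.comp g) = comp (ofFunctor J f) (ofFunctor J g) := by
  rw [comp_ofFunctor]
  refine congrArg (Anafunctor.mk X.obj (𝟙 X.obj) (cover_id X.obj)) ?_
  exact InternalFunctor.ext (Category.assoc _ _ _).symm (Category.assoc _ _ _).symm

/-! ### Natural transformations as transformations of anafunctors -/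

variable [J.IsSubcanonical]

/-- Conjugation with two equalities of anafunctors. -/
theorem eqToHom_conj {A B A' B' : Anafunctor J X Y} (e : A = B) (e' : B' = A') (η : B ⟶ B')
    {T : S} (u : T ⟶ A.U) (a : T ⟶ X.arr) (v : T ⟶ A'.U) (hs : a ≫ X.s = u ≫ A.p)
    (ht : a ≫ X.t = v ≫ A'.p) :
    ext (eqToHom e ≫ η ≫ eqToHom e') u a v hs ht =
      ext η (u ≫ eqToHom (congrArg Anafunctor.U e)) a
        (v ≫ eqToHom (congrArg Anafunctor.U e'.symm))
        (by subst e; simpa using hs) (by subst e'; simpa using ht) := by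
  subst e e'
  simp only [eqToHom_refl, Category.id_comp, Category.comp_id]

/-- The one-sided form of `eqToHom_conj`, as needed for the unitors, where no equality occurs at the
target. -/
theorem eqToHom_comp_ext {A B D : Anafunctor J X Y} (e : A = B) (η : B ⟶ D)
    {T : S} (u : T ⟶ A.U) (a : T ⟶ X.arr) (v : T ⟶ D.U) (hs : a ≫ X.s = u ≫ A.p)
    (ht : a ≫ X.t = v ≫ D.p) :
    ext (eqToHom e ≫ η) u a v hs ht =
      ext η (u ≫ eqToHom (congrArg Anafunctor.U e)) a v (by subst e; simpa using hs) ht := by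
  subst e
  simp only [eqToHom_refl, Category.id_comp, Category.comp_id]

/-- Both covers are identities, so `u` is itself a lift of the source of `a` to the second cover and
the descent defining `ext` is trivial. The lifts `u` and `v` are absent from the right-hand side,
which is why transporting them along equalities of covers does no harm below. -/
theorem ext_ofTrans {f g : InternalFunctor X Y} (α : InternalTrans f g) {T : S}
    (u : T ⟶ (ofFunctor J f).U) (a : T ⟶ X.arr) (v : T ⟶ (ofFunctor J g).U)
    (hs : a ≫ X.s = u ≫ (ofFunctor J f).p) (ht : a ≫ X.t = v ≫ (ofFunctor J g).p) :
    ext (ofTrans J α : ofFunctor J f ⟶ ofFunctor J g) u a v hs ht =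
      Y.comp ((a ≫ X.s) ≫ α.app) (a ≫ g.arr)
        (by rw [Category.assoc, Category.assoc, Category.assoc, α.app_t, g.arr_s]) := by
  refine (Trans.ext_eq (ofTrans J α) u a v hs ht u rfl).trans (Y.comp_congr ?_ ?_ _)
  · refine (SpecifiedPullback.lift_fst_assoc _ _ _ _ _).trans ?_
    rw [hs, Category.comp_id]
  · exact ofFunctor_app _ _ _ _ _ _ _

theorem ofTrans_id (f : InternalFunctor X Y) :
    (ofTrans J (InternalTrans.id f) : ofFunctor J f ⟶ ofFunctor J f) = 𝟙 (ofFunctor J f) := by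
  apply ext_injective
  intro T u a v hs ht
  rw [ext_ofTrans, ext_id, ofFunctor_app]
  exact Y.id_comp' ((a ≫ X.s) ≫ f.obj) _ (Category.assoc _ _ _).symm

/-- The composite of anafunctor transformations is evaluated at the middle lift `u`, which is
available globally because all three covers are the identity of `X₀`. -/
theorem ofTrans_vcomp {f g h : InternalFunctor X Y} (α : InternalTrans f g)
    (β : InternalTrans g h) :
    ofTrans J (α.vcomp β) = ((ofTrans J α : ofFunctor J f ⟶ ofFunctor J g) ≫
      (ofTrans J β : ofFunctor J g ⟶ ofFunctor J h) : ofFunctor J f ⟶ ofFunctor J h) := by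
  apply ext_injective
  intro T u a v hs ht
  refine (ext_ofTrans _ _ _ _ _ _).trans (Eq.trans ?_ (ext_comp_src (A := ofFunctor J f)
    (B := ofFunctor J g) (D := ofFunctor J h) (ofTrans J α) (ofTrans J β) u a u v hs ht rfl).symm)
  refine Eq.trans ?_ (Y.comp_congr (ext_ofTrans α _ _ _ _ _) (ext_ofTrans β _ _ _ _ _) _).symm
  -- The first factor is the value of `α` at an identity arrow, namely `α ; g(id)`. The factor
  -- `g(id)` is an identity and has to be removed before associativity applies.
  have hu : ((u ≫ 𝟙 X.obj) ≫ X.e) ≫ g.arr = (u ≫ g.obj) ≫ Y.e := by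
    rw [Category.comp_id, Category.assoc, g.map_e, Category.assoc]
  have hu' : (((u ≫ 𝟙 X.obj) ≫ X.e) ≫ X.s) ≫ α.app = (a ≫ X.s) ≫ α.app := by
    rw [hs, Category.assoc _ X.e, X.e_s, Category.comp_id]
  refine Eq.trans ?_ (Y.comp_congr ((Y.comp_id' _ _ hu).trans hu').symm rfl
    (by rw [Y.comp_s]; simp only [Category.assoc]; rw [α.app_t, β.app_s]))
  refine (Y.comp_congr (Y.precomp _ _ _ _) rfl _).trans ?_
  exact Y.comp_assoc _ _ _ _ _

/-- Both sides have the value `β(f(s a)) ; h(f(a))` at `a`: on the right `β` is evaluated at the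
arrow `f(a)`, whose source is `f(s a)`. -/
theorem ofTrans_whiskerLeft (f : InternalFunctor X Y) {g h : InternalFunctor Y Z}
    (β : InternalTrans g h) :
    (ofTrans J (InternalTrans.whiskerLeft f β) :
        ofFunctor J (f.comp g) ⟶ ofFunctor J (f.comp h)) =
      eqToHom (ofFunctor_comp f g) ≫
        whiskerLeft (ofFunctor J f) (ofTrans J β : ofFunctor J g ⟶ ofFunctor J h) ≫
          eqToHom (ofFunctor_comp f h).symm := by
  apply ext_injective
  intro T u a v hs ht
  refine Eq.trans ?_ (eqToHom_conj _ _ _ _ _ _ _ _).symm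
  refine Eq.trans ?_ (ext_whiskerLeft _ _ _ _ _ _ _).symm
  refine (ext_ofTrans _ _ _ _ _ _).trans (Eq.trans ?_ (ext_ofTrans _ _ _ _ _ _).symm)
  refine Z.comp_congr ?_ ?_ _
  · rw [ofFunctor_app]
    refine (Category.assoc _ _ _).symm.trans (congrArg (· ≫ β.app) ?_)
    rw [Category.assoc, Category.assoc, f.arr_s]
  · rw [ofFunctor_app, Category.assoc]

/-- On the right the value is `h` applied to `α(s a) ; g(a)`, so the equation is the functoriality
of `h`. -/
theorem ofTrans_whiskerRight {f g : InternalFunctor X Y} (α : InternalTrans f g)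
    (h : InternalFunctor Y Z) :
    (ofTrans J (InternalTrans.whiskerRight α h) :
        ofFunctor J (f.comp h) ⟶ ofFunctor J (g.comp h)) =
      eqToHom (ofFunctor_comp f h) ≫
        whiskerRight (ofTrans J α : ofFunctor J f ⟶ ofFunctor J g) (ofFunctor J h) ≫
          eqToHom (ofFunctor_comp g h).symm := by
  apply ext_injective
  intro T u a v hs ht
  refine Eq.trans ?_ (eqToHom_conj _ _ _ _ _ _ _ _).symm
  refine Eq.trans ?_ (ext_whiskerRight _ _ _ _ _ _ _).symm
  refine (ext_ofTrans _ _ _ _ _ _).trans (Eq.trans ?_ (ofFunctor_app _ _ _ _ _ _ _).symm)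
  refine Eq.trans ?_ (congrArg (· ≫ h.arr) (ext_ofTrans _ _ _ _ _ _).symm)
  refine Eq.trans ?_ (h.map_comp _ _ _).symm
  exact Z.comp_congr (Category.assoc _ _ _).symm (Category.assoc _ _ _).symm _

/-- The coherence isomorphisms of `Cat(S)` are all of the form `isoOfEq`, with identity components.
Their values therefore reduce to those of the target functor, which is also what refinement
isomorphisms have as values. -/
theorem ext_ofTrans_isoOfEq {f g : InternalFunctor X Y} (e : f = g) {T : S}
    (u : T ⟶ (ofFunctor J f).U) (a : T ⟶ X.arr) (v : T ⟶ (ofFunctor J g).U)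
    (hs : a ≫ X.s = u ≫ (ofFunctor J f).p) (ht : a ≫ X.t = v ≫ (ofFunctor J g).p) :
    ext (ofTrans J (InternalFunctor.isoOfEq f g e).hom : ofFunctor J f ⟶ ofFunctor J g)
      u a v hs ht = a ≫ g.arr := by
  subst e
  refine (ext_ofTrans _ _ _ _ _ _).trans ?_
  exact Y.id_comp' ((a ≫ X.s) ≫ f.obj) _ (Category.assoc _ _ _).symm

/-- Here and in the next two lemmas both sides have the same value at `a`, the target functor
applied to `a`: on the left by `ext_ofTrans_isoOfEq`, on the right because the coherence
isomorphisms of anafunctors come from refinements. The equalities of anafunctors are arguments, so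
that any proofs of them may be supplied later. -/
theorem ofTrans_leftUnitor (f : InternalFunctor X Y)
    (e : ofFunctor J ((InternalFunctor.id X).comp f) = comp (id J X) (ofFunctor J f)) :
    (ofTrans J (InternalFunctor.isoOfEq ((InternalFunctor.id X).comp f) f
        (InternalFunctor.ext (Category.id_comp _) (Category.id_comp _))).hom :
        ofFunctor J ((InternalFunctor.id X).comp f) ⟶ ofFunctor J f) =
      eqToHom e ≫ (leftUnitor (ofFunctor J f)).hom := by
  apply ext_injective
  intro T u a v hs ht
  refine (ext_ofTrans_isoOfEq _ _ _ _ _ _).trans (Eq.trans ?_ (eqToHom_comp_ext _ _ _ _ _ _ _).symm)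
  refine Eq.trans ?_ (isoOfMap_hom_ext _ (snd_isRefinement _) _ _ _ _ _).symm
  rw [ofFunctor_app]

theorem ofTrans_rightUnitor (f : InternalFunctor X Y)
    (e : ofFunctor J (f.comp (InternalFunctor.id Y)) = comp (ofFunctor J f) (id J Y)) :
    (ofTrans J (InternalFunctor.isoOfEq (f.comp (InternalFunctor.id Y)) f
        (InternalFunctor.ext (Category.comp_id _) (Category.comp_id _))).hom :
        ofFunctor J (f.comp (InternalFunctor.id Y)) ⟶ ofFunctor J f) =
      eqToHom e ≫ (rightUnitor (ofFunctor J f)).hom := by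
  apply ext_injective
  intro T u a v hs ht
  refine (ext_ofTrans_isoOfEq _ _ _ _ _ _).trans (Eq.trans ?_ (eqToHom_comp_ext _ _ _ _ _ _ _).symm)
  refine Eq.trans ?_ (isoOfMap_hom_ext _ (fst_isRefinement _) _ _ _ _ _).symm
  rw [ofFunctor_app]

theorem ofTrans_associator (f : InternalFunctor X Y) (g : InternalFunctor Y Z)
    (h : InternalFunctor Z W)
    (e : ofFunctor J ((f.comp g).comp h) = comp (comp (ofFunctor J f) (ofFunctor J g))
      (ofFunctor J h))
    (e' : comp (ofFunctor J f) (comp (ofFunctor J g) (ofFunctor J h)) =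
      ofFunctor J (f.comp (g.comp h))) :
    (ofTrans J (InternalFunctor.isoOfEq ((f.comp g).comp h) (f.comp (g.comp h))
        (InternalFunctor.ext (Category.assoc _ _ _) (Category.assoc _ _ _))).hom :
        ofFunctor J ((f.comp g).comp h) ⟶ ofFunctor J (f.comp (g.comp h))) =
      eqToHom e ≫ (associator (ofFunctor J f) (ofFunctor J g) (ofFunctor J h)).hom ≫
        eqToHom e' := by
  apply ext_injective
  intro T u a v hs ht
  refine (ext_ofTrans_isoOfEq _ _ _ _ _ _).trans (Eq.trans ?_ (eqToHom_conj _ _ _ _ _ _ _ _).symm)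
  refine Eq.trans ?_ (isoOfMap_hom_ext _ (assocMap_isRefinement _ _ _) _ _ _ _ _).symm
  refine Eq.trans ?_ (comp_app_eq _ _ _ _ _ _ _).symm
  refine Eq.trans ?_ (comp_ofFunctor_app _ _ _ _ _ _ _).symm
  rw [ofFunctor_app, ofFunctor_app]
  simp only [Category.assoc]

end Anafunctor

/-! ### The strict 2-functors on `Cat(S)` and on `C` -/

section AlphaCat

open Bicategory

variable (J : UnarySite S) [J.IsSubcanonical]

/-- This lemma and those that follow rephrase the computations with anafunctors in the notation of
the two bicategories, where they hold by unfolding definitions. In this form they serve both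
`alphaCatStrict` and `alphaStrict`. -/
theorem alphaCat_map₂_id {X Y : InternalCat S} (f : X ⟶ Y) :
    (alphaCat J).map₂ (𝟙 f) = 𝟙 ((alphaCat J).map f) :=
  Anafunctor.ofTrans_id f

theorem alphaCat_map₂_comp {X Y : InternalCat S} {f g h : X ⟶ Y} (α : f ⟶ g) (β : g ⟶ h) :
    (alphaCat J).map₂ (α ≫ β) = (alphaCat J).map₂ α ≫ (alphaCat J).map₂ β :=
  Anafunctor.ofTrans_vcomp α β

theorem alphaCat_map_id (X : InternalCat S) :
    (alphaCat J).map (𝟙 X) = 𝟙 ((alphaCat J).obj X) :=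
  Anafunctor.ofFunctor_id J X

theorem alphaCat_map_comp {X Y Z : InternalCat S} (f : X ⟶ Y) (g : Y ⟶ Z) :
    (alphaCat J).map (f ≫ g) = (alphaCat J).map f ≫ (alphaCat J).map g :=
  Anafunctor.ofFunctor_comp f g

theorem alphaCat_map₂_whiskerLeft {X Y Z : InternalCat S} (f : X ⟶ Y) {g h : Y ⟶ Z}
    (β : g ⟶ h) : (alphaCat J).map₂ (f ◁ β) = eqToHom (alphaCat_map_comp J f g) ≫
      (alphaCat J).map f ◁ (alphaCat J).map₂ β ≫ eqToHom (alphaCat_map_comp J f h).symm :=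
  Anafunctor.ofTrans_whiskerLeft f β

theorem alphaCat_map₂_whiskerRight {X Y Z : InternalCat S} {f g : X ⟶ Y} (α : f ⟶ g)
    (h : Y ⟶ Z) : (alphaCat J).map₂ (α ▷ h) = eqToHom (alphaCat_map_comp J f h) ≫
      (alphaCat J).map₂ α ▷ (alphaCat J).map h ≫ eqToHom (alphaCat_map_comp J g h).symm :=
  Anafunctor.ofTrans_whiskerRight α h

theorem alphaCat_map₂_leftUnitor {X Y : InternalCat S} (f : X ⟶ Y)
    (e : (alphaCat J).map (𝟙 X ≫ f) = 𝟙 ((alphaCat J).obj X) ≫ (alphaCat J).map f) :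
    (alphaCat J).map₂ (λ_ f).hom = eqToHom e ≫ (λ_ ((alphaCat J).map f)).hom :=
  Anafunctor.ofTrans_leftUnitor f e

theorem alphaCat_map₂_rightUnitor {X Y : InternalCat S} (f : X ⟶ Y)
    (e : (alphaCat J).map (f ≫ 𝟙 Y) = (alphaCat J).map f ≫ 𝟙 ((alphaCat J).obj Y)) :
    (alphaCat J).map₂ (ρ_ f).hom = eqToHom e ≫ (ρ_ ((alphaCat J).map f)).hom :=
  Anafunctor.ofTrans_rightUnitor f e

theorem alphaCat_map₂_associator {X Y Z W : InternalCat S} (f : X ⟶ Y) (g : Y ⟶ Z) (h : Z ⟶ W)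
    (e : (alphaCat J).map ((f ≫ g) ≫ h) =
      ((alphaCat J).map f ≫ (alphaCat J).map g) ≫ (alphaCat J).map h)
    (e' : (alphaCat J).map f ≫ (alphaCat J).map g ≫ (alphaCat J).map h =
      (alphaCat J).map (f ≫ g ≫ h)) :
    (alphaCat J).map₂ (α_ f g h).hom = eqToHom e ≫
      (α_ ((alphaCat J).map f) ((alphaCat J).map g) ((alphaCat J).map h)).hom ≫ eqToHom e' :=
  Anafunctor.ofTrans_associator f g h e e'

/-- The 2-functor `Cat(S) ⟶ Cat_ana(S, J)`. -/
noncomputable def alphaCatStrict : StrictPseudofunctor (InternalCat S) (CatAna J) :=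
  StrictPseudofunctor.mk'
    { toPrelaxFunctorStruct := alphaCat J
      map₂_id := alphaCat_map₂_id J
      map₂_comp := alphaCat_map₂_comp J
      map_id := alphaCat_map_id J
      map_comp := alphaCat_map_comp J
      map₂_whisker_left := alphaCat_map₂_whiskerLeft J
      map₂_whisker_right := alphaCat_map₂_whiskerRight J
      map₂_left_unitor := fun f => alphaCat_map₂_leftUnitor J f _
      map₂_right_unitor := fun f => alphaCat_map₂_rightUnitor J f _
      map₂_associator := fun f g h => alphaCat_map₂_associator J f g h _ _ }

variable (P : InternalCat S → Prop)

/-- The 2-functor `α_J : C ⟶ C_ana(J)`. -/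
noncomputable def alphaStrict : StrictPseudofunctor (FullCat P) (FullAna J P) :=
  StrictPseudofunctor.mk'
    { toPrelaxFunctorStruct := alpha J P
      map₂_id := fun f => InducedBicategory.hom₂_ext (alphaCat_map₂_id J f.hom)
      map₂_comp := fun α β =>
        InducedBicategory.hom₂_ext (alphaCat_map₂_comp J α.hom β.hom)
      map_id := fun X => InducedBicategory.hom_ext (alphaCat_map_id J X.1)
      map_comp := fun f g => InducedBicategory.hom_ext (alphaCat_map_comp J f.hom g.hom)
      map₂_whisker_left := fun f _ _ β => InducedBicategory.hom₂_ext <|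
        (alphaCat_map₂_whiskerLeft J f.hom β.hom).trans <| by
          -- Passing to the underlying 2-arrow turns vertical composites and `eqToHom`s of
          -- `C_ana(J)` into those of `Cat_ana(S, J)`; whiskerings agree by definition.
          rw [InducedBicategory.Hom.category_comp_hom, InducedBicategory.Hom.category_comp_hom,
            InducedBicategory.eqToHom_hom, InducedBicategory.eqToHom_hom]
          rfl
      map₂_whisker_right := fun α h => InducedBicategory.hom₂_ext <|
        (alphaCat_map₂_whiskerRight J α.hom h.hom).trans <| by
          rw [InducedBicategory.Hom.category_comp_hom, InducedBicategory.Hom.category_comp_hom,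
            InducedBicategory.eqToHom_hom, InducedBicategory.eqToHom_hom]
          rfl
      map₂_left_unitor := fun f => InducedBicategory.hom₂_ext <|
        (alphaCat_map₂_leftUnitor J f.hom (by rw [alphaCat_map_comp, alphaCat_map_id])).trans <| by
          rw [InducedBicategory.Hom.category_comp_hom, InducedBicategory.eqToHom_hom]
          rfl
      map₂_right_unitor := fun f => InducedBicategory.hom₂_ext <|
        (alphaCat_map₂_rightUnitor J f.hom (by rw [alphaCat_map_comp, alphaCat_map_id])).trans <| by
          rw [InducedBicategory.Hom.category_comp_hom, InducedBicategory.eqToHom_hom]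
          rfl
      map₂_associator := fun f g h => InducedBicategory.hom₂_ext <|
        (alphaCat_map₂_associator J f.hom g.hom h.hom (by simp only [alphaCat_map_comp])
          (by simp only [alphaCat_map_comp])).trans <| by
          rw [InducedBicategory.Hom.category_comp_hom, InducedBicategory.Hom.category_comp_hom,
            InducedBicategory.eqToHom_hom, InducedBicategory.eqToHom_hom]
          rfl }

end AlphaCat

/-! ### Commutation with the inclusions -/

/-- A strict pseudofunctor is determined by its action on 0-, 1- and 2-arrows. -/
theorem strictPseudofunctor_ext {B C : Type*} [Bicategory B] [Bicategory C]
    {F G : StrictPseudofunctor B C}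
    (h : F.toPrelaxFunctorStruct = G.toPrelaxFunctorStruct) : F = G := by
  obtain ⟨⟨⟨⟨F, _, _⟩, mI, mC, _, _, _, _, _⟩, _, hI⟩, _, hC⟩ := F
  obtain ⟨⟨⟨⟨G, _, _⟩, mI', mC', _, _, _, _, _⟩, _, hI'⟩, _, hC'⟩ := G
  obtain rfl : F = G := h
  -- Strictness forces the unit comparisons to be the `eqToIso` of the equalities on identities, so
  -- they depend on the common data only. The composition comparisons are treated likewise.
  obtain rfl : @mI = @mI' := by
    funext x
    exact (hI x).trans (hI' x).symm
  obtain rfl : @mC = @mC' := by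
    funext a b c f g
    exact (hC f g).trans (hC' f g).symm
  rfl

theorem strictPseudofunctor_comp_toPrelaxFunctorStruct {B C D : Type*} [Bicategory B] [Bicategory C]
    [Bicategory D] (F : StrictPseudofunctor B C) (G : StrictPseudofunctor C D) :
    (F.comp G).toPrelaxFunctorStruct =
      F.toPrelaxFunctorStruct.comp G.toPrelaxFunctorStruct :=
  rfl

theorem alphaCatStrict_toPrelaxFunctorStruct (J : UnarySite S) [J.IsSubcanonical] :
    (alphaCatStrict J).toPrelaxFunctorStruct = alphaCat J :=
  rfl

theorem alphaStrict_toPrelaxFunctorStruct (J : UnarySite S) [J.IsSubcanonical]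
    (P : InternalCat S → Prop) : (alphaStrict J P).toPrelaxFunctorStruct = alpha J P :=
  rfl

/-- The restricted data are defined by wrapping those of `alphaCat`, and the inclusion unwraps them.
-/
theorem alpha_comp_inclusion (J : UnarySite S) [J.IsSubcanonical]
    (P : InternalCat S → Prop) : (alpha J P).comp (FullAna.inclusion J P).toPrelaxFunctorStruct =
    (FullCat.inclusion P).toPrelaxFunctorStruct.comp (alphaCat J) := rfl

/-- Reducing to the underlying prelax data avoids any comparison of the structure isomorphisms of
the two composites. -/
theorem alphaStrict_comp_inclusion (J : UnarySite S) [J.IsSubcanonical]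
    (P : InternalCat S → Prop) :
    (alphaStrict J P).comp (FullAna.inclusion J P) =
      (FullCat.inclusion P).comp (alphaCatStrict J) := by
  apply strictPseudofunctor_ext
  rw [strictPseudofunctor_comp_toPrelaxFunctorStruct,
    strictPseudofunctor_comp_toPrelaxFunctorStruct, alphaStrict_toPrelaxFunctorStruct,
    alphaCatStrict_toPrelaxFunctorStruct, alpha_comp_inclusion]

/-! ### `J`-equivalences are sent to equivalences -/

/-- The uniqueness half of the universal property. It reduces equations between arrows of `X` with
the same ends to their images in `Y`. -/
theorem InternalFunctor.FullyFaithful.hom_ext {X Y : InternalCat S} {f : InternalFunctor X Y}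
    (hf : f.FullyFaithful) {T : S} {a b : T ⟶ X.arr} (hs : a ≫ X.s = b ≫ X.s)
    (ht : a ≫ X.t = b ≫ X.t) (h : a ≫ f.arr = b ≫ f.arr) : a = b :=
  (hf (b ≫ X.s) (b ≫ X.t) (b ≫ f.arr) (by rw [Category.assoc, f.arr_s, Category.assoc])
    (by rw [Category.assoc, f.arr_t, Category.assoc])).unique ⟨hs, ht, h⟩ ⟨rfl, rfl, rfl⟩

namespace Anafunctor

open UnarySite

variable {J : UnarySite S} {X Y W : InternalCat S}

variable [J.IsSubcanonical]

/-- Two mutually inverse families give an invertible transformation. -/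
@[reducible] noncomputable def isoOfFam {A B : Anafunctor J X Y} (F : Fam A B) (G : Fam B A)
    (hFG : ∀ {T : S} (u : T ⟶ A.U) (b : T ⟶ X.arr) (w : T ⟶ B.U) (c : T ⟶ X.arr) (v : T ⟶ A.U)
      (hb : b ≫ X.s = u ≫ A.p) (hb' : b ≫ X.t = w ≫ B.p) (hc : c ≫ X.s = w ≫ B.p)
      (hc' : c ≫ X.t = v ≫ A.p),
      Y.comp (F.app u b w hb hb') (G.app w c v hc hc') (by rw [F.app_t, G.app_s]) =
        A.app u (X.comp b c (by rw [hb', hc])) v (by rw [X.comp_s, hb]) (by rw [X.comp_t, hc']))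
    (hGF : ∀ {T : S} (u : T ⟶ B.U) (b : T ⟶ X.arr) (w : T ⟶ A.U) (c : T ⟶ X.arr) (v : T ⟶ B.U)
      (hb : b ≫ X.s = u ≫ B.p) (hb' : b ≫ X.t = w ≫ A.p) (hc : c ≫ X.s = w ≫ A.p)
      (hc' : c ≫ X.t = v ≫ B.p),
      Y.comp (G.app u b w hb hb') (F.app w c v hc hc') (by rw [G.app_t, F.app_s]) =
        B.app u (X.comp b c (by rw [hb', hc])) v (by rw [X.comp_s, hb]) (by rw [X.comp_t, hc'])) :
    A ≅ B where
  hom := ofFam F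
  inv := ofFam G
  hom_inv_id := by
    -- A middle object `w` over the source of `a` exists only locally, on the cover of `B`; with it
    -- chosen, the composite is `F(u, id, w) ; G(w, a, v)`.
    refine ext_local B.cover fun u a v hs ht w hw => ?_
    refine (ext_comp_src _ _ u a w v hs ht hw).trans (Eq.trans ?_ (ext_id _ _ _ _ _ _).symm)
    refine (Y.comp_congr (ext_ofFam _ _ _ _ _ _) (ext_ofFam _ _ _ _ _ _) _).trans ?_
    exact (hFG _ _ _ _ _ _ _ _ _).trans
      (app_congr _ _ _ _ _ _ rfl (X.id_comp _ _ (by simp [X.e_t, hs])) rfl)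
  inv_hom_id := by
    refine ext_local A.cover fun u a v hs ht w hw => ?_
    refine (ext_comp_src _ _ u a w v hs ht hw).trans (Eq.trans ?_ (ext_id _ _ _ _ _ _).symm)
    refine (Y.comp_congr (ext_ofFam _ _ _ _ _ _) (ext_ofFam _ _ _ _ _ _) _).trans ?_
    exact (hGF _ _ _ _ _ _ _ _ _).trans
      (app_congr _ _ _ _ _ _ rfl (X.id_comp _ _ (by simp [X.e_t, hs])) rfl)

/-! ### Lifting transformations along a fully faithful functor -/

section Lift

variable {f : InternalFunctor X Y}

/-- The value `φ(u, a, v)` is an arrow of `Y` whose ends are the images under `f` of the objects of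
`X` assigned to `u` and `v`. Full faithfulness for generalised elements lifts it over `T` itself,
without passing to a cover. -/
theorem exists_lift (hf : f.FullyFaithful) {A B : Anafunctor J W X}
    (φ : A.postcomp f ⟶ B.postcomp f) {T : S} (u : T ⟶ A.U) (a : T ⟶ W.arr) (v : T ⟶ B.U)
    (hs : a ≫ W.s = u ≫ A.p) (ht : a ≫ W.t = v ≫ B.p) :
    ∃ d : T ⟶ X.arr, d ≫ X.s = u ≫ A.functor.obj ∧
      d ≫ X.t = v ≫ B.functor.obj ∧ d ≫ f.arr = ext φ u a v hs ht :=
  (hf (u ≫ A.functor.obj) (v ≫ B.functor.obj) (ext φ u a v hs ht)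
    ((ext_s' φ u a v hs ht).trans (Category.assoc _ _ _).symm)
    ((ext_t' φ u a v hs ht).trans (Category.assoc _ _ _).symm)).exists

/-- The lift of a transformation along a fully faithful functor. -/
noncomputable def liftFam (hf : f.FullyFaithful) {A B : Anafunctor J W X}
    (φ : A.postcomp f ⟶ B.postcomp f) : Fam A B where
  app u a v hs ht := (exists_lift hf φ u a v hs ht).choose
  app_s u a v hs ht := (exists_lift hf φ u a v hs ht).choose_spec.1
  app_t u a v hs ht := (exists_lift hf φ u a v hs ht).choose_spec.2.1
  comp_app u a v hs ht r := by
    have h := (exists_lift hf φ u a v hs ht).choose_spec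
    have h' := (exists_lift hf φ (r ≫ u) (r ≫ a) (r ≫ v) (by simp [hs])
      (by simp [ht])).choose_spec
    -- As for the other two axioms below, the ends match by construction, and after applying `f` the
    -- claim is the corresponding property of the values of `φ`.
    refine hf.hom_ext ?_ ?_ ?_
    · rw [h'.1, Category.assoc, h.1, Category.assoc]
    · rw [h'.2.1, Category.assoc, h.2.1, Category.assoc]
    · rw [h'.2.2, Category.assoc, h.2.2]
      exact comp_ext' φ u a v hs ht r
  pre u' b u a v hs' ht' hs ht k := by
    have h := (exists_lift hf φ u a v hs ht).choose_spec
    have h' := (exists_lift hf φ u' (W.comp b a (by rw [ht', hs])) v (by rw [W.comp_s, hs'])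
      (by rw [W.comp_t, ht])).choose_spec
    refine hf.hom_ext ?_ ?_ ?_
    · rw [h'.1, X.comp_s, app_s]
    · rw [h'.2.1, X.comp_t, h.2.1]
    · rw [h'.2.2, f.map_comp]
      refine (Y.comp_congr (postcomp_app A f u' b u hs' ht').symm h.2.2 _).trans ?_
      exact ext_pre' φ _ _ _ _ _ _ _ _ _ _ _ rfl
  post u a v b v' hs ht hs' ht' k := by
    have h := (exists_lift hf φ u a v hs ht).choose_spec
    have h' := (exists_lift hf φ u (W.comp a b (by rw [ht, hs'])) v' (by rw [W.comp_s, hs])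
      (by rw [W.comp_t, ht'])).choose_spec
    refine hf.hom_ext ?_ ?_ ?_
    · rw [h'.1, X.comp_s, h.1]
    · rw [h'.2.1, X.comp_t, app_t]
    · rw [h'.2.2, f.map_comp]
      refine (Y.comp_congr h.2.2 (postcomp_app B f v b v' hs' ht').symm _).trans ?_
      exact ext_post' φ _ _ _ _ _ _ _ _ _ _ _ rfl

theorem liftFam_app_arr (hf : f.FullyFaithful) {A B : Anafunctor J W X}
    (φ : A.postcomp f ⟶ B.postcomp f) {T : S} (u : T ⟶ A.U) (a : T ⟶ W.arr) (v : T ⟶ B.U)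
    (hs : a ≫ W.s = u ≫ A.p) (ht : a ≫ W.t = v ≫ B.p) :
    (liftFam hf φ).app u a v hs ht ≫ f.arr = ext φ u a v hs ht :=
  (exists_lift hf φ u a v hs ht).choose_spec.2.2

/-- After applying `f`, the left side becomes the value of `φ ≫ ψ` at `b ; c`, which is that of the
identity. Applied to an isomorphism and its inverse in both orders, this supplies the two hypotheses
of `isoOfFam`. -/
theorem liftFam_comp (hf : f.FullyFaithful) {A B : Anafunctor J W X}
    (φ : A.postcomp f ⟶ B.postcomp f) (ψ : B.postcomp f ⟶ A.postcomp f) (h : φ ≫ ψ = 𝟙 _)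
    {T : S} (u : T ⟶ A.U) (b : T ⟶ W.arr) (w : T ⟶ B.U) (c : T ⟶ W.arr) (v : T ⟶ A.U)
    (hb : b ≫ W.s = u ≫ A.p) (hb' : b ≫ W.t = w ≫ B.p) (hc : c ≫ W.s = w ≫ B.p)
    (hc' : c ≫ W.t = v ≫ A.p) :
    X.comp ((liftFam hf φ).app u b w hb hb') ((liftFam hf ψ).app w c v hc hc')
        (by rw [Fam.app_t, Fam.app_s]) =
      A.app u (W.comp b c (by rw [hb', hc])) v (by rw [W.comp_s, hb]) (by rw [W.comp_t, hc']) := by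
  refine hf.hom_ext ?_ ?_ ?_
  · rw [X.comp_s, Fam.app_s, app_s]
  · rw [X.comp_t, Fam.app_t, app_t]
  · rw [f.map_comp, ← postcomp_app]
    refine (Y.comp_congr (liftFam_app_arr _ _ _ _ _ _ _) (liftFam_app_arr _ _ _ _ _ _ _) _).trans ?_
    refine (ext_comp φ ψ u _ b w c v (by rw [W.comp_s, hb]) (by rw [W.comp_t, hc']) hb hb' hc hc'
      rfl).symm.trans ?_
    rw [h]
    exact ext_id (A.postcomp f) _ _ _ _ _

/-- Invertible transformations lift along fully faithful functors. -/
noncomputable def liftIso (hf : f.FullyFaithful) {A B : Anafunctor J W X}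
    (φ : A.postcomp f ≅ B.postcomp f) : A ≅ B :=
  isoOfFam (liftFam hf φ.hom) (liftFam hf φ.inv) (liftFam_comp hf _ _ φ.hom_inv_id)
    (liftFam_comp hf _ _ φ.inv_hom_id)

end Lift

end Anafunctor

namespace Anafunctor

open UnarySite

/-! ### Anafunctors isomorphic to the identity -/

section CounitIso

variable {J : UnarySite S} {X Y : InternalCat S} (A : Anafunctor J Y Y)
  (τ : A.functor ≅ J.baseProj Y A.p A.cover)

theorem baseProj_iso_hom_s : InternalTrans.app τ.hom ≫ Y.s = A.functor.obj :=
  InternalTrans.app_s τ.hom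

theorem baseProj_iso_hom_t : InternalTrans.app τ.hom ≫ Y.t = A.p :=
  InternalTrans.app_t τ.hom

theorem baseProj_iso_inv_s : InternalTrans.app τ.inv ≫ Y.s = A.p :=
  InternalTrans.app_s τ.inv

theorem baseProj_iso_inv_t : InternalTrans.app τ.inv ≫ Y.t = A.functor.obj :=
  InternalTrans.app_t τ.inv

variable {T : S} (u : T ⟶ A.U) (a : T ⟶ Y.arr) (v : T ⟶ A.U)
    (hs : a ≫ Y.s = u ≫ A.p) (ht : a ≫ Y.t = v ≫ A.p)

/-- Naturality of `τ` at the arrow `(u, a, v)` of `Y[U]`, which the canonical functor sends to `a`.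
-/
theorem baseProj_iso_hom_nat :
    Y.comp (A.app u a v hs ht) (v ≫ InternalTrans.app τ.hom)
        (by rw [app_t, Category.assoc, baseProj_iso_hom_s]) =
      Y.comp (u ≫ InternalTrans.app τ.hom) a
        (by rw [Category.assoc, baseProj_iso_hom_t, hs]) := by
  have n := InternalTrans.nat τ.hom (J.el A.cover u a v hs ht)
  refine Eq.trans (Y.comp_congr rfl ?_ _) (n.trans (Y.comp_congr ?_ ?_ _))
  · exact congrArg (· ≫ _) (J.el_T A.cover u a v hs ht).symm
  · exact congrArg (· ≫ _) (J.el_S A.cover u a v hs ht)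
  · exact J.el_A A.cover u a v hs ht

theorem baseProj_iso_inv_nat :
    Y.comp a (v ≫ InternalTrans.app τ.inv) (by rw [Category.assoc, baseProj_iso_inv_s, ht]) =
      Y.comp (u ≫ InternalTrans.app τ.inv) (A.app u a v hs ht)
        (by rw [app_s, Category.assoc, baseProj_iso_inv_t]) := by
  have n := InternalTrans.nat τ.inv (J.el A.cover u a v hs ht)
  refine Eq.trans (Y.comp_congr ?_ ?_ _) (n.trans (Y.comp_congr ?_ rfl _))
  · exact (J.el_A A.cover u a v hs ht).symm
  · exact congrArg (· ≫ _) (J.el_T A.cover u a v hs ht).symm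
  · exact congrArg (· ≫ _) (J.el_S A.cover u a v hs ht)

theorem baseProj_iso_hom_inv :
    Y.comp (u ≫ InternalTrans.app τ.hom) (u ≫ InternalTrans.app τ.inv)
        (by rw [Category.assoc, Category.assoc, baseProj_iso_hom_t, baseProj_iso_inv_s]) =
      (u ≫ A.functor.obj) ≫ Y.e := by
  have h := congrArg (fun τ => u ≫ InternalTrans.app τ) τ.hom_inv_id
  exact (Y.precomp _ _ _ _).symm.trans (h.trans (Category.assoc _ _ _).symm)

theorem baseProj_iso_inv_hom :
    Y.comp (u ≫ InternalTrans.app τ.inv) (u ≫ InternalTrans.app τ.hom)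
        (by rw [Category.assoc, Category.assoc, baseProj_iso_inv_t, baseProj_iso_hom_s]) =
      (u ≫ A.p) ≫ Y.e := by
  have h := congrArg (fun τ => u ≫ InternalTrans.app τ) τ.inv_hom_id
  exact (Y.precomp _ _ _ _).symm.trans (h.trans (Category.assoc _ _ _).symm)

/-- The family `τ(u) ; a`, for a natural isomorphism `τ` from the functor of an anafunctor to the
canonical functor `Y[U] ⟶ Y`. -/
noncomputable def toIdFam : Fam A (id J Y) where
  app u a v hs ht := Y.comp (u ≫ InternalTrans.app τ.hom) a
    (by rw [Category.assoc, baseProj_iso_hom_t, hs])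
  app_s u a v hs ht := by rw [Y.comp_s, Category.assoc, baseProj_iso_hom_s]
  app_t u a v hs ht := by rw [Y.comp_t, ht]
  comp_app u a v hs ht r := by
    rw [Y.precomp]
    exact Y.comp_congr (Category.assoc _ _ _).symm rfl _
  pre u' b u a v hs' ht' hs ht h := by
    -- Writing `F` for the functor of `A`, naturality of `τ` carries `F(b)` across: `F(b) ; τ(u) ; a
    -- = τ(u') ; b ; a`. The other axiom, `post`, is mere associativity.
    refine (Y.comp_assoc _ _ _ (by rw [app_t, Category.assoc, baseProj_iso_hom_s])
      (by rw [Y.comp_t, Category.assoc, baseProj_iso_hom_t, hs])).symm.trans ?_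
    refine (Y.comp_congr (A.baseProj_iso_hom_nat τ u' b u hs' ht') rfl _).trans ?_
    exact Y.comp_assoc _ _ _ _ _
  post u a v b v' hs ht hs' ht' h := by
    refine (Y.comp_congr rfl (id_app v b v' hs' ht') _).trans ?_
    exact Y.comp_assoc _ _ _ _ _

/-- The family `a ; τ⁻¹(v)`, for a natural isomorphism `τ` from the functor of an anafunctor to the
canonical functor `Y[U] ⟶ Y`. -/
noncomputable def fromIdFam : Fam (id J Y) A where
  app u a v hs ht := Y.comp a (v ≫ InternalTrans.app τ.inv)
    (by rw [Category.assoc, baseProj_iso_inv_s, ht])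
  app_s u a v hs ht := by rw [Y.comp_s, hs]
  app_t u a v hs ht := by rw [Y.comp_t, Category.assoc, baseProj_iso_inv_t]
  comp_app u a v hs ht r := by
    rw [Y.precomp]
    exact Y.comp_congr rfl (Category.assoc _ _ _).symm _
  pre u' b u a v hs' ht' hs ht h := by
    refine (Y.comp_congr (id_app u' b u hs' ht') rfl _).trans ?_
    exact (Y.comp_assoc _ _ _ (by rw [ht', hs])
      (by rw [Y.comp_t, Category.assoc, baseProj_iso_inv_s, ht])).symm
  post u a v b v' hs ht hs' ht' h := by
    -- Dually to `toIdFam`, naturality of `τ⁻¹` is needed on this side: `a ; τ⁻¹(v) ; F(b) = a ; b ;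
    -- τ⁻¹(v')`.
    refine (Y.comp_assoc _ _ _ (by rw [Category.assoc, baseProj_iso_inv_s, ht]) _).trans ?_
    refine (Y.comp_congr rfl (A.baseProj_iso_inv_nat τ v b v' hs' ht').symm _).trans ?_
    exact (Y.comp_assoc _ _ _ (by rw [ht, hs'])
      (by rw [Y.comp_t, Category.assoc, baseProj_iso_inv_s, ht'])).symm

variable [J.IsSubcanonical]

/-- An anafunctor whose functor is isomorphic to the canonical functor `Y[U] ⟶ Y` is isomorphic to
the identity. -/
noncomputable def isoId : A ≅ id J Y :=
  isoOfFam (A.toIdFam τ) (A.fromIdFam τ)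
    (fun u b w c v hb hb' hc hc' => by
      have h₁ : (u ≫ InternalTrans.app τ.hom) ≫ Y.t = b ≫ Y.s := by
        rw [Category.assoc, baseProj_iso_hom_t, hb]
      have h₂ : c ≫ Y.t = (v ≫ InternalTrans.app τ.inv) ≫ Y.s := by
        rw [Category.assoc, baseProj_iso_inv_s, hc']
      have h₃ : b ≫ Y.t = c ≫ Y.s := by rw [hb', hc]
      have hs : Y.comp b c h₃ ≫ Y.s = u ≫ A.p := by rw [Y.comp_s, hb]
      have ht : Y.comp b c h₃ ≫ Y.t = v ≫ A.p := by rw [Y.comp_t, hc']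
      change Y.comp (Y.comp (u ≫ InternalTrans.app τ.hom) b h₁)
        (Y.comp c (v ≫ InternalTrans.app τ.inv) h₂) _ = A.app u (Y.comp b c h₃) v hs ht
      -- The computation is `τ(u) ; b ; c ; τ⁻¹(v) = τ(u) ; τ⁻¹(u) ; F(b ; c) = F(b ; c)`, where `F`
      -- is the functor of `A`.
      refine (Y.comp_assoc _ _ _ h₁ (by rw [Y.comp_t, Y.comp_s, h₃])).trans ?_
      refine (Y.comp_congr rfl (Y.comp_assoc _ _ _ h₃ (by rw [Y.comp_t, h₂])).symm _).trans ?_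
      refine (Y.comp_congr rfl (A.baseProj_iso_inv_nat τ u _ v hs ht) _).trans ?_
      refine (Y.comp_assoc _ _ _ (by
        rw [Category.assoc, Category.assoc, baseProj_iso_hom_t, baseProj_iso_inv_s])
        (by rw [Y.comp_t, Category.assoc, baseProj_iso_inv_t, app_s])).symm.trans ?_
      exact Y.id_comp' _ _ (A.baseProj_iso_hom_inv τ u))
    (fun u b w c v hb hb' hc hc' => by
      have h₁ : b ≫ Y.t = (w ≫ InternalTrans.app τ.inv) ≫ Y.s := by
        rw [Category.assoc, baseProj_iso_inv_s, hb']
      have h₂ : (w ≫ InternalTrans.app τ.hom) ≫ Y.t = c ≫ Y.s := by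
        rw [Category.assoc, baseProj_iso_hom_t, hc]
      have h₃ : (w ≫ InternalTrans.app τ.inv) ≫ Y.t = (w ≫ InternalTrans.app τ.hom) ≫ Y.s := by
        rw [Category.assoc, Category.assoc, baseProj_iso_inv_t, baseProj_iso_hom_s]
      rw [id_app]
      -- In the other order the two components cancel at `w` directly: `b ; τ⁻¹(w) ; τ(w) ; c = b ;
      -- c`. Naturality is not needed.
      refine (Y.comp_assoc _ _ _ h₁
        ((Y.comp_t _ _ h₁).trans (h₃.trans (Y.comp_s _ _ h₂).symm))).trans ?_
      refine Y.comp_congr rfl ?_ _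
      refine (Y.comp_assoc _ _ _ h₃ (by rw [Y.comp_t, h₂])).symm.trans ?_
      exact Y.id_comp' _ _ (A.baseProj_iso_inv_hom τ w))

end CounitIso

end Anafunctor

/-! ### Unit, counit and the resulting equivalence -/

section Equivalence

open Bicategory

/-- If `g ≫ f` is isomorphic to the identity, then `f` is isomorphic to `(f ≫ g) ≫ f`. -/
def idCompIsoOfCounit {B : Type*} [Bicategory B] {x y : B} (f : x ⟶ y) (g : y ⟶ x)
    (e : g ≫ f ≅ 𝟙 y) : 𝟙 x ≫ f ≅ (f ≫ g) ≫ f :=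
  λ_ f ≪≫ (ρ_ f).symm ≪≫ whiskerLeftIso f e.symm ≪≫ (α_ f g f).symm

variable {J : UnarySite S} [J.IsSubcanonical] {X Y : InternalCat S} {f : InternalFunctor X Y}
  (σ : f.LocalSplitting J)

/-- `(U, f̄)` followed by `(X₀, f)` is isomorphic to the identity. -/
noncomputable def InternalFunctor.LocalSplitting.counitIso :
    Anafunctor.comp σ.toAnafunctor (Anafunctor.ofFunctor J f) ≅ Anafunctor.id J Y :=
  -- The composite is literally `(U, f̄ ; f)`, and the isomorphism of the splitting starts at
  -- precisely this functor on `Y[U]`.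
  eqToIso (Anafunctor.comp_ofFunctor _ _) ≪≫
    Anafunctor.isoId (σ.toAnafunctor.postcomp f) σ.iso

/-- `(X₀, f)` followed by `(U, f̄)` is isomorphic to the identity, for fully faithful `f`. -/
noncomputable def InternalFunctor.LocalSplitting.unitIso (hf : f.FullyFaithful) :
    Anafunctor.id J X ≅ Anafunctor.comp (Anafunctor.ofFunctor J f) σ.toAnafunctor :=
  let e : Anafunctor.comp (Anafunctor.id J X) (Anafunctor.ofFunctor J f) ≅
      Anafunctor.comp (Anafunctor.comp (Anafunctor.ofFunctor J f) σ.toAnafunctor)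
        (Anafunctor.ofFunctor J f) :=
    idCompIsoOfCounit (B := CatAna J) (Anafunctor.ofFunctor J f) σ.toAnafunctor σ.counitIso
  -- The ends of `e` are composites with `(X₀, f)`. The equalities `comp_ofFunctor` put them in the
  -- form of a postcomposition with `f`, along which isomorphisms lift.
  Anafunctor.liftIso hf
    ((eqToIso (Anafunctor.comp_ofFunctor _ _)).symm ≪≫ e ≪≫
      eqToIso (Anafunctor.comp_ofFunctor _ _))

/-- `(X₀, f)` and `(U, f̄)` form an equivalence of `C_ana(J)`. -/
noncomputable def alphaEquivalence {P : InternalCat S → Prop} {X Y : FullCat P} (f : X ⟶ Y)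
    (hf : InternalFunctor.FullyFaithful f.hom) (σ : InternalFunctor.LocalSplitting J f.hom) :
    Bicategory.Equivalence ((alpha J P).obj X) ((alpha J P).obj Y) :=
  -- The unit and counit built above need not satisfy the triangle identity, so the counit is
  -- adjusted. Both 1-arrows are untouched, so the pseudoinverse is still `(U, f̄)`. The 2-arrows of
  -- `C_ana(J)` are those of `Cat_ana(S, J)`, hence the isomorphisms can be used as they are.
  Equivalence.mkOfAdjointifyCounit (f := (alpha J P).map f)
    (g := FullAna.ofAnafunctor σ.toAnafunctor)
    (InducedBicategory.isoMk (σ.unitIso hf)) (InducedBicategory.isoMk σ.counitIso)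

end Equivalence

end Anafunctors

open Anafunctors

theorem mainTheorem4 {S : Type u} [Category.{v} S] (J : UnarySite S) [J.IsSubcanonical]
    (P : InternalCat S → Prop) (hP : AdmitsBaseChange J P) :
    ∃ (αS : StrictPseudofunctor (InternalCat S) (CatAna J))
      (α : StrictPseudofunctor (FullCat P) (FullAna J P)),
      -- both are given by `f ↦ (X₀, f)` and `a ↦ a`
      αS.toPrelaxFunctorStruct = alphaCat J ∧
      α.toPrelaxFunctorStruct = alpha J P ∧
      -- `α_J` is the identity on objects
      (∀ X : {X : InternalCat S // P X}, α.obj X = X) ∧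
      -- `α_J` sends `J`-equivalences to equivalences
      (∀ {X Y : FullCat P} (f : X ⟶ Y), InternalFunctor.IsJEquivalence J f.hom →
        ∃ e : Bicategory.Equivalence (α.obj X) (α.obj Y), e.hom = α.map f) ∧
      -- with the anafunctor `(U, f̄)` of any local splitting as a pseudoinverse
      (∀ {X Y : FullCat P} (f : X ⟶ Y), InternalFunctor.FullyFaithful f.hom →
        ∀ σ : InternalFunctor.LocalSplitting J f.hom,
          ∃ e : Bicategory.Equivalence ((alpha J P).obj X) ((alpha J P).obj Y),
            e.hom = (alpha J P).map f ∧ e.inv = FullAna.ofAnafunctor σ.toAnafunctor) ∧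
      -- `α_J` commutes with the inclusions
      α.comp (FullAna.inclusion J P) = (FullCat.inclusion P).comp αS :=
  ⟨alphaCatStrict J, alphaStrict J P, alphaCatStrict_toPrelaxFunctorStruct J,
    alphaStrict_toPrelaxFunctorStruct J P, fun _ => rfl,
    -- A `J`-equivalence only asserts that some local splitting exists, and any choice will do here;
    -- the next component treats a given one.
    fun f hf => ⟨alphaEquivalence f hf.1 hf.2.some, rfl⟩,
    fun f hf σ => ⟨alphaEquivalence f hf σ, rfl, rfl⟩, alphaStrict_comp_inclusion J P⟩
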